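/- **Setting.** Fix block sizes $m_1,\dots,m_s$, $r_1,\dots,r_f$ with $\sum m_i+\sum r_j=n_p$, and consider the discrete-time plant $$\begin{bmatrix}x(k+1)\\q(k)\\e(k)\\y(k)\end{bmatrix}=\begin{bmatrix}A&B_0&B_1&B_2\\C_0&D_{00}&0&D_{02}\\C_1&D_{10}&0&D_{12}\\C_2&D_{20}&D_{21}&0\end{bmatrix}\begin{bmatrix}x(k)\\p(k)\\d(k)\\u(k)\end{bmatrix},\qquad p=\Delta q,$$ with $x(k)\in\mathbb R^n$, $p(k),q(k)\in\mathbb R^{n_p}$, $d(k)\in\mathbb R^{n_d}$, $e(k)\in\mathbb R^{n_e}$, $u(k)\in\mathbb R^{n_u}$, $y(k)\in\mathbb R^{n_y}$. Let $\boldsymbol\Delta$ be the set of $\Delta=\mathrm{diag}\{\delta_1I_{m_1},\dots,\delta_sI_{m_s},\Delta_1,\dots,\Delta_f\}$, where $\delta_i:\ell_2\to\ell_2$ and $\Delta_j:\ell_2^{r_j}\to\ell_2^{r_j}$ are linear operators with induced $\ell_2$ norm at most $1$; $\Delta$ is memoryless if it acts as $p(k)=\Delta(k)q(k)$ with matrices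 $\Delta(k)$ (of the same block form, with blocks of norm at most $1$). Let $\mathcal A$ be the set of matrices $\mathrm{diag}\{D_1,\dots,D_s,d_1I_{r_1},\dots,d_fI_{r_f}\}$ with $D_i\in\mathbb R^{m_i\times m_i}$, $d_j\in\mathbb R$, and $\mathcal D\subset\mathcal A$ those with all $D_i$ symmetric positive definite and all $d_j>0$. A gain-scheduling controller is $$\begin{bmatrix}x_k(k+1)\\u(k)\\q_k(k)\end{bmatrix}=\begin{bmatrix}A_k&B_{k1}&B_{k0}\\C_{k1}&0&D_{k10}\\C_{k0}&0&D_{k00}\end{bmatrix}\begin{bmatrix}x_k(k)\\y(k)\\p_k(k)\end{bmatrix},\qquad p_k=\Delta q_k,$$ with $x_k(k)\in\mathbb R^n$, $p_k(k),q_k(k)\in\mathbb R^{n_p}$ and the same $\Delta$ as the plant. For $f\in\ell_2^{p}$ with Fourier transform $f(\omega)$ and $\eta>0$ write $f\in\mathcal W_\eta$ if $\max_{\sigma\in[0,2\pi]}\big\|\int_0^\sigma f(\omega)f^\star(\omega)\frac{d\omega}{2\pi}-\frac{\sigma\|f\|^2}{2p\pi}I_p\big\|_\infty<\eta$ ($\|\cdot\|_\infty$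 the largest modulus of an entry). The $\mathcal H_2$ norm of $\mathbf T:\ell_2^p\to\ell_2^q$ is $\|\mathbf T\|_2=\sqrt p\,\lim_{\eta\downarrow0}\sup\{\|\mathbf Tf\|:f\in\mathcal W_\eta,\ \|f\|=1\}$. The closed loop has robust $\mathcal H_2$ norm less than $\gamma$ if for every $\Delta\in\boldsymbol\Delta$ each $d\in\ell_2^{n_d}$ determines, with zero initial state, unique signals of the loop in $\ell_2$ depending on $d$ as bounded linear functions, and $\sup_{\Delta\in\boldsymbol\Delta}\|d\mapsto e\|_2<\gamma$. It is exponentially stable if for all memoryless $\Delta\in\boldsymbol\Delta$ the loop is well posed and, for $d=0$, the state $\xi=(x,x_k)$ satisfies $\|\xi(k_0+k)\|\le c\rho^k\|\xi(k_0)\|$ for all $k_0,k\ge0$, with $c>0$ and $\rho\in(0,1)$ independent of $\Delta$ and of the trajectory. **Theorem.** Let $\gamma>0$. Suppose there exist positive definite $T_+,T_-\in\mathbb R^{2n\times2n}$, $Q\in\mathbb R^{n_d\times n_d}$, scalings $L,J\in\mathcal D$, matrices $R,S,U\in\mathbb R^{n\times n}$ and matrices $\hat A_k,\hat B_{k1},\hat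 B_{k0},\hat C_{k1},\hat D_{k10},\hat C_{k0},\hat D_{k00}$ (of the sizes of the corresponding controller matrices) such that, for $T=T_+$ and for $T=T_-$, $$\begin{bmatrix}\begin{pmatrix}S+S^T&I+U^T\\U+I&R^T+R\end{pmatrix}-T&0&G_{31}^T&G_{41}^T&G_{51}^T\\0&\begin{pmatrix}L&I\\I&J\end{pmatrix}&G_{32}^T&G_{42}^T&G_{52}^T\\G_{31}&G_{32}&T&0&0\\G_{41}&G_{42}&0&\begin{pmatrix}L&I\\I&J\end{pmatrix}&0\\G_{51}&G_{52}&0&0&I\end{bmatrix}>0,$$ and $$\begin{bmatrix}Q&H_{21}^T\\H_{21}&T_+-T_-\end{bmatrix}>0,\qquad\mathrm{tr}(Q)<\gamma^2,$$ where, with $\hat K=\begin{bmatrix}\hat A_k&\hat B_{k1}&\hat B_{k0}\\\hat C_{k1}&0&\hat D_{k10}\\\hat C_{k0}&0&\hat D_{k00}\end{bmatrix}$, $$\begin{bmatrix}G_{31}&G_{32}\\G_{41}&G_{42}\\G_{51}&G_{52}\end{bmatrix}=\left[\begin{array}{cc|cc}AS&A&B_0&B_0J\\0&RA&RB_0&0\\\hline0&LC_0&LD_{00}&0\\C_0S&C_0&D_{00}&D_{00}J\\\hline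 C_1S&C_1&D_{10}&D_{10}J\end{array}\right]+\left[\begin{array}{ccc}0&B_2&0\\I&0&0\\\hline0&0&I\\0&D_{02}&0\\\hline0&D_{12}&0\end{array}\right]\hat K\left[\begin{array}{cc|cc}I&0&0&0\\0&C_2&D_{20}&0\\0&0&0&I\end{array}\right],$$ $$H_{21}=\begin{bmatrix}B_1\\RB_1\end{bmatrix}+\begin{bmatrix}0&B_2&0\\I&0&0\end{bmatrix}\hat K\begin{bmatrix}0\\D_{21}\\0\end{bmatrix}.$$ Then there is a gain-scheduling controller for which the closed loop is exponentially stable and has robust $\mathcal H_2$ norm less than $\gamma$. More precisely, there exist $M,N\in\mathbb R^{n\times n}$ and $L_2,J_2\in\mathcal A$ with $MN=U-RS$ and $L_2J_2^T=I-LJ$, and for every such choice the two matrices inverted below are nonsingular and $$\begin{bmatrix}A_k&B_{k1}&B_{k0}\\C_{k1}&0&D_{k10}\\C_{k0}&0&D_{k00}\end{bmatrix}=\begin{bmatrix}M&RB_2&0\\0&I&0\\0&LD_{02}&L_2\end{bmatrix}^{-1}\left(\hat K-\begin{bmatrix}RAS&0&RB_0J\\0&0&0\\LC_0S&0&LD_{00}J\end{bmatrix}\right)\begin{bmatrix}N&0&0\\C_2S&I&D_{20}J\\0&0&J_2^T\end{bmatrix}^{-1}$$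 (the right-hand side has the two zero blocks shown) defines such a controller. -/

import Mathlib

open scoped Real ENNReal Matrix Topology

noncomputable section

namespace RobustH2

/-! ## Signals -/

/-- Square-summable sequences of vectors with real coordinates indexed by `ι`, with the `ℓ₂` norm
of sequences of Euclidean vectors. -/
abbrev Sig (ι : Type) [Fintype ι] : Type :=
  lp (fun _ : ℕ => EuclideanSpace ℝ ι) 2

/-- The vector of coordinates of the signal `f` at time `k`. -/
def Sig.at {ι : Type} [Fintype ι] (f : Sig ι) (k : ℕ) : ι → ℝ := (f k).ofLp

theorem memlp_sub {ι κ : Type} [Fintype ι] [Fintype κ] (f : Sig ι) (g : κ → ι) :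
    Memℓp (fun k => (WithLp.toLp 2 fun a => f.at k (g a) : EuclideanSpace ℝ κ)) 2 := by
  have hf : Memℓp (fun k => (Fintype.card κ : ℝ) * ‖f k‖) 2 :=
    Memℓp.const_mul (Memℓp.norm (lp.memℓp f)) _
  refine hf.mono fun k => ?_
  have h1 : ∀ a, ‖f.at k (g a)‖ ≤ ‖f k‖ := fun a => PiLp.norm_apply_le (f k) (g a)
  have h2 : ‖(WithLp.toLp 2 fun a => f.at k (g a) : EuclideanSpace ℝ κ)‖
      ≤ ∑ a, ‖f.at k (g a)‖ := by
    classical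
    have h3 : (WithLp.toLp 2 fun a => f.at k (g a) : EuclideanSpace ℝ κ)
        = ∑ a, EuclideanSpace.single a (f.at k (g a)) := by
      ext b
      simp [Finset.sum_apply]
    rw [h3]
    refine (norm_sum_le _ _).trans (le_of_eq ?_)
    simp
  refine h2.trans ((Finset.sum_le_sum fun a _ => h1 a).trans ?_)
  simp

/-- The signal whose coordinate `a` is the coordinate `g a` of `f`. -/
def Sig.sub {ι κ : Type} [Fintype ι] [Fintype κ] (f : Sig ι) (g : κ → ι) : Sig κ :=
  ⟨fun k => WithLp.toLp 2 fun a => f.at k (g a), memlp_sub f g⟩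

/-! ## The `H₂` norm of a system on signals -/

instance twoPiPos : Fact (0 < 2 * π) := ⟨Real.two_pi_pos⟩

/-- The Fourier transform `f(ω) = ∑ₖ fₖ e^{-iωk}` of coordinate `i` of the signal `f`: the sum of
the series in `L²` of the circle of length `2π` with its normalized measure. -/
def fourierTransform {ι : Type} [Fintype ι] (f : Sig ι) (i : ι) :
    MeasureTheory.Lp ℂ 2 (@AddCircle.haarAddCircle (2 * π) _) :=
  ∑' k : ℕ, (f.at k i : ℂ) • fourierLp (T := 2 * π) 2 (-(k : ℤ))

/-- The entry `(i, j)` of `∫₀ˢ f(ω) f(ω)* dω / 2π`. -/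
def cumulativeSpectrum {ι : Type} [Fintype ι] (f : Sig ι) (s : ℝ) (i j : ι) : ℂ :=
  ∫ ω in (0 : ℝ)..s, fourierTransform f i (ω : AddCircle (2 * π)) *
    (starRingEnd ℂ) (fourierTransform f j (ω : AddCircle (2 * π))) / ((2 * π : ℝ) : ℂ)

/-- The signals whose cumulative spectrum is within `η` of that of white noise with the same
energy, uniformly in the frequency and over the matrix entries. -/
def whiteSet (ι : Type) [Fintype ι] [DecidableEq ι] (η : ℝ) : Set (Sig ι) :=
  {f | ∃ η' < η, ∀ s ∈ Set.Icc (0 : ℝ) (2 * π), ∀ i j : ι,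
    ‖cumulativeSpectrum f s i j -
      (((s * ‖f‖ ^ 2 / (2 * (Fintype.card ι : ℝ) * π)) • (1 : Matrix ι ι ℝ)) i j : ℝ)‖ ≤ η'}

/-- The gain of a system over the unit-energy signals of `whiteSet ι η`. -/
def whiteGain {ι κ : Type} [Fintype ι] [DecidableEq ι] [Fintype κ]
    (T : Sig ι → Sig κ) (η : ℝ) : ℝ≥0∞ :=
  ⨆ f ∈ {f : Sig ι | f ∈ whiteSet ι η ∧ ‖f‖ = 1}, ‖T f‖ₑ

/-- The `H₂` norm of a (not necessarily linear or time-invariant) system with inputs indexed by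
`ι`: `√p` times the limit of its gain over `whiteSet ι η` as `η` decreases to `0`, where `p` is the
number of inputs. The gain is monotone in `η`, so that the limit is an infimum, see
`tendsto_whiteGain`. -/
def h2Norm {ι κ : Type} [Fintype ι] [DecidableEq ι] [Fintype κ] (T : Sig ι → Sig κ) : ℝ≥0∞ :=
  ENNReal.ofReal (√(Fintype.card ι : ℝ)) * ⨅ η ∈ Set.Ioi (0 : ℝ), whiteGain T η

theorem whiteGain_mono {ι κ : Type} [Fintype ι] [DecidableEq ι] [Fintype κ]
    (T : Sig ι → Sig κ) : Monotone (whiteGain T) := by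
  intro a b hab
  refine biSup_mono fun f hf => ⟨?_, hf.2⟩
  obtain ⟨η', h1, h2⟩ := hf.1
  exact ⟨η', h1.trans_le hab, h2⟩

theorem tendsto_whiteGain {ι κ : Type} [Fintype ι] [DecidableEq ι] [Fintype κ]
    (T : Sig ι → Sig κ) :
    Filter.Tendsto (whiteGain T) (𝓝[>] 0) (𝓝 (⨅ η ∈ Set.Ioi (0 : ℝ), whiteGain T η)) := by
  have h := (whiteGain_mono T).tendsto_nhdsGT (0 : ℝ)
  rwa [sInf_image] at h

/-! ## Structured uncertainty -/

/-- Index set of the uncertainty channel: `s` repeated scalar blocks of sizes `m i`, followed by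
`f` full blocks of sizes `r j`. -/
abbrev Chan {s f : ℕ} (m : Fin s → ℕ) (r : Fin f → ℕ) : Type :=
  (Σ i, Fin (m i)) ⊕ (Σ j, Fin (r j))

/-- The matrix `diag {D₁, …, Dₛ, E₁, …, E_f}`. -/
def blockDiag {s f : ℕ} {m : Fin s → ℕ} {r : Fin f → ℕ}
    (D : ∀ i, Matrix (Fin (m i)) (Fin (m i)) ℝ) (E : ∀ j, Matrix (Fin (r j)) (Fin (r j)) ℝ) :
    Matrix (Chan m r) (Chan m r) ℝ :=
  Matrix.fromBlocks (Matrix.blockDiagonal' D) 0 0 (Matrix.blockDiagonal' E)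

/-- The matrices `diag {D₁, …, Dₛ, d₁ I, …, d_f I}`. -/
def commutantSet {s f : ℕ} (m : Fin s → ℕ) (r : Fin f → ℕ) :
    Set (Matrix (Chan m r) (Chan m r) ℝ) :=
  {X | ∃ (D : ∀ i, Matrix (Fin (m i)) (Fin (m i)) ℝ) (d : Fin f → ℝ),
    X = blockDiag D fun j => d j • 1}

/-- The scaling matrices `diag {D₁, …, Dₛ, d₁ I, …, d_f I}` with all `Dᵢ` symmetric positive
definite and all `dⱼ > 0`. -/
def scalingSet {s f : ℕ} (m : Fin s → ℕ) (r : Fin f → ℕ) :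
    Set (Matrix (Chan m r) (Chan m r) ℝ) :=
  {X | ∃ (D : ∀ i, Matrix (Fin (m i)) (Fin (m i)) ℝ) (d : Fin f → ℝ),
    (∀ i, (D i).PosDef) ∧ (∀ j, 0 < d j) ∧ X = blockDiag D fun j => d j • 1}

/-- Structured uncertainty `Δ = diag {δ₁ I, …, δₛ I, Δ₁, …, Δ_f}` whose blocks are linear operators
on `ℓ₂` of induced norm at most one. A scalar signal is a signal with a single coordinate. -/
structure Uncertainty {s f : ℕ} (m : Fin s → ℕ) (r : Fin f → ℕ) where
  scalar : Fin s → (Sig Unit →L[ℝ] Sig Unit)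
  full : ∀ j : Fin f, Sig (Fin (r j)) →L[ℝ] Sig (Fin (r j))
  scalar_le : ∀ i, ‖scalar i‖ ≤ 1
  full_le : ∀ j, ‖full j‖ ≤ 1

/-- The relation `p = Δ q`. -/
def Uncertainty.Rel {s f : ℕ} {m : Fin s → ℕ} {r : Fin f → ℕ} (Δ : Uncertainty m r)
    (q p : Sig (Chan m r)) : Prop :=
  (∀ (i : Fin s) (a : Fin (m i)),
    p.sub (fun _ : Unit => .inl ⟨i, a⟩) = Δ.scalar i (q.sub fun _ : Unit => .inl ⟨i, a⟩)) ∧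
  ∀ j : Fin f,
    p.sub (fun b : Fin (r j) => .inr ⟨j, b⟩) = Δ.full j (q.sub fun b : Fin (r j) => .inr ⟨j, b⟩)

/-- The relation `p = diag {Δ, Δ} q`. -/
def Uncertainty.Rel₂ {s f : ℕ} {m : Fin s → ℕ} {r : Fin f → ℕ} (Δ : Uncertainty m r)
    (q p : Sig (Chan m r ⊕ Chan m r)) : Prop :=
  Δ.Rel (q.sub Sum.inl) (p.sub Sum.inl) ∧ Δ.Rel (q.sub Sum.inr) (p.sub Sum.inr)

/-- The possible values `diag {δ₁ I, …, δₛ I, Δ₁, …, Δ_f}` at one time of a memoryless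
uncertainty `p(k) = Δ(k) q(k)`: such an uncertainty has induced `ℓ₂` norm at most one exactly if
each of its values has spectral norm at most one. -/
def valueSet {s f : ℕ} (m : Fin s → ℕ) (r : Fin f → ℕ) :
    Set (Matrix (Chan m r) (Chan m r) ℝ) :=
  {X | ∃ (δ : Fin s → ℝ) (E : ∀ j, Matrix (Fin (r j)) (Fin (r j)) ℝ),
    (∀ i, |δ i| ≤ 1) ∧ (∀ j, ‖Matrix.toEuclideanCLM (𝕜 := ℝ) (E j)‖ ≤ 1) ∧
    X = blockDiag (fun i => δ i • 1) E}

/-! ## Uncertain systems in linear fractional form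

A system is given by the matrix `G` of the equations `[x(k+1); q(k); e(k)] = G [x(k); p(k); d(k)]`.
-/

/-- The finite-energy signals `x, q, p, e` solve the equations of the system `G` with the input `d`,
zero initial state and the uncertainty relation `rel q p`. -/
def IsSolution {X P D E : Type} [Fintype X] [Fintype P] [Fintype D] [Fintype E]
    (G : Matrix (X ⊕ P ⊕ E) (X ⊕ P ⊕ D) ℝ) (rel : Sig P → Sig P → Prop)
    (d : Sig D) (x : Sig X) (q p : Sig P) (e : Sig E) : Prop :=
  x.at 0 = 0 ∧
  (∀ k, Sum.elim (x.at (k + 1)) (Sum.elim (q.at k) (e.at k)) =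
    G *ᵥ Sum.elim (x.at k) (Sum.elim (p.at k) (d.at k))) ∧
  rel q p

/-- The robust `H₂` norm of the system `G`, over all uncertainties `Δ : 𝒰` entering through the
relations `rel Δ`, is less than `γ`: for every `Δ` the loop is well posed and stable on signals of
finite energy, that is, each input `d` gives unique signals `x, q, p, e`, which are a bounded linear
function of `d`, and the supremum over `Δ` of the `H₂` norms from `d` to `e` is less than `γ`. -/
def RobustH2NormLT {X P D E 𝒰 : Type} [Fintype X] [Fintype P] [Fintype D] [DecidableEq D]
    [Fintype E] (G : Matrix (X ⊕ P ⊕ E) (X ⊕ P ⊕ D) ℝ) (rel : 𝒰 → Sig P → Sig P → Prop)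
    (γ : ℝ) : Prop :=
  ∃ T : 𝒰 → (Sig D →L[ℝ] Sig X × Sig P × Sig P × Sig E),
    (∀ Δ d x q p e, IsSolution G (rel Δ) d x q p e ↔ (x, q, p, e) = T Δ d) ∧
    ⨆ Δ, h2Norm (fun d => (T Δ d).2.2.2) < ENNReal.ofReal γ

/-- Robust exponential stability of the system `G` for all memoryless uncertainties
`p(k) = Δ(k) q(k)` with values `Δ(k)` in `𝒱`, with a uniform rate: the loop is well posed, and
without input every trajectory decays exponentially. -/
def ExpStable {X P D E : Type} [Fintype X] [Fintype P] [DecidableEq P] [Fintype D]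
    (G : Matrix (X ⊕ P ⊕ E) (X ⊕ P ⊕ D) ℝ) (𝒱 : Set (Matrix P P ℝ)) : Prop :=
  (∀ Δ ∈ 𝒱, IsUnit (1 - G.toBlocks₂₂.toBlocks₁₁ * Δ)) ∧
  ∃ c ρ : ℝ, 0 < c ∧ 0 < ρ ∧ ρ < 1 ∧
    ∀ Δ : ℕ → Matrix P P ℝ, (∀ k, Δ k ∈ 𝒱) →
    ∀ (x : ℕ → X → ℝ) (q p : ℕ → P → ℝ) (e : ℕ → E → ℝ),
      (∀ k, Sum.elim (x (k + 1)) (Sum.elim (q k) (e k)) =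
        G *ᵥ Sum.elim (x k) (Sum.elim (p k) (0 : D → ℝ))) →
      (∀ k, p k = Δ k *ᵥ q k) →
      ∀ k₀ k, ‖x (k₀ + k)‖ ≤ c * ρ ^ k * ‖x k₀‖

/-! ## Plant, controller and closed loop -/

/-- The data of the plant
`[x(k+1); q; e; y] = [A B₀ B₁ B₂; C₀ D₀₀ 0 D₀₂; C₁ D₁₀ 0 D₁₂; C₂ D₂₀ D₂₁ 0] [x; p; d; u]`. -/
structure Plant (n nd ne nu ny : ℕ) (c : Type) where
  A : Matrix (Fin n) (Fin n) ℝ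
  B₀ : Matrix (Fin n) c ℝ
  B₁ : Matrix (Fin n) (Fin nd) ℝ
  B₂ : Matrix (Fin n) (Fin nu) ℝ
  C₀ : Matrix c (Fin n) ℝ
  D₀₀ : Matrix c c ℝ
  D₀₂ : Matrix c (Fin nu) ℝ
  C₁ : Matrix (Fin ne) (Fin n) ℝ
  D₁₀ : Matrix (Fin ne) c ℝ
  D₁₂ : Matrix (Fin ne) (Fin nu) ℝ
  C₂ : Matrix (Fin ny) (Fin n) ℝ
  D₂₀ : Matrix (Fin ny) c ℝ
  D₂₁ : Matrix (Fin ny) (Fin nd) ℝ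

/-- The data of the controller
`[x_k(k+1); u; q_k] = [A_k B_k1 B_k0; C_k1 0 D_k10; C_k0 0 D_k00] [x_k; y; p_k]`. -/
structure Controller (n nu ny : ℕ) (c : Type) where
  A : Matrix (Fin n) (Fin n) ℝ
  B₁ : Matrix (Fin n) (Fin ny) ℝ
  B₀ : Matrix (Fin n) c ℝ
  C₁ : Matrix (Fin nu) (Fin n) ℝ
  D₁₀ : Matrix (Fin nu) c ℝ
  C₀ : Matrix c (Fin n) ℝ
  D₀₀ : Matrix c c ℝ

section Blocks

variable {ι a b c d e : Type}

/-- A block row `[K L M]`. -/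
def row3 (K : Matrix ι a ℝ) (L : Matrix ι b ℝ) (M : Matrix ι c ℝ) : Matrix ι (a ⊕ b ⊕ c) ℝ :=
  Matrix.fromCols K (Matrix.fromCols L M)

/-- A block column `[K; L; M]`. -/
def col3 (K : Matrix a ι ℝ) (L : Matrix b ι ℝ) (M : Matrix c ι ℝ) : Matrix (a ⊕ b ⊕ c) ι ℝ :=
  Matrix.fromRows K (Matrix.fromRows L M)

/-- A block row `[K L | M N]`. -/
def row4 (K : Matrix ι a ℝ) (L : Matrix ι b ℝ) (M : Matrix ι c ℝ) (N : Matrix ι d ℝ) :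
    Matrix ι ((a ⊕ b) ⊕ (c ⊕ d)) ℝ :=
  Matrix.fromCols (Matrix.fromCols K L) (Matrix.fromCols M N)

/-- A block row `[K L | M N | O]`. -/
def row5 (K : Matrix ι a ℝ) (L : Matrix ι b ℝ) (M : Matrix ι c ℝ) (N : Matrix ι d ℝ)
    (O : Matrix ι e ℝ) : Matrix ι ((a ⊕ b) ⊕ (c ⊕ d) ⊕ e) ℝ :=
  row3 (Matrix.fromCols K L) (Matrix.fromCols M N) O

/-- A block column `[K; L | M; N | O]`. -/
def col5 (K : Matrix a ι ℝ) (L : Matrix b ι ℝ) (M : Matrix c ι ℝ) (N : Matrix d ι ℝ)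
    (O : Matrix e ι ℝ) : Matrix ((a ⊕ b) ⊕ (c ⊕ d) ⊕ e) ι ℝ :=
  col3 (Matrix.fromRows K L) (Matrix.fromRows M N) O

end Blocks

section Synthesis

variable {n nd ne nu ny : ℕ} {c : Type} [Fintype c] [DecidableEq c]

/-- The matrix `[A_k B_k1 B_k0; C_k1 0 D_k10; C_k0 0 D_k00]`. -/
def Controller.toMatrix (K : Controller n nu ny c) :
    Matrix (Fin n ⊕ Fin nu ⊕ c) (Fin n ⊕ Fin ny ⊕ c) ℝ :=
  col3 (row3 K.A K.B₁ K.B₀) (row3 K.C₁ 0 K.D₁₀) (row3 K.C₀ 0 K.D₀₀)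

/-- The matrix of the closed loop
`[x; x_k](k+1), [q; q_k](k), e(k) ↤ [x; x_k](k), [p; p_k](k), d(k)`. -/
def closedLoop (G : Plant n nd ne nu ny c) (K : Controller n nu ny c) :
    Matrix ((Fin n ⊕ Fin n) ⊕ (c ⊕ c) ⊕ Fin ne) ((Fin n ⊕ Fin n) ⊕ (c ⊕ c) ⊕ Fin nd) ℝ :=
  col5
    (row5 G.A 0 G.B₀ 0 G.B₁)
    (row5 0 0 0 0 0)
    (row5 G.C₀ 0 G.D₀₀ 0 0)
    (row5 0 0 0 0 0)
    (row5 G.C₁ 0 G.D₁₀ 0 0)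
  + (col5 (row3 0 G.B₂ 0) (row3 1 0 0) (row3 0 G.D₀₂ 0) (row3 0 0 1) (row3 0 G.D₁₂ 0) :
      Matrix ((Fin n ⊕ Fin n) ⊕ (c ⊕ c) ⊕ Fin ne) (Fin n ⊕ Fin nu ⊕ c) ℝ)
    * K.toMatrix
    * (col3 (row5 0 1 0 0 0) (row5 G.C₂ 0 G.D₂₀ 0 G.D₂₁) (row5 0 0 0 1 0) :
      Matrix (Fin n ⊕ Fin ny ⊕ c) ((Fin n ⊕ Fin n) ⊕ (c ⊕ c) ⊕ Fin nd) ℝ)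

/-- The matrix `[G₃₁ G₃₂; G₄₁ G₄₂; G₅₁ G₅₂]` of the synthesis inequalities, an affine function of
the transformed controller data `K`. -/
def gMatrix (G : Plant n nd ne nu ny c) (R S : Matrix (Fin n) (Fin n) ℝ) (L J : Matrix c c ℝ)
    (K : Controller n nu ny c) :
    Matrix ((Fin n ⊕ Fin n) ⊕ (c ⊕ c) ⊕ Fin ne) ((Fin n ⊕ Fin n) ⊕ (c ⊕ c)) ℝ :=
  col5
    (row4 (G.A * S) G.A G.B₀ (G.B₀ * J))
    (row4 0 (R * G.A) (R * G.B₀) 0)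
    (row4 0 (L * G.C₀) (L * G.D₀₀) 0)
    (row4 (G.C₀ * S) G.C₀ G.D₀₀ (G.D₀₀ * J))
    (row4 (G.C₁ * S) G.C₁ G.D₁₀ (G.D₁₀ * J))
  + (col5 (row3 0 G.B₂ 0) (row3 1 0 0) (row3 0 0 1) (row3 0 G.D₀₂ 0) (row3 0 G.D₁₂ 0) :
      Matrix ((Fin n ⊕ Fin n) ⊕ (c ⊕ c) ⊕ Fin ne) (Fin n ⊕ Fin nu ⊕ c) ℝ)
    * K.toMatrix
    * (col3 (row4 1 0 0 0) (row4 0 G.C₂ G.D₂₀ 0) (row4 0 0 0 1) :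
      Matrix (Fin n ⊕ Fin ny ⊕ c) ((Fin n ⊕ Fin n) ⊕ (c ⊕ c)) ℝ)

/-- The matrix `H₂₁`. -/
def hMatrix (G : Plant n nd ne nu ny c) (R : Matrix (Fin n) (Fin n) ℝ)
    (K : Controller n nu ny c) : Matrix (Fin n ⊕ Fin n) (Fin nd) ℝ :=
  Matrix.fromRows G.B₁ (R * G.B₁)
  + (Matrix.fromRows (row3 0 G.B₂ 0) (row3 1 0 0) :
      Matrix (Fin n ⊕ Fin n) (Fin n ⊕ Fin nu ⊕ c) ℝ)
    * K.toMatrix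
    * (col3 0 G.D₂₁ 0 : Matrix (Fin n ⊕ Fin ny ⊕ c) (Fin nd) ℝ)

/-- The matrix of the synthesis inequality for `T`. -/
def lmiMatrix (G : Plant n nd ne nu ny c) (R S U : Matrix (Fin n) (Fin n) ℝ)
    (L J : Matrix c c ℝ) (K : Controller n nu ny c)
    (T : Matrix (Fin n ⊕ Fin n) (Fin n ⊕ Fin n) ℝ) :
    Matrix (((Fin n ⊕ Fin n) ⊕ (c ⊕ c)) ⊕ ((Fin n ⊕ Fin n) ⊕ (c ⊕ c) ⊕ Fin ne))
      (((Fin n ⊕ Fin n) ⊕ (c ⊕ c)) ⊕ ((Fin n ⊕ Fin n) ⊕ (c ⊕ c) ⊕ Fin ne)) ℝ :=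
  Matrix.fromBlocks
    (Matrix.fromBlocks (Matrix.fromBlocks (S + Sᵀ) (1 + Uᵀ) (U + 1) (Rᵀ + R) - T) 0
      0 (Matrix.fromBlocks L 1 1 J))
    (gMatrix G R S L J K)ᵀ
    (gMatrix G R S L J K)
    (Matrix.fromBlocks T 0
      0 (Matrix.fromBlocks (Matrix.fromBlocks L 1 1 J) 0 0 1))

/-- The left factor `[M RB₂ 0; 0 I 0; 0 LD₀₂ L₂]` of the change of controller variables. -/
def leftFactor (G : Plant n nd ne nu ny c) (R M : Matrix (Fin n) (Fin n) ℝ)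
    (L L₂ : Matrix c c ℝ) : Matrix (Fin n ⊕ Fin nu ⊕ c) (Fin n ⊕ Fin nu ⊕ c) ℝ :=
  col3 (row3 M (R * G.B₂) 0) (row3 0 1 0) (row3 0 (L * G.D₀₂) L₂)

/-- The right factor `[N 0 0; C₂S I D₂₀J; 0 0 J₂ᵀ]` of the change of controller variables. -/
def rightFactor (G : Plant n nd ne nu ny c) (S N : Matrix (Fin n) (Fin n) ℝ)
    (J J₂ : Matrix c c ℝ) : Matrix (Fin n ⊕ Fin ny ⊕ c) (Fin n ⊕ Fin ny ⊕ c) ℝ :=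
  col3 (row3 N 0 0) (row3 (G.C₂ * S) 1 (G.D₂₀ * J)) (row3 0 0 J₂ᵀ)

/-- The constant term `[RAS 0 RB₀J; 0 0 0; LC₀S 0 LD₀₀J]` of the change of controller variables. -/
def shiftTerm (G : Plant n nd ne nu ny c) (R S : Matrix (Fin n) (Fin n) ℝ) (L J : Matrix c c ℝ) :
    Matrix (Fin n ⊕ Fin nu ⊕ c) (Fin n ⊕ Fin ny ⊕ c) ℝ :=
  col3 (row3 (R * G.A * S) 0 (R * G.B₀ * J)) (row3 0 0 0) (row3 (L * G.C₀ * S) 0 (L * G.D₀₀ * J))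

end Synthesis

/-- The closed loop of the plant with the controller, both scheduled by the same uncertainty, is
robustly exponentially stable and has robust `H₂` norm less than `γ`. -/
def Achieves {n nd ne nu ny s f : ℕ} {m : Fin s → ℕ} {r : Fin f → ℕ}
    (G : Plant n nd ne nu ny (Chan m r)) (K : Controller n nu ny (Chan m r)) (γ : ℝ) : Prop :=
  ExpStable (closedLoop G K) {X | ∃ Δ ∈ valueSet m r, X = Matrix.fromBlocks Δ 0 0 Δ} ∧
  RobustH2NormLT (closedLoop G K) (Uncertainty.Rel₂ (m := m) (r := r)) γ

end RobustH2

end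

noncomputable section

set_option linter.unusedSectionVars false

namespace RobustH2

/-! ## Operators on signals -/

section Signals

variable {ι κ μ : Type} [Fintype ι] [Fintype κ] [Fintype μ]

/-! The synthesis inequalities are analysis inequalities for the closed loop, seen through
congruences. Put `F = [1 0; R M]`, `Y = [S 1; N 0]`, `H = [L L₂; 1 0]`, `Z = [1 J; 0 J₂ᵀ]`. The
factorizations of `U - RS` and `I - LJ` say exactly that `F Y = V := [S 1; U R]` and `H Z = Ω := [L
1; 1 J]`. The inequalities force `V` and `Ω` to be invertible, hence all four factors are. In the
original controller variables, the matrix of blocks `Gᵢⱼ` is the disturbance-free closed loop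
multiplied by `F`, `H`, `1` on the left and by `Y`, `Z` on the right (`gMatrix_transform_mulVec`). A
Schur complement together with `V + Vᵀ - T ≤ Vᵀ T⁻¹ V` then yields strict dissipation with storages
`Σ± = Fᵀ T±⁻¹ F` and scaling `Θ = Hᵀ Ω⁻¹ H` (`dissipative_of_posDef`). The blocks of `Θ` commute
with the uncertainty structure, so `⟨p, Θp⟩ ≤ ⟨q, Θq⟩` whenever `p = diag {Δ, Δ} q`
(`Uncertainty.inner_op_le`). Exponential stability follows because the storage contracts along
trajectories, and well-posedness on `ℓ₂` because the loop operator contracts the form of storage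
plus scaling.

The `H₂` bound is the delicate part. `Δ` need not be causal, so the predicted state `z(k) = A x(k) +
B₀ p(k)` may be correlated with `d(k)`, and the cross term `2⟨z, Σ B₁ d⟩` of a storage argument does
not vanish. The second storage `Σ₋ > Σ₊` controls it. Choose a storage `Σ ≤ Σ₊` of nearly minimal
trace; it is almost fixed by the Riccati map. With the gain `K` and weight `R` obtained by
completing the square in `p`, the form `Σ₋ - Σ` contracts under `A + B₀K`, and by duality `(Σ₋ -
Σ)⁻¹` satisfies a covariance inequality for the adjoint system (`exists_certificate`). The cross
term is rewritten with an adjoint state `w`, driven by `Σ B₁ d` and running backwards in time;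
Young's inequality spends the slack `R` and leaves `‖e‖² ≤ ⟨d, Y₀ d⟩ + 2⟨d, Y₁ (advance w)⟩`
(`Certificate.inner_out_le`).

Now `advance w` involves only strictly future values of `d`. A nearly white signal is nearly
uncorrelated with its own advances (`abs_corr_sub_le`), so asymptotically the energy is at most `tr
Y₀ / n_d`. The inequality for `Q` gives `tr Y₀ ≤ tr Q < γ²`, with all estimates uniform in `Δ`. -/

theorem Sig.ext_at {f g : Sig ι} (h : ∀ k, f.at k = g.at k) : f = g := by
  apply lp.ext
  funext k
  exact (WithLp.ofLp_injective 2) (h k)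

@[simp] theorem Sig.at_add (f g : Sig ι) (k : ℕ) : (f + g).at k = f.at k + g.at k := rfl
@[simp] theorem Sig.at_zero (k : ℕ) : (0 : Sig ι).at k = 0 := rfl
@[simp] theorem Sig.at_smul (c : ℝ) (f : Sig ι) (k : ℕ) : (c • f).at k = c • f.at k := rfl

@[simp] theorem Sig.at_sum {τ : Type} (s : Finset τ) (f : τ → Sig ι) (k : ℕ) :
    (∑ t ∈ s, f t).at k = ∑ t ∈ s, (f t).at k := by
  classical
  induction s using Finset.induction_on with
  | empty => simp
  | insert a s ha ih => simp [Finset.sum_insert ha, ih]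

theorem Sig.hasSum_inner (f g : Sig ι) :
    HasSum (fun k => f.at k ⬝ᵥ g.at k) (inner ℝ f g) := by
  have h := lp.hasSum_inner (𝕜 := ℝ) f g
  have e : (fun k => inner ℝ (f k) (g k)) = fun k => f.at k ⬝ᵥ g.at k := by
    funext k
    rw [EuclideanSpace.inner_eq_star_dotProduct, star_trivial, dotProduct_comm]
    rfl
  rwa [e] at h

theorem Sig.inner_eq (f g : Sig ι) : inner ℝ f g = ∑' k, f.at k ⬝ᵥ g.at k :=
  (Sig.hasSum_inner f g).tsum_eq.symm

/-- A continuous linear map applied at each time. -/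
def pointwise (L : EuclideanSpace ℝ ι →L[ℝ] EuclideanSpace ℝ κ) : Sig ι →L[ℝ] Sig κ :=
  LinearMap.mkContinuous
    { toFun := fun f => ⟨fun k => L (f k), by
        have hf : Memℓp (fun k => ‖L‖ * ‖f k‖) 2 :=
          Memℓp.const_mul (Memℓp.norm (lp.memℓp f)) _
        exact hf.mono fun k => L.le_opNorm _⟩
      map_add' := fun f g => by
        apply lp.ext; funext k; exact map_add L _ _
      map_smul' := fun c f => by
        apply lp.ext; funext k; exact map_smul L _ _ }
    ‖L‖ (by
      intro f
      have hp : (0 : ℝ) < (2 : ℝ≥0∞).toReal := by norm_num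
      refine lp.norm_le_of_forall_sum_le hp (by positivity) fun s => ?_
      calc ∑ k ∈ s, ‖L (f k)‖ ^ (2 : ℝ≥0∞).toReal
          ≤ ∑ k ∈ s, ‖L‖ ^ (2 : ℝ≥0∞).toReal * ‖f k‖ ^ (2 : ℝ≥0∞).toReal := by
            refine Finset.sum_le_sum fun k _ => ?_
            rw [← Real.mul_rpow (norm_nonneg _) (norm_nonneg _)]
            exact Real.rpow_le_rpow (norm_nonneg _) (L.le_opNorm _) hp.le
        _ ≤ (‖L‖ * ‖f‖) ^ (2 : ℝ≥0∞).toReal := by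
            rw [← Finset.mul_sum, Real.mul_rpow (norm_nonneg _) (norm_nonneg _)]
            exact mul_le_mul_of_nonneg_left (lp.sum_rpow_le_norm_rpow hp f s) (by positivity))

theorem norm_pointwise_le (L : EuclideanSpace ℝ ι →L[ℝ] EuclideanSpace ℝ κ) :
    ‖pointwise L‖ ≤ ‖L‖ := LinearMap.mkContinuous_norm_le _ (norm_nonneg _) _

/-- Multiplication of a signal by a matrix. -/
def op [DecidableEq ι] (M : Matrix κ ι ℝ) : Sig ι →L[ℝ] Sig κ :=
  pointwise (LinearMap.toContinuousLinearMap (Matrix.toLpLin 2 2 M))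

@[simp] theorem op_at [DecidableEq ι] (M : Matrix κ ι ℝ) (f : Sig ι) (k : ℕ) :
    (op M f).at k = M *ᵥ f.at k := rfl

theorem op_mul [DecidableEq ι] [DecidableEq κ] (M : Matrix μ κ ℝ) (N : Matrix κ ι ℝ)
    (f : Sig ι) : op (M * N) f = op M (op N f) :=
  Sig.ext_at fun k => by simp [Matrix.mulVec_mulVec]

theorem op_add [DecidableEq ι] (M N : Matrix κ ι ℝ) (f : Sig ι) :
    op (M + N) f = op M f + op N f :=
  Sig.ext_at fun k => by simp [Matrix.add_mulVec]

@[simp] theorem op_one [DecidableEq ι] (f : Sig ι) : op (1 : Matrix ι ι ℝ) f = f :=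
  Sig.ext_at fun k => by simp

theorem inner_op_left [DecidableEq ι] [DecidableEq κ] (M : Matrix κ ι ℝ) (f : Sig ι)
    (g : Sig κ) : inner ℝ (op M f) g = inner ℝ f (op Mᵀ g) := by
  rw [Sig.inner_eq, Sig.inner_eq]
  congr 1; funext k
  rw [op_at, op_at, Matrix.mulVec_transpose, dotProduct_comm, Matrix.dotProduct_mulVec,
    dotProduct_comm]

theorem Sig.hasSum_op [DecidableEq ι] (M : Matrix κ ι ℝ) (f : Sig κ) (g : Sig ι) :
    HasSum (fun k => f.at k ⬝ᵥ M *ᵥ g.at k) (inner ℝ f (op M g)) :=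
  Sig.hasSum_inner f (op M g)

theorem inner_op_nonneg [DecidableEq ι] {M : Matrix ι ι ℝ} (hM : M.PosSemidef) (f : Sig ι) :
    0 ≤ inner ℝ f (op M f) :=
  (Sig.hasSum_op M f f).nonneg fun k => by simpa using hM.dotProduct_mulVec_nonneg (f.at k)

/-- The signal `f` delayed by one step, with initial value zero. -/
def delay : Sig ι →L[ℝ] Sig ι :=
  LinearMap.mkContinuous
    { toFun := fun f => ⟨fun k => Nat.casesOn k 0 f, by
        have hp : (0 : ℝ) < (2 : ℝ≥0∞).toReal := by norm_num
        apply memℓp_gen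
        rw [← summable_nat_add_iff 1]
        exact (lp.memℓp f).summable hp⟩
      map_add' := fun f g => by
        apply lp.ext; funext k; cases k
        · exact (add_zero (0 : EuclideanSpace ℝ ι)).symm
        · rfl
      map_smul' := fun c f => by
        apply lp.ext; funext k; cases k
        · exact (smul_zero c).symm
        · rfl }
    1 (by
      intro f
      have hp : (0 : ℝ) < (2 : ℝ≥0∞).toReal := by norm_num
      rw [one_mul]
      refine lp.norm_le_of_tsum_le hp (norm_nonneg _) ?_
      rw [lp.norm_rpow_eq_tsum hp f]
      have hs : Summable fun k => ‖f k‖ ^ (2 : ℝ≥0∞).toReal := (lp.memℓp f).summable hp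
      rw [← hs.hasSum.tsum_eq, Summable.tsum_eq_zero_add]
      · simp
      · rw [← summable_nat_add_iff 1]
        exact hs)

/-- The signal `f` advanced by one step, its initial value being dropped. -/
def advance : Sig ι →L[ℝ] Sig ι :=
  LinearMap.mkContinuous
    { toFun := fun f => ⟨fun k => f (k + 1), by
        have hp : (0 : ℝ) < (2 : ℝ≥0∞).toReal := by norm_num
        exact memℓp_gen ((summable_nat_add_iff 1).2 ((lp.memℓp f).summable hp))⟩
      map_add' := fun f g => rfl
      map_smul' := fun c f => rfl }
    1 (by
      intro f
      have hp : (0 : ℝ) < (2 : ℝ≥0∞).toReal := by norm_num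
      rw [one_mul]
      refine lp.norm_le_of_tsum_le hp (norm_nonneg _) ?_
      rw [lp.norm_rpow_eq_tsum hp f]
      have hs : Summable fun k => ‖f k‖ ^ (2 : ℝ≥0∞).toReal := (lp.memℓp f).summable hp
      rw [hs.tsum_eq_zero_add]
      exact le_add_of_nonneg_left (by positivity))

@[simp] theorem delay_at_zero (f : Sig ι) : (delay f).at 0 = 0 := rfl
@[simp] theorem delay_at_succ (f : Sig ι) (k : ℕ) : (delay f).at (k + 1) = f.at k := rfl
@[simp] theorem advance_at (f : Sig ι) (k : ℕ) : (advance f).at k = f.at (k + 1) := rfl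

@[simp] theorem advance_delay (f : Sig ι) : advance (delay f) = f := rfl

theorem op_delay [DecidableEq ι] (M : Matrix κ ι ℝ) (f : Sig ι) :
    op M (delay f) = delay (op M f) :=
  Sig.ext_at fun k => by cases k <;> simp

theorem op_advance [DecidableEq ι] (M : Matrix κ ι ℝ) (f : Sig ι) :
    op M (advance f) = advance (op M f) := rfl

theorem inner_eq_add_inner_advance (f g : Sig ι) :
    inner ℝ f g = f.at 0 ⬝ᵥ g.at 0 + inner ℝ (advance f) (advance g) := by
  rw [Sig.inner_eq, (Sig.hasSum_inner f g).summable.tsum_eq_zero_add, Sig.inner_eq]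
  rfl

theorem inner_delay_delay (f g : Sig ι) : inner ℝ (delay f) (delay g) = inner ℝ f g := by
  rw [inner_eq_add_inner_advance]
  simp

theorem inner_delay_left (f g : Sig ι) : inner ℝ (delay f) g = inner ℝ f (advance g) := by
  rw [inner_eq_add_inner_advance]
  simp

theorem advance_pow_at (f : Sig ι) (j k : ℕ) : ((advance ^ j) f).at k = f.at (k + j) := by
  induction j generalizing k with
  | zero => rfl
  | succ j ih =>
    rw [pow_succ', mul_apply_eq_comp, advance_at, ih]
    congr 1; omega

@[simp] theorem Sig.sub_at (f : Sig ι) (g : κ → ι) (k : ℕ) :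
    (f.sub g).at k = fun a => f.at k (g a) := rfl

end Signals

/-! ## Contractions in an equivalent quadratic norm -/

section Contraction

variable {H : Type*} [NormedAddCommGroup H] [NormedSpace ℝ H]

/-- Iterating the contraction of `N` and comparing with the norm on both sides gives a bound of
order `ρ ^ (k / 2)` for the powers. A single application of `T` may still increase the norm, so only
powers are controlled. -/
theorem tendsto_norm_pow_of_contraction {T : H →L[ℝ] H} {N : H → ℝ} {c C ρ : ℝ} (hc : 0 < c)
    (hρ : 0 ≤ ρ) (hρ' : ρ < 1) (hl : ∀ u, c * ‖u‖ ^ 2 ≤ N u) (hu : ∀ u, N u ≤ C * ‖u‖ ^ 2)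
    (hT : ∀ u, N (T u) ≤ ρ * N u) :
    Filter.Tendsto (fun k : ℕ => ‖T ^ k‖) Filter.atTop (𝓝 0) := by
  -- `C` may be negative when the space is trivial.
  have hC : 0 ≤ max C 0 := le_max_right _ _
  have h1 : ∀ (k : ℕ) u, N ((T ^ k) u) ≤ ρ ^ k * N u := by
    intro k
    induction k with
    | zero => intro u; simp
    | succ k ih =>
      intro u
      rw [pow_succ', mul_apply_eq_comp, pow_succ']
      refine (hT _).trans ?_
      rw [mul_assoc]
      exact mul_le_mul_of_nonneg_left (ih u) hρ
  have h2 : ∀ k : ℕ, ‖T ^ k‖ ≤ √(ρ ^ k * (max C 0 / c)) := by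
    intro k
    refine ContinuousLinearMap.opNorm_le_bound _ (Real.sqrt_nonneg _) fun u => ?_
    have h3 : c * ‖(T ^ k) u‖ ^ 2 ≤ ρ ^ k * (max C 0 * ‖u‖ ^ 2) := by
      refine (hl _).trans ((h1 k u).trans (mul_le_mul_of_nonneg_left ((hu u).trans ?_)
        (pow_nonneg hρ k)))
      exact mul_le_mul_of_nonneg_right (le_max_left _ _) (sq_nonneg _)
    have h4 : ‖(T ^ k) u‖ ^ 2 ≤ (ρ ^ k * (max C 0 / c)) * ‖u‖ ^ 2 := by
      rw [← mul_le_mul_iff_right₀ hc]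
      refine h3.trans (le_of_eq ?_)
      field_simp
    calc ‖(T ^ k) u‖ = √(‖(T ^ k) u‖ ^ 2) := (Real.sqrt_sq (norm_nonneg _)).symm
      _ ≤ √((ρ ^ k * (max C 0 / c)) * ‖u‖ ^ 2) := Real.sqrt_le_sqrt h4
      _ = _ := by
        rw [Real.sqrt_mul (by positivity), Real.sqrt_sq (norm_nonneg _)]
  refine squeeze_zero (fun _ => norm_nonneg _) h2 ?_
  have h5 : Filter.Tendsto (fun k : ℕ => ρ ^ k * (max C 0 / c)) Filter.atTop (𝓝 0) := by
    simpa using (tendsto_pow_atTop_nhds_zero_of_lt_one hρ hρ').mul_const (max C 0 / c)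
  simpa using h5.sqrt

/-- Some power has norm below one, so `1 - T ^ k` is invertible by the Neumann series; `1 - T` is a
factor of it that commutes with the cofactor. -/
theorem isUnit_one_sub_of_tendsto_pow [CompleteSpace H] {T : H →L[ℝ] H}
    (hT : Filter.Tendsto (fun k : ℕ => ‖T ^ k‖) Filter.atTop (𝓝 0)) : IsUnit (1 - T) := by
  obtain ⟨k, hk⟩ := (hT.eventually (gt_mem_nhds one_pos)).exists
  have h1 : IsUnit (1 - T ^ k) := isUnit_one_sub_of_norm_lt_one hk
  have h2 : (1 - T) * (∑ i ∈ Finset.range k, T ^ i) = 1 - T ^ k := mul_neg_geom_sum T k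
  have h3 : Commute (1 - T) (∑ i ∈ Finset.range k, T ^ i) :=
    Commute.sum_right _ _ _ fun i _ =>
      ((Commute.one_left _).sub_left (Commute.refl T |>.pow_right i))
  exact (h3.isUnit_mul_iff.1 (h2 ▸ h1)).1

end Contraction

/-! ## Bilinear forms of matrices -/

section Forms

variable {ι κ μ : Type} [Fintype ι] [Fintype κ] [Fintype μ]

/-- The bilinear form `xᵀ M y`. -/
def form (M : Matrix ι κ ℝ) (x : ι → ℝ) (y : κ → ℝ) : ℝ := x ⬝ᵥ M *ᵥ y

@[simp] theorem form_zero_left (M : Matrix ι κ ℝ) (y : κ → ℝ) : form M 0 y = 0 := by simp [form]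
@[simp] theorem form_zero_right (M : Matrix ι κ ℝ) (x : ι → ℝ) : form M x 0 = 0 := by simp [form]
theorem form_add_left (M : Matrix ι κ ℝ) (x x' : ι → ℝ) (y : κ → ℝ) :
    form M (x + x') y = form M x y + form M x' y := by simp [form]
theorem form_add_right (M : Matrix ι κ ℝ) (x : ι → ℝ) (y y' : κ → ℝ) :
    form M x (y + y') = form M x y + form M x y' := by simp [form, Matrix.mulVec_add]
theorem form_sub_left (M : Matrix ι κ ℝ) (x x' : ι → ℝ) (y : κ → ℝ) :
    form M (x - x') y = form M x y - form M x' y := by simp [form]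
theorem form_sub_right (M : Matrix ι κ ℝ) (x : ι → ℝ) (y y' : κ → ℝ) :
    form M x (y - y') = form M x y - form M x y' := by simp [form, Matrix.mulVec_sub]
theorem form_neg_left (M : Matrix ι κ ℝ) (x : ι → ℝ) (y : κ → ℝ) :
    form M (-x) y = -form M x y := by simp [form]
theorem form_neg_right (M : Matrix ι κ ℝ) (x : ι → ℝ) (y : κ → ℝ) :
    form M x (-y) = -form M x y := by simp [form, Matrix.mulVec_neg]
theorem form_smul_left (M : Matrix ι κ ℝ) (c : ℝ) (x : ι → ℝ) (y : κ → ℝ) :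
    form M (c • x) y = c * form M x y := by simp [form]
theorem form_smul_right (M : Matrix ι κ ℝ) (c : ℝ) (x : ι → ℝ) (y : κ → ℝ) :
    form M x (c • y) = c * form M x y := by simp [form, Matrix.mulVec_smul]
theorem form_add (M N : Matrix ι κ ℝ) (x : ι → ℝ) (y : κ → ℝ) :
    form (M + N) x y = form M x y + form N x y := by simp [form, Matrix.add_mulVec]
theorem form_sub (M N : Matrix ι κ ℝ) (x : ι → ℝ) (y : κ → ℝ) :
    form (M - N) x y = form M x y - form N x y := by simp [form, Matrix.sub_mulVec]
theorem form_transpose (M : Matrix ι κ ℝ) (x : κ → ℝ) (y : ι → ℝ) :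
    form Mᵀ x y = form M y x := by
  rw [form, form, Matrix.mulVec_transpose, Matrix.dotProduct_mulVec, dotProduct_comm]
theorem form_comm {M : Matrix ι ι ℝ} (hM : Mᵀ = M) (x y : ι → ℝ) : form M x y = form M y x := by
  rw [← form_transpose, hM]
theorem form_mul {τ : Type} [Fintype τ] (M : Matrix ι κ ℝ) (N : Matrix κ τ ℝ) (x : ι → ℝ)
    (y : τ → ℝ) : form (M * N) x y = form M x (N *ᵥ y) := by
  rw [form, form, Matrix.mulVec_mulVec]
theorem form_transpose_mul {τ : Type} [Fintype τ] (M : Matrix κ ι ℝ) (N : Matrix κ τ ℝ)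
    (x : ι → ℝ) (y : τ → ℝ) : form (Mᵀ * N) x y = form N (M *ᵥ x) y := by
  rw [form_mul, form_transpose, form, form, dotProduct_comm]

theorem form_add_self {M : Matrix ι ι ℝ} (hM : Mᵀ = M) (x y : ι → ℝ) :
    form M (x + y) (x + y) = form M x x + 2 * form M x y + form M y y := by
  rw [form_add_left, form_add_right, form_add_right, form_comm hM y x]; ring

theorem form_sub_self {M : Matrix ι ι ℝ} (hM : Mᵀ = M) (x y : ι → ℝ) :
    form M (x - y) (x - y) = form M x x - 2 * form M x y + form M y y := by
  rw [form_sub_left, form_sub_right, form_sub_right, form_comm hM y x]; ring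

theorem _root_.Matrix.PosSemidef.transpose_eq {M : Matrix ι ι ℝ} (hM : M.PosSemidef) :
    Mᵀ = M := by simpa using hM.isHermitian.eq
theorem _root_.Matrix.PosDef.transpose_eq {M : Matrix ι ι ℝ} (hM : M.PosDef) :
    Mᵀ = M := hM.posSemidef.transpose_eq

theorem form_nonneg {M : Matrix ι ι ℝ} (hM : M.PosSemidef) (x : ι → ℝ) : 0 ≤ form M x x := by
  simpa [form] using hM.dotProduct_mulVec_nonneg x

theorem form_pos {M : Matrix ι ι ℝ} (hM : M.PosDef) {x : ι → ℝ} (hx : x ≠ 0) :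
    0 < form M x x := by
  simpa [form] using hM.dotProduct_mulVec_pos hx

theorem posSemidef_of_form {M : Matrix ι ι ℝ} (hM : Mᵀ = M) (h : ∀ x, 0 ≤ form M x x) :
    M.PosSemidef :=
  .of_dotProduct_mulVec_nonneg (by simpa [Matrix.IsHermitian] using hM) fun x => by
    simpa [form] using h x

theorem posDef_of_form {M : Matrix ι ι ℝ} (hM : Mᵀ = M) (h : ∀ x, x ≠ 0 → 0 < form M x x) :
    M.PosDef :=
  .of_dotProduct_mulVec_pos (by simpa [Matrix.IsHermitian] using hM) fun x hx => by
    simpa [form] using h x hx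

theorem continuous_form (M : Matrix ι κ ℝ) :
    Continuous fun u : (ι → ℝ) × (κ → ℝ) => form M u.1 u.2 := by
  unfold form
  exact Continuous.dotProduct continuous_fst (continuous_const.matrix_mulVec continuous_snd)

variable [DecidableEq ι]

theorem mulVec_inv_mulVec {M : Matrix ι ι ℝ} (hM : IsUnit M) (x : ι → ℝ) :
    M *ᵥ (M⁻¹ *ᵥ x) = x := by
  rw [Matrix.mulVec_mulVec, Matrix.mul_nonsing_inv _ ((Matrix.isUnit_iff_isUnit_det _).1 hM),
    Matrix.one_mulVec]

theorem inv_mulVec_mulVec {M : Matrix ι ι ℝ} (hM : IsUnit M) (x : ι → ℝ) :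
    M⁻¹ *ᵥ (M *ᵥ x) = x := by
  rw [Matrix.mulVec_mulVec, Matrix.nonsing_inv_mul _ ((Matrix.isUnit_iff_isUnit_det _).1 hM),
    Matrix.one_mulVec]

/-- Young's inequality for a positive definite matrix. -/
theorem two_mul_dotProduct_le {M : Matrix ι ι ℝ} (hM : M.PosDef) (x y : ι → ℝ) :
    2 * (x ⬝ᵥ y) ≤ form M⁻¹ x x + form M y y := by
  have h := form_nonneg hM.posSemidef (M⁻¹ *ᵥ x - y)
  have e1 : form M (M⁻¹ *ᵥ x) (M⁻¹ *ᵥ x) = form M⁻¹ x x := by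
    rw [form, mulVec_inv_mulVec hM.isUnit, dotProduct_comm]; rfl
  have e2 : form M (M⁻¹ *ᵥ x) y = x ⬝ᵥ y := by
    rw [form_comm hM.transpose_eq, form, mulVec_inv_mulVec hM.isUnit, dotProduct_comm]
  rw [form_sub_self hM.transpose_eq, e1, e2] at h
  linarith

theorem form_one (x y : ι → ℝ) : form (1 : Matrix ι ι ℝ) x y = x ⬝ᵥ y := by simp [form]

open scoped MatrixOrder in
theorem exists_eq_transpose_mul_self {M : Matrix ι ι ℝ} (hM : M.PosSemidef) :
    ∃ B : Matrix ι ι ℝ, M = Bᵀ * B := by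
  obtain ⟨B, hB⟩ := CStarAlgebra.nonneg_iff_eq_star_mul_self.1 hM.nonneg
  exact ⟨B, by simpa [Matrix.star_eq_conjTranspose] using hB⟩

/-- A positive semidefinite matrix is bounded by its trace. -/
theorem form_le_trace_mul {M : Matrix ι ι ℝ} (hM : M.PosSemidef) (x : ι → ℝ) :
    form M x x ≤ M.trace * (x ⬝ᵥ x) := by
  obtain ⟨B, rfl⟩ := exists_eq_transpose_mul_self hM
  rw [form_transpose_mul]
  have h1 : form B (B *ᵥ x) x = ∑ i, (∑ j, B i j * x j) ^ 2 := by
    simp [form, dotProduct, Matrix.mulVec, sq]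
  have h2 : (Bᵀ * B).trace = ∑ i, ∑ j, B i j ^ 2 := by
    simp only [Matrix.trace, Matrix.diag, Matrix.mul_apply, Matrix.transpose_apply, ← sq]
    exact Finset.sum_comm
  have h3 : x ⬝ᵥ x = ∑ j, x j ^ 2 := by simp [dotProduct, sq]
  rw [h1, h2, h3, Finset.sum_mul]
  exact Finset.sum_le_sum fun i _ => Finset.sum_mul_sq_le_sq_mul_sq _ _ _

theorem form_single (M : Matrix ι ι ℝ) (i : ι) :
    form M (Pi.single i 1) (Pi.single i 1) = M i i := by simp [form]

theorem trace_le_of_form_le {M N : Matrix ι ι ℝ} (h : ∀ x, form M x x ≤ form N x x) :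
    M.trace ≤ N.trace :=
  Finset.sum_le_sum fun i _ => by
    have := h (Pi.single i 1)
    rwa [form_single, form_single] at this

end Forms

/-- Both functions are homogeneous of degree two, so it suffices to compare them on the compact unit
sphere. This is the source of every uniform margin and norm comparison below. -/
theorem exists_pos_mul_le {V : Type*} [NormedAddCommGroup V] [NormedSpace ℝ V]
    [FiniteDimensional ℝ V] {f g : V → ℝ} (hf : Continuous f) (hg : Continuous g)
    (hf2 : ∀ (c : ℝ) u, f (c • u) = c ^ 2 * f u) (hg2 : ∀ (c : ℝ) u, g (c • u) = c ^ 2 * g u)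
    (hpos : ∀ u, u ≠ 0 → 0 < f u) : ∃ ε : ℝ, 0 < ε ∧ ε < 1 ∧ ∀ u, ε * g u ≤ f u := by
  have hK : IsCompact (Metric.sphere (0 : V) 1) := isCompact_sphere 0 1
  obtain ⟨ε, h0, h1, h2⟩ : ∃ ε : ℝ, 0 < ε ∧ ε < 1 ∧
      ∀ u ∈ Metric.sphere (0 : V) 1, ε * g u ≤ f u := by
    rcases (Metric.sphere (0 : V) 1).eq_empty_or_nonempty with he | hne
    · exact ⟨1 / 2, by norm_num, by norm_num, by simp [he]⟩
    obtain ⟨u, hu, hmin⟩ := hK.exists_isMinOn hne hf.continuousOn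
    obtain ⟨v, hv, hmax⟩ := hK.exists_isMaxOn hne hg.continuousOn
    have hu0 : 0 < f u := hpos u (by rintro rfl; simp at hu)
    have hM : 0 < |g v| + f u + 1 := by positivity
    -- Minimum of `f` over a bound for the maximum of `g`; the extra `f u + 1` makes the denominator
    -- positive and the ratio less than one.
    refine ⟨f u / (|g v| + f u + 1), by positivity, ?_, fun w hw => ?_⟩
    · rw [div_lt_one hM]; linarith [abs_nonneg (g v)]
    · have a1 : f u ≤ f w := hmin hw
      have a2 : g w ≤ |g v| + f u + 1 := by
        have : g w ≤ g v := hmax hw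
        linarith [le_abs_self (g v)]
      calc f u / (|g v| + f u + 1) * g w ≤ f u / (|g v| + f u + 1) * (|g v| + f u + 1) :=
            mul_le_mul_of_nonneg_left a2 (by positivity)
        _ = f u := by field_simp
        _ ≤ f w := a1
  refine ⟨ε, h0, h1, fun u => ?_⟩
  rcases eq_or_ne u 0 with rfl | hu
  · have a := hf2 0 0
    have b := hg2 0 0
    simp only [smul_zero, ne_eq, OfNat.ofNat_ne_zero, not_false_eq_true, zero_pow, zero_mul] at a b
    simp [a, b]
  · have hn : ‖u‖ ≠ 0 := norm_ne_zero_iff.2 hu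
    have e : u = ‖u‖ • (‖u‖⁻¹ • u) := by rw [smul_smul, mul_inv_cancel₀ hn, one_smul]
    have h3 := h2 (‖u‖⁻¹ • u) (by simp [norm_smul, hn])
    rw [e, hf2, hg2]
    nlinarith [sq_nonneg ‖u‖]

theorem exists_pos_mul_dotProduct_le {ι : Type} [Fintype ι] {M : Matrix ι ι ℝ} (hM : M.PosDef) :
    ∃ c : ℝ, 0 < c ∧ ∀ x, c * (x ⬝ᵥ x) ≤ form M x x := by
  obtain ⟨c, h0, -, h⟩ := exists_pos_mul_le (V := ι → ℝ) (f := fun x => form M x x)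
    (g := fun x => x ⬝ᵥ x) ((continuous_form M).comp (continuous_id.prodMk continuous_id))
    (Continuous.dotProduct continuous_id continuous_id)
    (fun c u => by rw [form_smul_left, form_smul_right]; ring)
    (fun c u => by simp; ring) (fun u hu => form_pos hM hu)
  exact ⟨c, h0, h⟩

/-! ## Linear systems and their storage inequalities -/

/-- The data of the system `[x(k+1); q; e] = [A B₀ B₁; C₀ D₀ 0; C₁ D₁ 0] [x; p; d]`. -/
structure LinSys (X P D E : Type) where
  A : Matrix X X ℝ
  B₀ : Matrix X P ℝ
  B₁ : Matrix X D ℝ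
  C₀ : Matrix P X ℝ
  D₀ : Matrix P P ℝ
  C₁ : Matrix E X ℝ
  D₁ : Matrix E P ℝ

namespace LinSys

variable {X P D E : Type} [Fintype X] [Fintype P] [Fintype E] [DecidableEq X] [DecidableEq P]

/-- The next state without disturbance. -/
def next (G : LinSys X P D E) (x : X → ℝ) (p : P → ℝ) : X → ℝ := G.A *ᵥ x + G.B₀ *ᵥ p

/-- The input of the uncertainty. -/
def chan (G : LinSys X P D E) (x : X → ℝ) (p : P → ℝ) : P → ℝ := G.C₀ *ᵥ x + G.D₀ *ᵥ p

/-- The performance output. -/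
def out (G : LinSys X P D E) (x : X → ℝ) (p : P → ℝ) : E → ℝ := G.C₁ *ᵥ x + G.D₁ *ᵥ p

/-- The next storage plus the supply, for the storage `S` and the scaling `Θ`. -/
def supply (G : LinSys X P D E) (Θ : Matrix P P ℝ) (S : Matrix X X ℝ) (x : X → ℝ) (p : P → ℝ) :
    ℝ :=
  form S (G.next x p) (G.next x p) + form Θ (G.chan x p) (G.chan x p)
    + G.out x p ⬝ᵥ G.out x p - form Θ p p

/-- The strict storage inequality. -/
def Dissipative (G : LinSys X P D E) (Θ : Matrix P P ℝ) (S : Matrix X X ℝ) : Prop :=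
  ∀ x p, (x, p) ≠ 0 → G.supply Θ S x p < form S x x

/-- The quadratic coefficient of `supply` in `x`. -/
def supplyX (G : LinSys X P D E) (Θ : Matrix P P ℝ) (S : Matrix X X ℝ) : Matrix X X ℝ :=
  G.Aᵀ * (S * G.A) + G.C₀ᵀ * (Θ * G.C₀) + G.C₁ᵀ * G.C₁

/-- The mixed coefficient of `supply`. -/
def supplyPX (G : LinSys X P D E) (Θ : Matrix P P ℝ) (S : Matrix X X ℝ) : Matrix P X ℝ :=
  G.B₀ᵀ * (S * G.A) + G.D₀ᵀ * (Θ * G.C₀) + G.D₁ᵀ * G.C₁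

/-- The negative of the quadratic coefficient of `supply` in `p`. -/
def supplyP (G : LinSys X P D E) (Θ : Matrix P P ℝ) (S : Matrix X X ℝ) : Matrix P P ℝ :=
  Θ - (G.B₀ᵀ * (S * G.B₀) + G.D₀ᵀ * (Θ * G.D₀) + G.D₁ᵀ * G.D₁)

/-- The gain of the maximizer of `supply` in `p`. -/
def gain (G : LinSys X P D E) (Θ : Matrix P P ℝ) (S : Matrix X X ℝ) : Matrix P X ℝ :=
  (G.supplyP Θ S)⁻¹ * G.supplyPX Θ S

/-- The matrix of the maximum of `supply` over `p`. -/
def riccati (G : LinSys X P D E) (Θ : Matrix P P ℝ) (S : Matrix X X ℝ) : Matrix X X ℝ :=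
  G.supplyX Θ S + (G.supplyPX Θ S)ᵀ * ((G.supplyP Θ S)⁻¹ * G.supplyPX Θ S)

variable {G : LinSys X P D E} {Θ : Matrix P P ℝ} {S : Matrix X X ℝ}

theorem supply_eq_expand (hΘ : Θᵀ = Θ) (hS : Sᵀ = S) (x : X → ℝ) (p : P → ℝ) :
    G.supply Θ S x p = form (G.supplyX Θ S) x x + 2 * form (G.supplyPX Θ S) p x
      - form (G.supplyP Θ S) p p := by
  have e1 : ∀ (v w : E → ℝ), (v + w) ⬝ᵥ (v + w) = v ⬝ᵥ v + 2 * (w ⬝ᵥ v) + w ⬝ᵥ w := by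
    intro v w
    rw [add_dotProduct, dotProduct_add, dotProduct_add, dotProduct_comm w v]; ring
  have e2 : ∀ {α β : Type} [Fintype α] [Fintype β] (M : Matrix E α ℝ) (N : Matrix E β ℝ)
      (v : α → ℝ) (w : β → ℝ), form (Mᵀ * N) v w = (M *ᵥ v) ⬝ᵥ (N *ᵥ w) := by
    intro α β _ _ M N v w
    rw [form_transpose_mul]; rfl
  simp only [supply, next, chan, out, supplyX, supplyPX, supplyP, form_add, form_sub, e1, e2]
  simp only [form_transpose_mul, form_add_self hS, form_add_self hΘ]
  simp only [form_mul]
  rw [form_comm hS (G.A *ᵥ x) (G.B₀ *ᵥ p), form_comm hΘ (G.C₀ *ᵥ x) (G.D₀ *ᵥ p)]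
  ring

theorem supplyX_transpose (hΘ : Θᵀ = Θ) (hS : Sᵀ = S) : (G.supplyX Θ S)ᵀ = G.supplyX Θ S := by
  simp [supplyX, Matrix.transpose_mul, hΘ, hS, Matrix.mul_assoc]

theorem supplyP_transpose (hΘ : Θᵀ = Θ) (hS : Sᵀ = S) : (G.supplyP Θ S)ᵀ = G.supplyP Θ S := by
  simp [supplyP, Matrix.transpose_mul, hΘ, hS, Matrix.mul_assoc]

/-- Completion of the square in `p`: the supply is concave in `p`, with maximizer `gain * x` and
maximal value given by `riccati`. -/
theorem supply_eq (hΘ : Θᵀ = Θ) (hS : Sᵀ = S) (hR : (G.supplyP Θ S).PosDef) (x : X → ℝ)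
    (p : P → ℝ) :
    G.supply Θ S x p = form (G.riccati Θ S) x x
      - form (G.supplyP Θ S) (p - G.gain Θ S *ᵥ x) (p - G.gain Θ S *ᵥ x) := by
  have e : ∀ v, form (G.supplyP Θ S) v (G.gain Θ S *ᵥ x) = form (G.supplyPX Θ S) v x := by
    intro v
    rw [form, gain, ← Matrix.mulVec_mulVec, mulVec_inv_mulVec hR.isUnit]; rfl
  rw [supply_eq_expand hΘ hS, form_sub_self hR.transpose_eq, e, e, riccati, form_add,
    form_transpose_mul]
  have e3 : form ((G.supplyP Θ S)⁻¹ * G.supplyPX Θ S) (G.supplyPX Θ S *ᵥ x) x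
      = form (G.supplyPX Θ S) (G.gain Θ S *ᵥ x) x := by
    rw [form, form, dotProduct_comm]; rfl
  rw [e3]; ring

theorem riccati_transpose (hΘ : Θᵀ = Θ) (hS : Sᵀ = S) : (G.riccati Θ S)ᵀ = G.riccati Θ S := by
  simp [riccati, Matrix.transpose_mul, supplyX_transpose hΘ hS, Matrix.transpose_nonsing_inv,
    supplyP_transpose hΘ hS, Matrix.mul_assoc]

theorem supply_mono {S' : Matrix X X ℝ} (h : ∀ x, form S x x ≤ form S' x x) (x : X → ℝ)
    (p : P → ℝ) : G.supply Θ S x p ≤ G.supply Θ S' x p := by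
  have := h (G.next x p)
  unfold supply; linarith

/-- The storage matrices below `Sp` that satisfy the storage inequality. -/
def storages (G : LinSys X P D E) (Θ : Matrix P P ℝ) (Sp : Matrix X X ℝ) : Set (Matrix X X ℝ) :=
  {S | S.PosSemidef ∧ (∀ x, form S x x ≤ form Sp x x) ∧ ∀ x p, G.supply Θ S x p ≤ form S x x}

variable {Sp Sm : Matrix X X ℝ}

/-- At state zero the supply is minus the form of `supplyP`. It increases with the storage, and for
the larger storage `Sp` it is negative by strict dissipation. -/
theorem supplyP_posDef (hΘ : Θ.PosDef) (hp : G.Dissipative Θ Sp) (hS : S ∈ G.storages Θ Sp) :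
    (G.supplyP Θ S).PosDef := by
  refine posDef_of_form (supplyP_transpose hΘ.transpose_eq hS.1.transpose_eq) fun p hp0 => ?_
  have h1 := supply_eq_expand (G := G) hΘ.transpose_eq hS.1.transpose_eq 0 p
  have h2 := (supply_mono (G := G) (Θ := Θ) hS.2.1 0 p).trans_lt (hp 0 p (by simpa using hp0))
  simp only [form_zero_right] at h1 h2
  linarith

/-- The Riccati map takes the maximum of the supply over `p`, so the storage inequality says that it
decreases `S`. Since the supply is monotone in the storage, the image satisfies the storage
inequality again; it is positive semidefinite because the supply at `p = 0` is nonnegative. -/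
theorem riccati_mem_storages (hΘ : Θ.PosDef) (hp : G.Dissipative Θ Sp)
    (hS : S ∈ G.storages Θ Sp) :
    G.riccati Θ S ∈ G.storages Θ Sp ∧ ∀ x, form (G.riccati Θ S) x x ≤ form S x x := by
  have hR := supplyP_posDef hΘ hp hS
  have h1 := supply_eq hΘ.transpose_eq hS.1.transpose_eq hR
  have h2 : ∀ x, form (G.riccati Θ S) x x ≤ form S x x := fun x => by
    have := hS.2.2 x (G.gain Θ S *ᵥ x)
    rw [h1] at this
    simpa using this
  refine ⟨⟨posSemidef_of_form (riccati_transpose hΘ.transpose_eq hS.1.transpose_eq) fun x => ?_,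
    fun x => (h2 x).trans (hS.2.1 x), fun x p => ?_⟩, h2⟩
  · have h3 := h1 x 0
    have h4 := form_nonneg hR.posSemidef (0 - G.gain Θ S *ᵥ x)
    have h5 : 0 ≤ G.supply Θ S x 0 := by
      have a1 := form_nonneg hS.1 (G.next x 0)
      have a2 := form_nonneg hΘ.posSemidef (G.chan x 0)
      have a3 : 0 ≤ G.out x 0 ⬝ᵥ G.out x 0 := by
        simpa using dotProduct_star_self_nonneg (G.out x 0)
      simp only [supply, form_zero_left]; linarith
    linarith
  · refine (supply_mono h2 x p).trans ?_
    rw [h1]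
    linarith [form_nonneg hR.posSemidef (p - G.gain Θ S *ᵥ x)]

/-- A storage whose trace is within `ε` of the infimum loses at most `ε` of trace under the Riccati
map, since its image is again a storage. The loss is positive semidefinite and so bounded by its
trace. An approximate fixed point is enough, which avoids solving the Riccati equation. -/
theorem exists_near_riccati (hΘ : Θ.PosDef) (hSp : Sp.PosSemidef) (hp : G.Dissipative Θ Sp)
    {ε : ℝ} (hε : 0 < ε) : ∃ S ∈ G.storages Θ Sp,
      ∀ x, form S x x ≤ form (G.riccati Θ S) x x + ε * (x ⬝ᵥ x) := by
  have hmem : Sp ∈ G.storages Θ Sp := by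
    refine ⟨hSp, fun _ => le_rfl, fun x p => ?_⟩
    rcases eq_or_ne (x, p) 0 with h | h
    · obtain ⟨rfl, rfl⟩ := Prod.mk_eq_zero.1 h
      simp [supply, next, chan, out]
    · exact (hp x p h).le
  have hbdd : BddBelow (Matrix.trace '' G.storages Θ Sp) :=
    ⟨0, by rintro _ ⟨S, hS, rfl⟩; exact hS.1.trace_nonneg⟩
  obtain ⟨_, ⟨S, hS, rfl⟩, hlt⟩ := exists_lt_of_csInf_lt (Set.Nonempty.image _ ⟨Sp, hmem⟩)
    (lt_add_of_pos_right (sInf (Matrix.trace '' G.storages Θ Sp)) hε)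
  obtain ⟨hF, hle⟩ := riccati_mem_storages hΘ hp hS
  refine ⟨S, hS, fun x => ?_⟩
  have h1 : sInf (Matrix.trace '' G.storages Θ Sp) ≤ (G.riccati Θ S).trace :=
    csInf_le hbdd ⟨_, hF, rfl⟩
  have h2 : (S - G.riccati Θ S).PosSemidef := by
    refine posSemidef_of_form ?_ fun x => ?_
    · rw [Matrix.transpose_sub, hS.1.transpose_eq, hF.1.transpose_eq]
    · rw [form_sub]; linarith [hle x]
  have h3 := form_le_trace_mul h2 x
  have h4 : (S - G.riccati Θ S).trace ≤ ε := by rw [Matrix.trace_sub]; linarith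
  have h5 : 0 ≤ x ⬝ᵥ x := by simpa using dotProduct_star_self_nonneg x
  rw [form_sub] at h3
  nlinarith

end LinSys

/-! ### Certificates from a pair of storages -/

namespace LinSys

variable {X P D E : Type} [Fintype X] [Fintype P] [Fintype E] [DecidableEq X] [DecidableEq P]
  {G : LinSys X P D E} {Θ : Matrix P P ℝ} {Sp Sm : Matrix X X ℝ}

/-- Data for bounding the energy of the output by a quadratic function of the disturbance: a
storage matrix `S`, a feedback gain `K` with its weight `R`, and a covariance `Z` for the adjoint
of the system with feedback. -/
structure Certificate (G : LinSys X P D E) (Θ : Matrix P P ℝ) where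
  S : Matrix X X ℝ
  K : Matrix P X ℝ
  R : Matrix P P ℝ
  Z : Matrix X X ℝ
  ρ : ℝ
  S_psd : S.PosSemidef
  R_pos : R.PosDef
  Z_pos : Z.PosDef
  ρ_nonneg : 0 ≤ ρ
  ρ_lt : ρ < 1
  storage : ∀ x p, G.supply Θ S x p + form R (p - K *ᵥ x) (p - K *ᵥ x) ≤ form S x x
  contract : ∀ w, form Z ((G.A + G.B₀ * K)ᵀ *ᵥ w) ((G.A + G.B₀ * K)ᵀ *ᵥ w) ≤ ρ * form Z w w
  covariance : ∀ w, form Z ((G.A + G.B₀ * K)ᵀ *ᵥ w) ((G.A + G.B₀ * K)ᵀ *ᵥ w)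
    + form R⁻¹ (G.B₀ᵀ *ᵥ w) (G.B₀ᵀ *ᵥ w) ≤ form Z w w

/-- Compactness turns strictness into a quantitative margin. Its `x ⬝ᵥ x` term absorbs the defect of
an approximate Riccati fixed point; the other two terms give contraction rates for the storage and
the scaling. -/
theorem Dissipative.exists_le (hm : G.Dissipative Θ Sm) :
    ∃ ε : ℝ, 0 < ε ∧ ε < 1 ∧ ∀ x p,
      G.supply Θ Sm x p + ε * (x ⬝ᵥ x + form Sm x x + form Θ p p) ≤ form Sm x x := by
  have c2 : ∀ {α β : Type} [Fintype α] [Fintype β] (M : Matrix α β ℝ)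
      {f : (X → ℝ) × (P → ℝ) → α → ℝ} {g : (X → ℝ) × (P → ℝ) → β → ℝ}, Continuous f →
      Continuous g → Continuous fun u => form M (f u) (g u) := fun M f g hf hg =>
    (continuous_form M).comp (hf.prodMk hg)
  have hn : Continuous fun u : (X → ℝ) × (P → ℝ) => G.next u.1 u.2 := by
    unfold next; fun_prop
  have hc : Continuous fun u : (X → ℝ) × (P → ℝ) => G.chan u.1 u.2 := by
    unfold chan; fun_prop
  have ho : Continuous fun u : (X → ℝ) × (P → ℝ) => G.out u.1 u.2 := by
    unfold out; fun_prop
  obtain ⟨ε, h0, h1, h⟩ := exists_pos_mul_le (V := (X → ℝ) × (P → ℝ))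
    (f := fun u => form Sm u.1 u.1 - G.supply Θ Sm u.1 u.2)
    (g := fun u => u.1 ⬝ᵥ u.1 + form Sm u.1 u.1 + form Θ u.2 u.2)
    (by
      unfold supply
      exact (c2 _ continuous_fst continuous_fst).sub ((((c2 _ hn hn).add (c2 _ hc hc)).add
        (ho.dotProduct ho)).sub (c2 _ continuous_snd continuous_snd)))
    (((continuous_fst.dotProduct continuous_fst).add (c2 _ continuous_fst continuous_fst)).add
      (c2 _ continuous_snd continuous_snd))
    (fun c u => by
      simp only [supply, next, chan, out, Prod.smul_fst, Prod.smul_snd, Matrix.mulVec_smul,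
        ← smul_add, form_smul_left, form_smul_right, smul_dotProduct, dotProduct_smul, smul_eq_mul]
      ring)
    (fun c u => by
      simp only [Prod.smul_fst, Prod.smul_snd, form_smul_left, form_smul_right, smul_dotProduct,
        dotProduct_smul, smul_eq_mul]
      ring)
    (fun u hu => sub_pos.2 (hm u.1 u.2 hu))
  exact ⟨ε, h0, h1, fun x p => by have := h (x, p); simp only at this; linarith⟩

/-- A contraction with respect to a positive definite form, with a weighted input, has an adjoint
that satisfies the corresponding inequalities for the inverse form. -/
theorem adjoint_covariance {F : Matrix X X ℝ} {B : Matrix X P ℝ} {M : Matrix X X ℝ}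
    {R : Matrix P P ℝ} {ρ : ℝ} (hM : M.PosDef) (hR : R.PosDef) (hρ : 0 < ρ)
    (h : ∀ x v, form M (F *ᵥ x + B *ᵥ v) (F *ᵥ x + B *ᵥ v) ≤ ρ * form M x x + form R v v)
    (w : X → ℝ) :
    ρ⁻¹ * form M⁻¹ (Fᵀ *ᵥ w) (Fᵀ *ᵥ w) + form R⁻¹ (Bᵀ *ᵥ w) (Bᵀ *ᵥ w) ≤ form M⁻¹ w w := by
  -- These vectors maximize `2 w ⬝ᵥ (F x + B v)` minus the right-hand side of the hypothesis.
  have h1 := h (ρ⁻¹ • (M⁻¹ *ᵥ (Fᵀ *ᵥ w))) (R⁻¹ *ᵥ (Bᵀ *ᵥ w))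
  have e1 : ∀ {α : Type} [Fintype α] [DecidableEq α] {N : Matrix α α ℝ} (_ : N.PosDef) (v : α → ℝ),
      form N (N⁻¹ *ᵥ v) (N⁻¹ *ᵥ v) = form N⁻¹ v v := fun hN v => by
    rw [form, mulVec_inv_mulVec hN.isUnit, dotProduct_comm]; rfl
  rw [form_smul_left, form_smul_right, e1 hM, e1 hR] at h1
  have h2 := two_mul_dotProduct_le hM w
    (F *ᵥ (ρ⁻¹ • (M⁻¹ *ᵥ (Fᵀ *ᵥ w))) + B *ᵥ (R⁻¹ *ᵥ (Bᵀ *ᵥ w)))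
  have e2 : w ⬝ᵥ F *ᵥ (ρ⁻¹ • (M⁻¹ *ᵥ (Fᵀ *ᵥ w))) = ρ⁻¹ * form M⁻¹ (Fᵀ *ᵥ w) (Fᵀ *ᵥ w) := by
    rw [Matrix.mulVec_smul, dotProduct_smul, Matrix.dotProduct_mulVec, ← Matrix.mulVec_transpose]
    rfl
  have e3 : w ⬝ᵥ B *ᵥ (R⁻¹ *ᵥ (Bᵀ *ᵥ w)) = form R⁻¹ (Bᵀ *ᵥ w) (Bᵀ *ᵥ w) := by
    rw [Matrix.dotProduct_mulVec, ← Matrix.mulVec_transpose]; rfl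
  rw [dotProduct_add, e2, e3] at h2
  have e4 : ρ * (ρ⁻¹ * (ρ⁻¹ * form M⁻¹ (Fᵀ *ᵥ w) (Fᵀ *ᵥ w)))
      = ρ⁻¹ * form M⁻¹ (Fᵀ *ᵥ w) (Fᵀ *ᵥ w) := by
    field_simp
  rw [e4] at h1
  linarith

/-- Subtracting the supply identity of the near fixed point `S` from the strict inequality of `Sm`
cancels everything except the storages and the square weighted by `R`. So `Sm - S` contracts under
the feedback `K`, and its inverse is the adjoint covariance. The final inequality recovers the
disturbance weight from the two original storages. -/
theorem exists_certificate (hΘ : Θ.PosDef) (hSp : Sp.PosDef) (hSm : Sm.PosDef)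
    (hlt : (Sm - Sp).PosDef) (hp : G.Dissipative Θ Sp) (hm : G.Dissipative Θ Sm) :
    ∃ c : G.Certificate Θ, ∀ b, ∃ z,
      form c.S b b + form c.Z (c.S *ᵥ b) (c.S *ᵥ b) ≤ form Sp (z + b) (z + b) - form Sm z z := by
  obtain ⟨ε, h0, h1, hε⟩ := hm.exists_le
  -- The Riccati tolerance equals the dissipation margin of `Sm`, so that the two `ε * (x ⬝ᵥ x)`
  -- terms cancel in `hcon`.
  obtain ⟨S, hS, hnear⟩ := exists_near_riccati hΘ hSp.posSemidef hp h0
  have hR := supplyP_posDef hΘ hp hS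
  have hST := hS.1.transpose_eq
  have heq := supply_eq hΘ.transpose_eq hST hR
  set K := G.gain Θ S with hK
  set R := G.supplyP Θ S with hRdef
  have hM : (Sm - S).PosDef := by
    refine posDef_of_form ?_ fun x hx => ?_
    · rw [Matrix.transpose_sub, hSm.transpose_eq, hST]
    · have := form_pos hlt hx
      rw [form_sub] at this ⊢
      linarith [hS.2.1 x]
  have hcon : ∀ x v, form (Sm - S) ((G.A + G.B₀ * K) *ᵥ x + G.B₀ *ᵥ v)
      ((G.A + G.B₀ * K) *ᵥ x + G.B₀ *ᵥ v) ≤ (1 - ε) * form (Sm - S) x x + form R v v := by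
    intro x v
    have a1 := hε x (v + K *ᵥ x)
    have a2 := heq x (v + K *ᵥ x)
    have a3 := hnear x
    rw [add_sub_cancel_right] at a2
    have e : (G.A + G.B₀ * K) *ᵥ x + G.B₀ *ᵥ v = G.next x (v + K *ᵥ x) := by
      rw [next, Matrix.add_mulVec, Matrix.mulVec_add, ← Matrix.mulVec_mulVec]; abel
    have a4 : form (Sm - S) (G.next x (v + K *ᵥ x)) (G.next x (v + K *ᵥ x))
        = G.supply Θ Sm x (v + K *ᵥ x) - G.supply Θ S x (v + K *ᵥ x) := by
      rw [form_sub]; unfold supply; ring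
    have a5 := form_nonneg hΘ.posSemidef (v + K *ᵥ x)
    have a6 := form_nonneg hS.1 x
    rw [e, a4, form_sub]
    nlinarith
  have hcov := adjoint_covariance hM hR (sub_pos.2 h1) hcon
  have hZ : (Sm - S)⁻¹.PosDef := hM.inv
  refine ⟨⟨S, K, R, (Sm - S)⁻¹, 1 - ε, hS.1, hR, hZ, by linarith, by linarith, fun x p => ?_,
    fun w => ?_, fun w => ?_⟩, fun b => ⟨(Sm - S)⁻¹ *ᵥ (S *ᵥ b), ?_⟩⟩
  · rw [heq]
    linarith [(riccati_mem_storages hΘ hp hS).2 x]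
  · have a1 := hcov w
    have a2 := form_nonneg hR.inv.posSemidef (G.B₀ᵀ *ᵥ w)
    rw [← inv_mul_le_iff₀ (sub_pos.2 h1)]
    linarith
  · refine le_trans ?_ (hcov w)
    have a1 := form_nonneg hZ.posSemidef ((G.A + G.B₀ * K)ᵀ *ᵥ w)
    have a2 : 1 ≤ (1 - ε)⁻¹ := (one_le_inv₀ (sub_pos.2 h1)).2 (by linarith)
    nlinarith
  -- This `z` maximizes `form S (z + b) (z + b) - form Sm z z`, with value `form S b b + form (Sm -
  -- S)⁻¹ (S b) (S b)`; replacing `S` by the larger `Sp` only increases the expression.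
  · set z := (Sm - S)⁻¹ *ᵥ (S *ᵥ b) with hz
    have a1 := hS.2.1 (z + b)
    have a2 : form (Sm - S) z z = form (Sm - S)⁻¹ (S *ᵥ b) (S *ᵥ b) := by
      rw [form, hz, mulVec_inv_mulVec hM.isUnit, dotProduct_comm]; rfl
    have a3 : form S z b = form (Sm - S)⁻¹ (S *ᵥ b) (S *ᵥ b) := by
      rw [form, hz, dotProduct_comm]; rfl
    rw [form_add_self hST, a3] at a1
    rw [form_sub] at a2
    simp only
    linarith

end LinSys

/-! ## Structured uncertainty as an operator -/

section Coordinates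

variable {ι κ : Type} [Fintype ι] [Fintype κ] [DecidableEq ι]

/-- `Sig.sub` as a continuous linear map. -/
def subL (g : κ → ι) : Sig ι →L[ℝ] Sig κ := op (Matrix.of fun a x => if x = g a then (1 : ℝ) else 0)

@[simp] theorem subL_apply (g : κ → ι) (f : Sig ι) : subL g f = f.sub g :=
  Sig.ext_at fun k => by
    funext a
    simp [subL, Matrix.mulVec, dotProduct]

/-- The operator with the given coordinates. -/
def ofCoord {H : Type*} [NormedAddCommGroup H] [NormedSpace ℝ H] (F : ι → H →L[ℝ] Sig Unit) :
    H →L[ℝ] Sig ι :=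
  ∑ a, (op (Matrix.of fun b (_ : Unit) => if b = a then (1 : ℝ) else 0)).comp (F a)

@[simp] theorem ofCoord_at {H : Type*} [NormedAddCommGroup H] [NormedSpace ℝ H]
    (F : ι → H →L[ℝ] Sig Unit) (u : H) (k : ℕ) (a : ι) :
    (ofCoord F u).at k a = (F a u).at k () := by
  simp [ofCoord, Matrix.mulVec, dotProduct]

theorem inner_op_eq_sum (M : Matrix κ ι ℝ) (f : Sig κ) (g : Sig ι) :
    inner ℝ f (op M g)
      = ∑ a, ∑ b, M a b * inner ℝ (f.sub fun _ : Unit => a) (g.sub fun _ : Unit => b) := by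
  refine (Sig.hasSum_op M f g).unique ?_
  have h : ∀ a b, HasSum (fun k => M a b * (f.at k a * g.at k b))
      (M a b * inner ℝ (f.sub fun _ : Unit => a) (g.sub fun _ : Unit => b)) := fun a b => by
    have := (Sig.hasSum_inner (f.sub fun _ : Unit => a) (g.sub fun _ : Unit => b)).mul_left (M a b)
    simpa [dotProduct] using this
  convert! hasSum_sum (s := Finset.univ) fun a _ => hasSum_sum (s := Finset.univ) fun b _ => h a b
    using 1
  funext k
  simp only [dotProduct, Matrix.mulVec, Finset.mul_sum]
  exact Finset.sum_congr rfl fun a _ => Finset.sum_congr rfl fun b _ => by ring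

theorem inner_eq_sum_sub (f g : Sig ι) :
    inner ℝ f g = ∑ a, inner ℝ (f.sub fun _ : Unit => a) (g.sub fun _ : Unit => a) := by
  have := inner_op_eq_sum (1 : Matrix ι ι ℝ) f g
  simpa [Matrix.one_apply] using this

/-- The signal with value `v` at time zero, and zero afterwards. -/
def impulse (v : ι → ℝ) : Sig ι := lp.single 2 0 (WithLp.toLp 2 v)

@[simp] theorem impulse_at_zero (v : ι → ℝ) : (impulse v).at 0 = v := by
  simp [impulse, Sig.at]

@[simp] theorem impulse_at_succ (v : ι → ℝ) (k : ℕ) : (impulse v).at (k + 1) = 0 := by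
  simp [impulse, Sig.at]

theorem inner_impulse (v : ι → ℝ) (f : Sig ι) : inner ℝ (impulse v) f = v ⬝ᵥ f.at 0 := by
  have h : advance (impulse v) = 0 := Sig.ext_at fun k => by simp
  rw [inner_eq_add_inner_advance, h]
  simp

end Coordinates

theorem sum_transpose_mul_inner {κ H : Type*} [Fintype κ] [NormedAddCommGroup H]
    [InnerProductSpace ℝ H] (B : Matrix κ κ ℝ) (w : κ → H) :
    ∑ a, ∑ b, (Bᵀ * B) a b * inner ℝ (w a) (w b) = ∑ c, ‖∑ a, B c a • w a‖ ^ 2 := by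
  simp only [← real_inner_self_eq_norm_sq, sum_inner, inner_sum, real_inner_smul_left,
    real_inner_smul_right, Matrix.mul_apply, Matrix.transpose_apply, Finset.sum_mul]
  symm
  rw [Finset.sum_comm]
  refine Finset.sum_congr rfl fun a _ => ?_
  rw [Finset.sum_comm]
  refine Finset.sum_congr rfl fun b _ => Finset.sum_congr rfl fun c _ => ?_
  rw [real_inner_comm]
  ring

/-- Contractions of Hilbert spaces preserve inequalities of positive semidefinite matrix forms. -/
theorem sum_inner_map_le {κ : Type} {H H' : Type*} [Fintype κ] [DecidableEq κ]
    [NormedAddCommGroup H] [InnerProductSpace ℝ H] [NormedAddCommGroup H'] [InnerProductSpace ℝ H']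
    {M : Matrix κ κ ℝ} (hM : M.PosSemidef) (δ : H →L[ℝ] H') (hδ : ‖δ‖ ≤ 1) (u : κ → H) :
    ∑ a, ∑ b, M a b * inner ℝ (δ (u a)) (δ (u b)) ≤ ∑ a, ∑ b, M a b * inner ℝ (u a) (u b) := by
  obtain ⟨B, rfl⟩ := exists_eq_transpose_mul_self hM
  have e : ∀ c, ∑ a, B c a • δ (u a) = δ (∑ a, B c a • u a) := fun c => by
    rw [map_sum]
    exact Finset.sum_congr rfl fun a _ => (map_smul δ _ _).symm
  rw [sum_transpose_mul_inner, sum_transpose_mul_inner]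
  refine Finset.sum_le_sum fun c _ => ?_
  rw [e]
  exact pow_le_pow_left₀ (norm_nonneg _) ((δ.le_of_opNorm_le hδ _).trans_eq (one_mul _)) 2

theorem sum_sum_sumType {α : Type} [Fintype α] (F : α ⊕ α → α ⊕ α → ℝ) :
    ∑ a, ∑ b, F a b = ∑ a, ∑ b, F (.inl a) (.inl b) + ∑ a, ∑ b, F (.inl a) (.inr b)
      + ∑ a, ∑ b, F (.inr a) (.inl b) + ∑ a, ∑ b, F (.inr a) (.inr b) := by
  simp only [Fintype.sum_sum_type, Finset.sum_add_distrib]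
  ring

section Structure

variable {s f : ℕ} {m : Fin s → ℕ} {r : Fin f → ℕ}

/-- The coordinates of `Δ q` as operators. -/
def Uncertainty.coord (Δ : Uncertainty m r) : Chan m r → Sig (Chan m r) →L[ℝ] Sig Unit
  | .inl ⟨i, a⟩ => (Δ.scalar i).comp (subL fun _ => .inl ⟨i, a⟩)
  | .inr ⟨j, b⟩ => (subL fun _ => b).comp ((Δ.full j).comp (subL fun b => .inr ⟨j, b⟩))

/-- The operator `diag {Δ, Δ}`. -/
def Uncertainty.toCLM₂ (Δ : Uncertainty m r) :
    Sig (Chan m r ⊕ Chan m r) →L[ℝ] Sig (Chan m r ⊕ Chan m r) :=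
  ofCoord (Sum.elim (fun x => (Δ.coord x).comp (subL Sum.inl))
    fun x => (Δ.coord x).comp (subL Sum.inr))

theorem Uncertainty.rel_iff (Δ : Uncertainty m r) (q p : Sig (Chan m r)) :
    Δ.Rel q p ↔ ∀ x, (p.sub fun _ : Unit => x) = Δ.coord x q := by
  constructor
  · rintro ⟨h1, h2⟩ (⟨i, a⟩ | ⟨j, b⟩)
    · simp [coord, h1]
    · have := congrArg (Sig.sub · fun _ : Unit => b) (h2 j)
      simp only [coord, ContinuousLinearMap.comp_apply, subL_apply]
      exact this
  · refine fun h => ⟨fun i a => by simpa [coord] using h (.inl ⟨i, a⟩), fun j => ?_⟩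
    refine Sig.ext_at fun k => ?_
    funext b
    have := congrArg (fun g : Sig Unit => g.at k ()) (h (.inr ⟨j, b⟩))
    simpa [coord] using this

theorem Uncertainty.rel₂_iff (Δ : Uncertainty m r) (q p : Sig (Chan m r ⊕ Chan m r)) :
    Δ.Rel₂ q p ↔ p = Δ.toCLM₂ q := by
  rw [Rel₂, rel_iff, rel_iff]
  constructor
  · rintro ⟨h1, h2⟩
    refine Sig.ext_at fun k => ?_
    funext y
    rcases y with x | x
    · have := congrArg (fun g : Sig Unit => g.at k ()) (h1 x)
      simpa [toCLM₂] using this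
    · have := congrArg (fun g : Sig Unit => g.at k ()) (h2 x)
      simpa [toCLM₂] using this
  · rintro rfl
    refine ⟨fun x => Sig.ext_at fun k => ?_, fun x => Sig.ext_at fun k => ?_⟩ <;>
    · funext u
      simp [toCLM₂]

/-- The pairs of block matrices commuting with `diag {Δ, Δ}`. -/
def IsCommutant₂ (Θ : Matrix (Chan m r ⊕ Chan m r) (Chan m r ⊕ Chan m r) ℝ) : Prop :=
  Θ.toBlocks₁₁ ∈ commutantSet m r ∧ Θ.toBlocks₁₂ ∈ commutantSet m r ∧
    Θ.toBlocks₂₁ ∈ commutantSet m r ∧ Θ.toBlocks₂₂ ∈ commutantSet m r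

theorem sum_blockDiagonal'_mul {o : Type} [Fintype o] [DecidableEq o] {l : o → ℕ}
    (D : ∀ i, Matrix (Fin (l i)) (Fin (l i)) ℝ) (i : o) (a : Fin (l i)) (F : (Σ i, Fin (l i)) → ℝ) :
    ∑ y, Matrix.blockDiagonal' D ⟨i, a⟩ y * F y = ∑ b, D i a b * F ⟨i, b⟩ := by
  rw [Fintype.sum_sigma, Finset.sum_eq_single i]
  · simp
  · intro i' _ hi
    simp [Matrix.blockDiagonal'_apply_ne D _ _ hi.symm]
  · simp

theorem inner_op_blockDiag (D : ∀ i, Matrix (Fin (m i)) (Fin (m i)) ℝ) (d : Fin f → ℝ)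
    (p q : Sig (Chan m r)) :
    inner ℝ p (op (blockDiag D fun j => d j • 1) q)
      = ∑ i, ∑ a, ∑ b, D i a b * inner ℝ (p.sub fun _ : Unit => .inl ⟨i, a⟩)
          (q.sub fun _ : Unit => .inl ⟨i, b⟩)
        + ∑ j, d j * inner ℝ (p.sub fun b : Fin (r j) => .inr ⟨j, b⟩)
          (q.sub fun b : Fin (r j) => .inr ⟨j, b⟩) := by
  rw [inner_op_eq_sum, Fintype.sum_sum_type, Fintype.sum_sigma, Fintype.sum_sigma]
  congr 1
  · refine Finset.sum_congr rfl fun i _ => Finset.sum_congr rfl fun a _ => ?_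
    simp only [blockDiag, Fintype.sum_sum_type, Matrix.fromBlocks_apply₁₁,
      Matrix.fromBlocks_apply₁₂, Matrix.zero_apply, zero_mul, Finset.sum_const_zero, add_zero]
    rw [sum_blockDiagonal'_mul D i a fun y => inner ℝ (p.sub fun _ : Unit => .inl ⟨i, a⟩)
      (q.sub fun _ : Unit => .inl y)]
  · refine Finset.sum_congr rfl fun j _ => ?_
    rw [inner_eq_sum_sub, Finset.mul_sum]
    refine Finset.sum_congr rfl fun a _ => ?_
    simp only [blockDiag, Fintype.sum_sum_type, Matrix.fromBlocks_apply₂₁,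
      Matrix.fromBlocks_apply₂₂, Matrix.zero_apply, zero_mul, Finset.sum_const_zero, zero_add]
    rw [sum_blockDiagonal'_mul (fun j => d j • 1) j a
      fun y => inner ℝ (p.sub fun _ : Unit => .inr ⟨j, a⟩) (q.sub fun _ : Unit => .inr y)]
    simp only [Matrix.smul_apply, Matrix.one_apply, smul_eq_mul, mul_ite, mul_one, mul_zero,
      ite_mul, zero_mul, Finset.sum_ite_eq, Finset.mem_univ, if_true]
    rfl

/-- The form splits into one term per uncertainty block. A repeated scalar block, together with its
copy in the controller, contributes a semidefinite matrix form in scalar signals on which the same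
`δᵢ` acts; a full block contributes a 2 by 2 form in its two vector signals. On each term a Hilbert
space contraction can only decrease the form, without any causality. -/
theorem Uncertainty.inner_op_le (Δ : Uncertainty m r)
    {Θ : Matrix (Chan m r ⊕ Chan m r) (Chan m r ⊕ Chan m r) ℝ} (hΘ : Θ.PosSemidef)
    (hc : IsCommutant₂ Θ) {q p : Sig (Chan m r ⊕ Chan m r)} (h : Δ.Rel₂ q p) :
    inner ℝ p (op Θ p) ≤ inner ℝ q (op Θ q) := by
  obtain ⟨⟨D₁₁, d₁₁, h₁₁⟩, ⟨D₁₂, d₁₂, h₁₂⟩, ⟨D₂₁, d₂₁, h₂₁⟩, ⟨D₂₂, d₂₂, h₂₂⟩⟩ := hc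
  have hblocks : Θ = Matrix.fromBlocks _ _ _ _ := (Matrix.fromBlocks_toBlocks Θ).symm
  rw [h₁₁, h₁₂, h₂₁, h₂₂] at hblocks
  have key : ∀ g : Sig (Chan m r ⊕ Chan m r), inner ℝ g (op Θ g)
      = ∑ i, ∑ a : Fin (m i) ⊕ Fin (m i), ∑ b : Fin (m i) ⊕ Fin (m i),
          Matrix.fromBlocks (D₁₁ i) (D₁₂ i) (D₂₁ i) (D₂₂ i) a b * inner ℝ
            (g.sub fun _ : Unit => Sum.map (fun a => .inl ⟨i, a⟩) (fun a => .inl ⟨i, a⟩) a)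
            (g.sub fun _ : Unit => Sum.map (fun a => .inl ⟨i, a⟩) (fun a => .inl ⟨i, a⟩) b)
        + ∑ j, ∑ a : Unit ⊕ Unit, ∑ b : Unit ⊕ Unit,
          Matrix.fromBlocks (.of fun _ _ => d₁₁ j) (.of fun _ _ => d₁₂ j) (.of fun _ _ => d₂₁ j)
            (.of fun _ _ => d₂₂ j) a b * inner ℝ
            (g.sub fun x : Fin (r j) => Sum.map (fun _ => .inr ⟨j, x⟩) (fun _ => .inr ⟨j, x⟩) a)
            (g.sub fun x : Fin (r j) => Sum.map (fun _ => .inr ⟨j, x⟩) (fun _ => .inr ⟨j, x⟩) b)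
      := by
    intro g
    have hg : inner ℝ g (op Θ g) = inner ℝ (g.sub Sum.inl) (op Θ.toBlocks₁₁ (g.sub Sum.inl))
        + inner ℝ (g.sub Sum.inl) (op Θ.toBlocks₁₂ (g.sub Sum.inr))
        + inner ℝ (g.sub Sum.inr) (op Θ.toBlocks₂₁ (g.sub Sum.inl))
        + inner ℝ (g.sub Sum.inr) (op Θ.toBlocks₂₂ (g.sub Sum.inr)) := by
      rw [inner_op_eq_sum, sum_sum_sumType]
      simp only [inner_op_eq_sum]
      rfl
    rw [hg, h₁₁, h₁₂, h₂₁, h₂₂]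
    simp only [inner_op_blockDiag, sum_sum_sumType, Finset.sum_add_distrib]
    have e : ∀ A B C D A' B' C' D' : ℝ, A + A' + (B + B') + (C + C') + (D + D')
        = A + B + C + D + (A' + B' + C' + D') := fun _ _ _ _ _ _ _ _ => by ring
    rw [e]
    simp only [Finset.univ_unique, Finset.sum_singleton]
    rfl
  rw [key, key]
  refine add_le_add (Finset.sum_le_sum fun i _ => ?_) (Finset.sum_le_sum fun j _ => ?_)
  · have hM : (Matrix.fromBlocks (D₁₁ i) (D₁₂ i) (D₂₁ i) (D₂₂ i)).PosSemidef := by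
      have := hΘ.submatrix (Sum.map (fun a : Fin (m i) => (.inl ⟨i, a⟩ : Chan m r))
        (fun a : Fin (m i) => (.inl ⟨i, a⟩ : Chan m r)))
      convert! this using 1
      ext (a | a) (b | b) <;> simp [hblocks, blockDiag]
    refine le_trans (le_of_eq ?_) (sum_inner_map_le hM (Δ.scalar i) (Δ.scalar_le i) _)
    have e : ∀ a : Fin (m i) ⊕ Fin (m i),
        (p.sub fun _ : Unit => Sum.map (fun a => .inl ⟨i, a⟩) (fun a => .inl ⟨i, a⟩) a)
        = Δ.scalar i
          (q.sub fun _ : Unit => Sum.map (fun a => .inl ⟨i, a⟩) (fun a => .inl ⟨i, a⟩) a) := by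
      rintro (a | a)
      · exact h.1.1 i a
      · exact h.2.1 i a
    simp only [e]
  -- The 2 by 2 matrix of coefficients is a principal submatrix of `Θ` taken at one coordinate of
  -- the block, so an empty block needs separate treatment.
  · rcases isEmpty_or_nonempty (Fin (r j)) with he | ⟨⟨x⟩⟩
    · have e : ∀ u v : Sig (Fin (r j)), inner ℝ u v = 0 := fun u v => by
        rw [inner_eq_sum_sub]; simp
      simp only [e, mul_zero, Finset.sum_const_zero, le_refl]
    have hM : (Matrix.fromBlocks (.of fun _ _ => d₁₁ j) (.of fun _ _ => d₁₂ j)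
        (.of fun _ _ => d₂₁ j) (.of fun _ _ => d₂₂ j) :
          Matrix (Unit ⊕ Unit) (Unit ⊕ Unit) ℝ).PosSemidef := by
      have := hΘ.submatrix (Sum.map (fun _ : Unit => (.inr ⟨j, x⟩ : Chan m r))
        (fun _ : Unit => (.inr ⟨j, x⟩ : Chan m r)))
      convert! this using 1
      ext (a | a) (b | b) <;> simp [hblocks, blockDiag]
    refine le_trans (le_of_eq ?_) (sum_inner_map_le hM (Δ.full j) (Δ.full_le j) _)
    have e : ∀ a : Unit ⊕ Unit,
        (p.sub fun x : Fin (r j) => Sum.map (fun _ => .inr ⟨j, x⟩) (fun _ => .inr ⟨j, x⟩) a)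
        = Δ.full j
          (q.sub fun x : Fin (r j) => Sum.map (fun _ => .inr ⟨j, x⟩) (fun _ => .inr ⟨j, x⟩) a) := by
      rintro (a | a)
      · exact h.1.2 j
      · exact h.2.2 j
    simp only [e]

/-- A constant value acts pointwise as an admissible operator uncertainty. Applied to an impulse at
time zero, the inequality on signals becomes the pointwise one. -/
theorem form_mulVec_le_of_mem_valueSet
    {Θ : Matrix (Chan m r ⊕ Chan m r) (Chan m r ⊕ Chan m r) ℝ} (hΘ : Θ.PosSemidef)
    (hc : IsCommutant₂ Θ) {Δ : Matrix (Chan m r) (Chan m r) ℝ} (hΔ : Δ ∈ valueSet m r)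
    (q : Chan m r ⊕ Chan m r → ℝ) :
    form Θ (Matrix.fromBlocks Δ 0 0 Δ *ᵥ q) (Matrix.fromBlocks Δ 0 0 Δ *ᵥ q) ≤ form Θ q q := by
  obtain ⟨δ, E, hδ, hE, rfl⟩ := hΔ
  let Δ' : Uncertainty m r :=
    { scalar := fun i => δ i • ContinuousLinearMap.id ℝ _
      full := fun j => pointwise (Matrix.toEuclideanCLM (𝕜 := ℝ) (E j))
      scalar_le := fun i => by
        refine (norm_smul_le (δ i) (ContinuousLinearMap.id ℝ (Sig Unit))).trans ?_
        rw [Real.norm_eq_abs]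
        exact mul_le_one₀ (hδ i) (norm_nonneg _) ContinuousLinearMap.norm_id_le
      full_le := fun j => (norm_pointwise_le _).trans (hE j) }
  set Δ₂ := Matrix.fromBlocks (blockDiag (r := r) (fun i => δ i • 1) E) 0 0
    (blockDiag (fun i => δ i • 1) E) with hΔ₂
  have h := Δ'.inner_op_le hΘ hc (q := impulse q) (p := impulse (Δ₂ *ᵥ q)) ?_
  · rw [inner_impulse, inner_impulse] at h
    simpa [form] using h
  · have hsub : ∀ x : Chan m r ⊕ Chan m r → ℝ, Δ'.Rel ((impulse x).sub Sum.inl)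
        ((impulse (Δ₂ *ᵥ x)).sub Sum.inl) ∧ Δ'.Rel ((impulse x).sub Sum.inr)
        ((impulse (Δ₂ *ᵥ x)).sub Sum.inr) := by
      intro x
      have e1 : ∀ c, (Δ₂ *ᵥ x) (.inl c) = (blockDiag (fun i => δ i • 1) E *ᵥ (x ∘ .inl)) c := by
        intro c
        simp [hΔ₂, Matrix.fromBlocks_mulVec]
      have e2 : ∀ c, (Δ₂ *ᵥ x) (.inr c) = (blockDiag (fun i => δ i • 1) E *ᵥ (x ∘ .inr)) c := by
        intro c
        simp [hΔ₂, Matrix.fromBlocks_mulVec]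
      have e3 : ∀ (y : Chan m r → ℝ) i a,
          (blockDiag (fun i => δ i • 1) E *ᵥ y) (.inl ⟨i, a⟩) = δ i * y (.inl ⟨i, a⟩) := by
        intro y i a
        simp only [blockDiag, Matrix.mulVec, dotProduct, Fintype.sum_sum_type,
          Matrix.fromBlocks_apply₁₁, Matrix.fromBlocks_apply₁₂, Matrix.zero_apply, zero_mul,
          Finset.sum_const_zero, add_zero]
        rw [sum_blockDiagonal'_mul (fun i => δ i • 1) i a fun z => y (.inl z)]
        simp [Matrix.one_apply]
      have e4 : ∀ (y : Chan m r → ℝ) j b, (blockDiag (fun i => δ i • 1) E *ᵥ y) (.inr ⟨j, b⟩)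
          = (E j *ᵥ fun b => y (.inr ⟨j, b⟩)) b := by
        intro y j b
        simp only [blockDiag, Matrix.mulVec, dotProduct, Fintype.sum_sum_type,
          Matrix.fromBlocks_apply₂₁, Matrix.fromBlocks_apply₂₂, Matrix.zero_apply, zero_mul,
          Finset.sum_const_zero, zero_add]
        rw [sum_blockDiagonal'_mul E j b fun z => y (.inr z)]
      have e5 : ∀ j (g : Sig (Fin (r j))) k,
          (pointwise (Matrix.toEuclideanCLM (𝕜 := ℝ) (E j)) g).at k = E j *ᵥ g.at k := by
        intro j g k
        rfl
      refine ⟨⟨fun i a => Sig.ext_at fun k => ?_, fun j => Sig.ext_at fun k => ?_⟩,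
        ⟨fun i a => Sig.ext_at fun k => ?_, fun j => Sig.ext_at fun k => ?_⟩⟩
      all_goals
        funext b
        cases k <;> simp [Δ', e1, e2, e3, e4, e5] <;>
          first | rfl | exact (congrFun (Matrix.mulVec_zero _) b).symm
    exact hsub q

end Structure

/-! ## Autocorrelation of nearly white signals -/

section Fourier

open MeasureTheory AddCircle

variable {ι : Type} [Fintype ι]

/-- Only the primitive of `u` is small, so the derivative is moved onto `φ` by parts; the boundary
term contributes `η` and the remaining integral `C * T * η`. The primitive is merely absolutely
continuous, as `u` is only integrable. -/
theorem abs_integral_mul_le_of_abs_integral_le {φ φ' u : ℝ → ℝ} {C η T : ℝ} (hT : 0 ≤ T)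
    (hφ : ∀ x, HasDerivAt φ (φ' x) x) (hφ' : Continuous φ') (h1 : ∀ x, |φ x| ≤ 1)
    (h2 : ∀ x, |φ' x| ≤ C) (hu : IntervalIntegrable u volume 0 T)
    (hη : ∀ s ∈ Set.Icc 0 T, |∫ x in (0 : ℝ)..s, u x| ≤ η) :
    |∫ x in (0 : ℝ)..T, φ x * u x| ≤ (1 + C * T) * η := by
  have hη0 : 0 ≤ η := (abs_nonneg _).trans (hη 0 ⟨le_rfl, hT⟩)
  have hC : 0 ≤ C := (abs_nonneg _).trans (h2 0)
  set g : ℝ → ℝ := fun s => ∫ x in (0 : ℝ)..s, u x with hg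
  have hgac : AbsolutelyContinuousOnInterval g 0 T :=
    hu.absolutelyContinuousOnInterval_intervalIntegral Set.left_mem_uIcc
  have hφac : AbsolutelyContinuousOnInterval φ 0 T := by
    refine ContDiffOn.absolutelyContinuousOnInterval (ContDiff.contDiffOn ?_)
    rw [contDiff_one_iff_deriv]
    have e : deriv φ = φ' := funext fun x => (hφ x).deriv
    exact ⟨fun x => (hφ x).differentiableAt, e ▸ hφ'⟩
  have h3 := hφac.integral_mul_deriv_eq_deriv_mul hgac
  have h4 : ∫ x in (0 : ℝ)..T, φ x * u x = ∫ x in (0 : ℝ)..T, φ x * deriv g x := by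
    refine intervalIntegral.integral_congr_ae ?_
    filter_upwards [hu.ae_hasDerivAt_integral] with x hx hx'
    rw [(hx (Set.uIoc_subset_uIcc hx') 0 Set.left_mem_uIcc).deriv]
  have h5 : g 0 = 0 := by simp [hg]
  rw [h4, h3, h5, mul_zero, sub_zero]
  have h6 : |φ T * g T| ≤ η := by
    rw [abs_mul]
    exact (mul_le_mul (h1 T) (hη T ⟨hT, le_rfl⟩) (abs_nonneg _) zero_le_one).trans_eq (one_mul _)
  have h7 : ‖∫ x in (0 : ℝ)..T, deriv φ x * g x‖ ≤ (C * η) * |T - 0| := by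
    refine intervalIntegral.norm_integral_le_of_norm_le_const fun x hx => ?_
    rw [Set.uIoc_of_le hT] at hx
    rw [(hφ x).deriv, Real.norm_eq_abs, abs_mul]
    exact mul_le_mul (h2 x) (hη x ⟨hx.1.le, hx.2⟩) (abs_nonneg _) hC
  rw [sub_zero, abs_of_nonneg hT, Real.norm_eq_abs] at h7
  calc _ ≤ |φ T * g T| + |∫ x in (0 : ℝ)..T, deriv φ x * g x| := abs_sub _ _
    _ ≤ η + C * η * T := add_le_add h6 h7
    _ = _ := by ring

theorem summable_sq_at (f : Sig ι) (i : ι) : Summable fun k => ‖(f.at k i : ℂ)‖ ^ 2 := by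
  have h := (Sig.hasSum_inner (f.sub fun _ : Unit => i) (f.sub fun _ : Unit => i)).summable
  simpa [dotProduct, sq] using h

/-- Orthonormality of the exponentials and square summability of the coordinates give convergence,
so the `tsum` in the definition is a genuine sum and not the default value. -/
theorem hasSum_fourierTransform (f : Sig ι) (i : ι) :
    HasSum (fun k : ℕ => (f.at k i : ℂ) • fourierLp (T := 2 * π) 2 (-(k : ℤ)))
      (fourierTransform f i) := by
  refine Summable.hasSum ?_
  have ho : Orthonormal ℂ fun k : ℕ => fourierLp (T := 2 * π) 2 (-(k : ℤ)) :=
    orthonormal_fourier.comp _ fun a b h => by simpa using h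
  exact (ho.orthogonalFamily.summable_iff_norm_sq_summable _).2 (summable_sq_at f i)

theorem hasSum_inner_fourierTransform (f : Sig ι) (i : ι) (n : ℤ) :
    HasSum (fun k : ℕ => if n = -(k : ℤ) then (f.at k i : ℂ) else 0)
      (inner ℂ (fourierTransform f i) (fourierLp (T := 2 * π) 2 n)) := by
  have h := Complex.conjCLE.toContinuousLinearMap.hasSum
    (((hasSum_fourierTransform f i).mapL (innerSL ℂ (fourierLp (T := 2 * π) 2 n))))
  convert! h using 1
  · funext k
    have ho := orthonormal_iff_ite.1 (orthonormal_fourier (T := 2 * π)) n (-(k : ℤ))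
    simp only [map_smul, innerSL_apply_apply, ho]
    split_ifs <;> simp
  · simp

theorem inner_fourierTransform (f : Sig ι) (i : ι) (k : ℕ) :
    inner ℂ (fourierTransform f i) (fourierLp (T := 2 * π) 2 (-(k : ℤ))) = (f.at k i : ℂ) := by
  refine (hasSum_inner_fourierTransform f i (-(k : ℤ))).unique ?_
  convert! hasSum_ite_eq k (f.at k i : ℂ) using 1
  funext l
  rcases eq_or_ne l k with rfl | h
  · simp
  · rw [if_neg (by omega), if_neg h]

theorem inner_fourierTransform_pos (f : Sig ι) (i : ι) (n : ℤ) (hn : 0 < n) :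
    inner ℂ (fourierTransform f i) (fourierLp (T := 2 * π) 2 n) = 0 := by
  refine (hasSum_inner_fourierTransform f i n).unique ?_
  convert! hasSum_zero using 1
  funext k
  exact if_neg (by omega)

/-- The correlation of coordinate `a` of `f`, advanced by `j` steps, with coordinate `b`. -/
def corr (f : Sig ι) (j : ℕ) (a b : ι) : ℝ :=
  inner ℝ (((advance ^ j) f).sub fun _ : Unit => a) (f.sub fun _ : Unit => b)

theorem hasSum_corr (f : Sig ι) (j : ℕ) (a b : ι) :
    HasSum (fun k => f.at (k + j) a * f.at k b) (corr f j a b) := by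
  have h := Sig.hasSum_inner (((advance ^ j) f).sub fun _ : Unit => a) (f.sub fun _ : Unit => b)
  simp only [dotProduct, Finset.univ_unique, Finset.sum_singleton, Sig.sub_at, advance_pow_at] at h
  exact h

theorem memLp_fourier_mul (f : Sig ι) (i : ι) (n : ℤ) :
    MemLp (fun t => fourier n t * fourierTransform f i t) 2 (haarAddCircle (T := 2 * π)) := by
  refine MemLp.of_le (Lp.memLp (fourierTransform f i))
    ((fourier n).continuous.aestronglyMeasurable.mul (Lp.aestronglyMeasurable _))
    (Filter.Eventually.of_forall fun t => ?_)
  rw [norm_mul, fourier_apply, Circle.norm_coe, one_mul]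

/-- Multiplication by an exponential shifts Fourier coefficients. The integral is the inner product
of `f_a` with a modulated `f_b`, and expanding `f_a` in exponentials leaves the correlation at lag
`j`. -/
theorem integral_fourier_mul_eq_corr (f : Sig ι) (j : ℕ) (a b : ι) :
    ∫ t, fourier (j : ℤ) t * (fourierTransform f a t * (starRingEnd ℂ) (fourierTransform f b t))
      ∂haarAddCircle (T := 2 * π) = (corr f j a b : ℂ) := by
  set h := (memLp_fourier_mul f b (-(j : ℤ))).toLp _ with hh
  have hco := (memLp_fourier_mul f b (-(j : ℤ))).coeFn_toLp
  have e1 : inner ℂ h (fourierTransform f a) = ∫ t, fourier (j : ℤ) t *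
      (fourierTransform f a t * (starRingEnd ℂ) (fourierTransform f b t))
      ∂haarAddCircle (T := 2 * π) := by
    rw [L2.inner_def]
    refine integral_congr_ae ?_
    filter_upwards [hco] with t ht
    rw [hh, ht, RCLike.inner_apply]
    simp only [map_mul, fourier_neg, RingHomCompTriple.comp_apply, RingHom.id_apply]
    ring
  have e2 : ∀ n : ℤ, inner ℂ h (fourierLp (T := 2 * π) 2 n)
      = inner ℂ (fourierTransform f b) (fourierLp (T := 2 * π) 2 (j + n)) := by
    intro n
    rw [L2.inner_def, L2.inner_def]
    refine integral_congr_ae ?_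
    filter_upwards [hco, coeFn_fourierLp (T := 2 * π) 2 n, coeFn_fourierLp (T := 2 * π) 2 (j + n)]
      with t ht h1 h2
    rw [hh, ht, h1, h2, RCLike.inner_apply, RCLike.inner_apply]
    simp only [map_mul, fourier_neg, fourier_add, RingHomCompTriple.comp_apply, RingHom.id_apply]
    ring
  rw [← e1]
  have h3 := (hasSum_fourierTransform f a).mapL (innerSL ℂ h)
  simp only [innerSL_apply_apply, inner_smul_right, e2] at h3
  refine h3.unique ?_
  have h4 : HasSum (fun k => ((f.at (k + j) a * f.at k b : ℝ) : ℂ)) (corr f j a b : ℂ) :=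
    Complex.hasSum_ofReal.2 (hasSum_corr f j a b)
  -- The terms with `k < j` pair `f_b` with a positive frequency and vanish because signals start at
  -- time zero; the rest is reindexed by `k + j`.
  have h5 := (hasSum_nat_add_iff (f := fun k : ℕ => (f.at k a : ℂ) *
    inner ℂ (fourierTransform f b) (fourierLp (T := 2 * π) 2 (j + -(k : ℤ)))) j
    (g := (corr f j a b : ℂ))).1 ?_
  · rwa [Finset.sum_eq_zero, add_zero] at h5
    intro k hk
    have := Finset.mem_range.1 hk
    rw [inner_fourierTransform_pos f b _ (by omega), mul_zero]
  · convert! h4 using 1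
    funext k
    have e : (j : ℤ) + -((k + j : ℕ) : ℤ) = -(k : ℤ) := by push_cast; ring
    rw [e, inner_fourierTransform]
    push_cast
    rfl

theorem integrable_spectrum (f : Sig ι) (a b : ι) :
    Integrable (fun t => fourierTransform f a t * (starRingEnd ℂ) (fourierTransform f b t))
      (haarAddCircle (T := 2 * π)) := by
  have := L2.integrable_inner (𝕜 := ℂ) (fourierTransform f b) (fourierTransform f a)
  refine this.congr (Filter.Eventually.of_forall fun t => ?_)
  simp [RCLike.inner_apply]

/-- The density of the cumulative spectrum. -/
def spectrum (f : Sig ι) (a b : ι) (x : ℝ) : ℂ :=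
  fourierTransform f a (x : AddCircle (2 * π)) *
    (starRingEnd ℂ) (fourierTransform f b (x : AddCircle (2 * π))) / ((2 * π : ℝ) : ℂ)

theorem intervalIntegrable_spectrum (f : Sig ι) (a b : ι) :
    IntervalIntegrable (spectrum f a b) volume 0 (2 * π) := by
  have h : Integrable (fun t => fourierTransform f a t * (starRingEnd ℂ) (fourierTransform f b t))
      (volume : Measure (AddCircle (2 * π))) := by
    rw [volume_eq_smul_haarAddCircle]
    exact (integrable_spectrum f a b).smul_measure ENNReal.ofReal_ne_top
  have h2 := (AddCircle.measurePreserving_mk (2 * π) 0).integrable_comp_of_integrable h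
  rw [zero_add] at h2
  rw [intervalIntegrable_iff_integrableOn_Ioc_of_le Real.two_pi_pos.le]
  exact h2.div_const _

theorem corr_eq_integral (f : Sig ι) (j : ℕ) (a b : ι) :
    (corr f j a b : ℂ) = ∫ x in (0 : ℝ)..2 * π,
      (Real.cos (j * x) + Real.sin (j * x) * Complex.I) * spectrum f a b x := by
  have h := fourierCoeff_eq_intervalIntegral (T := 2 * π)
    (fun t => fourierTransform f a t * (starRingEnd ℂ) (fourierTransform f b t)) (-(j : ℤ)) 0
  rw [fourierCoeff, neg_neg, zero_add] at h
  simp only [smul_eq_mul] at h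
  rw [integral_fourier_mul_eq_corr] at h
  rw [h, ← intervalIntegral.integral_smul]
  refine intervalIntegral.integral_congr fun x _ => ?_
  have e : (fourier (T := 2 * π) (j : ℤ) (x : AddCircle (2 * π)) : ℂ)
      = Real.cos (j * x) + Real.sin (j * x) * Complex.I := by
    rw [fourier_coe_apply, Complex.ofReal_cos, Complex.ofReal_sin, ← Complex.exp_mul_I]
    congr 1
    push_cast
    have : (π : ℂ) ≠ 0 := by exact_mod_cast Real.pi_ne_zero
    field_simp
  simp only [e, spectrum, Complex.real_smul]
  push_cast
  ring

/-- Correlations are the Fourier coefficients of the spectral density, and near whiteness says that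
its primitive is within `η` of linear. The constant part of the density accounts for the lag-zero
value, and the deviation is integrated by parts against `cos (j x)` and `sin (j x)`. The bound grows
with the lag, so only finitely many lags can be handled at once. -/
theorem abs_corr_sub_le [DecidableEq ι] {f : Sig ι} {η : ℝ} (hf : f ∈ whiteSet ι η) (j : ℕ)
    (a b : ι) : |corr f j a b - if j = 0 ∧ a = b then ‖f‖ ^ 2 / Fintype.card ι else 0|
      ≤ 2 * (1 + 2 * π * j) * η := by
  obtain ⟨η', hη, hw⟩ := hf
  -- The slope of the white cumulative spectrum; `2π c` is the white correlation at lag zero.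
  set c : ℝ := if a = b then ‖f‖ ^ 2 / (2 * Fintype.card ι * π) else 0 with hc
  have hw' : ∀ s ∈ Set.Icc (0 : ℝ) (2 * π),
      ‖(∫ x in (0 : ℝ)..s, spectrum f a b x) - ((s * c : ℝ) : ℂ)‖ ≤ η := by
    intro s hs
    have := (hw s hs a b).trans hη.le
    convert! this using 4
    rw [Matrix.smul_apply, Matrix.one_apply, hc]
    split_ifs <;> simp; ring
  have hT : (0 : ℝ) ≤ 2 * π := Real.two_pi_pos.le
  have hI := intervalIntegrable_spectrum f a b
  have hIs : ∀ s ∈ Set.Icc (0 : ℝ) (2 * π), IntervalIntegrable (spectrum f a b) volume 0 s :=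
    fun s hs => hI.mono_set (by
      rw [Set.uIcc_of_le hs.1, Set.uIcc_of_le hT]; exact Set.Icc_subset_Icc_right hs.2)
  have hre : ∀ s ∈ Set.Icc (0 : ℝ) (2 * π), IntervalIntegrable
      (fun x => (spectrum f a b x).re) volume 0 s := fun s hs =>
    ⟨(hIs s hs).1.re, (hIs s hs).2.re⟩
  have him : ∀ s ∈ Set.Icc (0 : ℝ) (2 * π), IntervalIntegrable
      (fun x => (spectrum f a b x).im) volume 0 s := fun s hs =>
    ⟨(hIs s hs).1.im, (hIs s hs).2.im⟩
  have hTm : 2 * π ∈ Set.Icc (0 : ℝ) (2 * π) := ⟨hT, le_rfl⟩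
  have ere : ∀ (F : ℝ → ℂ) s, IntervalIntegrable F volume 0 s →
      ∫ x in (0 : ℝ)..s, (F x).re = (∫ x in (0 : ℝ)..s, F x).re := fun F s h =>
    Complex.reCLM.intervalIntegral_comp_comm h
  have eim : ∀ (F : ℝ → ℂ) s, IntervalIntegrable F volume 0 s →
      ∫ x in (0 : ℝ)..s, (F x).im = (∫ x in (0 : ℝ)..s, F x).im := fun F s h =>
    Complex.imCLM.intervalIntegral_comp_comm h
  have hu := abs_integral_mul_le_of_abs_integral_le (φ := fun x => Real.cos (j * x))
    (φ' := fun x => -Real.sin (j * x) * j) (u := fun x => (spectrum f a b x).re - c) (C := j)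
    (η := η) hT (fun x => by
      simpa using ((hasDerivAt_id x).const_mul (j : ℝ)).cos)
    (by fun_prop) (fun x => Real.abs_cos_le_one _) (fun x => by
      rw [abs_mul, abs_neg, Nat.abs_cast]
      exact mul_le_of_le_one_left (Nat.cast_nonneg j) (Real.abs_sin_le_one _))
    ((hre _ hTm).sub intervalIntegrable_const) (fun s hs => by
      rw [intervalIntegral.integral_sub (hre s hs) intervalIntegrable_const, ere _ _ (hIs s hs)]
      refine le_trans ?_ (hw' s hs)
      refine le_trans (le_of_eq ?_) (Complex.abs_re_le_norm _)
      simp)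
  have hv := abs_integral_mul_le_of_abs_integral_le (φ := fun x => Real.sin (j * x))
    (φ' := fun x => Real.cos (j * x) * j) (u := fun x => (spectrum f a b x).im) (C := j)
    (η := η) hT (fun x => by
      simpa using ((hasDerivAt_id x).const_mul (j : ℝ)).sin)
    (by fun_prop) (fun x => Real.abs_sin_le_one _) (fun x => by
      rw [abs_mul, Nat.abs_cast]
      exact mul_le_of_le_one_left (Nat.cast_nonneg j) (Real.abs_cos_le_one _))
    (him _ hTm) (fun s hs => by
      rw [eim _ _ (hIs s hs)]
      refine le_trans ?_ (hw' s hs)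
      refine le_trans (le_of_eq ?_) (Complex.abs_im_le_norm _)
      simp)
  have hcos : ∫ x in (0 : ℝ)..2 * π, Real.cos (j * x) * c
      = if j = 0 ∧ a = b then ‖f‖ ^ 2 / Fintype.card ι else 0 := by
    rw [intervalIntegral.integral_mul_const, hc]
    rcases eq_or_ne j 0 with rfl | hj
    · have := Real.pi_ne_zero
      have : Fintype.card ι ≠ 0 := (Fintype.card_pos_iff.2 ⟨a⟩).ne'
      by_cases hab : a = b
      · simp [hab]
        field_simp
      · simp [hab]
    · have hj' : (j : ℝ) ≠ 0 := Nat.cast_ne_zero.2 hj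
      have : ∫ x in (0 : ℝ)..2 * π, Real.cos (j * x) = 0 := by
        rw [intervalIntegral.integral_comp_mul_left _ hj', integral_cos]
        have : (j : ℝ) * (2 * π) = ((2 * j : ℕ) : ℝ) * π := by push_cast; ring
        rw [this, Real.sin_nat_mul_pi]
        simp
      rw [this, zero_mul, if_neg (by tauto)]
  have hmul : ∀ {φ u : ℝ → ℝ}, Continuous φ → IntervalIntegrable u volume 0 (2 * π) →
      IntervalIntegrable (fun x => φ x * u x) volume 0 (2 * π) := fun hφ hu =>
    hu.continuousOn_mul hφ.continuousOn
  -- The correlation is real, so only the real part of the integral matters. Subtracting `c` from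
  -- the density accounts for the integral computed in `hcos`.
  have hcorr : corr f j a b - (if j = 0 ∧ a = b then ‖f‖ ^ 2 / Fintype.card ι else 0)
      = (∫ x in (0 : ℝ)..2 * π, Real.cos (j * x) * ((spectrum f a b x).re - c))
        - ∫ x in (0 : ℝ)..2 * π, Real.sin (j * x) * (spectrum f a b x).im := by
    have e1 := congrArg Complex.re (corr_eq_integral f j a b)
    rw [Complex.ofReal_re, ← ere] at e1
    · rw [e1, ← hcos, ← intervalIntegral.integral_sub, ← intervalIntegral.integral_sub]
      · refine intervalIntegral.integral_congr fun x _ => ?_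
        simp only [Complex.mul_re, Complex.add_re, Complex.ofReal_re, Complex.I_re, mul_zero,
          Complex.ofReal_im, Complex.I_im, mul_one, sub_self, add_zero, Complex.add_im,
          Complex.mul_im, zero_add]
        ring
      · exact hmul (by fun_prop) ((hre _ hTm).sub intervalIntegrable_const)
      · exact hmul (by fun_prop) (him _ hTm)
      · have := hI.continuousOn_mul (g := fun x : ℝ => (Real.cos (j * x) : ℂ)
          + Real.sin (j * x) * Complex.I) (Continuous.continuousOn (by fun_prop))
        exact ⟨this.1.re, this.2.re⟩
      · exact Continuous.intervalIntegrable (by fun_prop) _ _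
    · exact hI.continuousOn_mul (Continuous.continuousOn (by fun_prop))
  rw [hcorr]
  refine (abs_sub _ _).trans ?_
  calc _ ≤ (1 + j * (2 * π)) * η + (1 + j * (2 * π)) * η := add_le_add hu hv
    _ = _ := by ring

end Fourier

namespace LinSys

variable {X P D E : Type} [Fintype X] [Fintype P] [Fintype D] [Fintype E]
  [DecidableEq X] [DecidableEq P] [DecidableEq D]

/-! ## Exponential stability -/

/-- The matrix of the system. -/
def toMatrix (G : LinSys X P D E) : Matrix (X ⊕ P ⊕ E) (X ⊕ P ⊕ D) ℝ :=
  col3 (row3 G.A G.B₀ G.B₁) (row3 G.C₀ G.D₀ 0) (row3 G.C₁ G.D₁ 0)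

theorem toMatrix_mulVec (G : LinSys X P D E) (x : X → ℝ) (p : P → ℝ) (d : D → ℝ) :
    G.toMatrix *ᵥ Sum.elim x (Sum.elim p d)
      = Sum.elim (G.next x p + G.B₁ *ᵥ d) (Sum.elim (G.chan x p) (G.out x p)) := by
  simp only [toMatrix, col3, row3, next, chan, out, Matrix.fromRows_mulVec,
    Matrix.fromCols_mulVec, Matrix.zero_mulVec, add_zero, add_assoc, Sum.elim_comp_inl,
    Sum.elim_comp_inr]

theorem toMatrix_feedthrough (G : LinSys X P D E) :
    G.toMatrix.toBlocks₂₂.toBlocks₁₁ = G.D₀ := rfl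

variable {G : LinSys X P D E} {Θ : Matrix P P ℝ} {S Sp Sm : Matrix X X ℝ}

/-- The storage is a Lyapunov function common to all memoryless uncertainties: the scaling terms
have the right sign by `h𝒱`, and the margin `ε` gives the decay factor `1 - ε`. -/
theorem expStable {𝒱 : Set (Matrix P P ℝ)} (hS : S.PosDef) (hΘ : Θ.PosDef)
    (h : G.Dissipative Θ S)
    (h𝒱 : ∀ Δ ∈ 𝒱, ∀ q, form Θ (Δ *ᵥ q) (Δ *ᵥ q) ≤ form Θ q q) : ExpStable G.toMatrix 𝒱 := by
  obtain ⟨ε, h0, h1, hε⟩ := h.exists_le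
  have hSn := fun x => form_nonneg hS.posSemidef x
  have hΘn := fun p => form_nonneg hΘ.posSemidef p
  refine ⟨fun Δ hΔ => ?_, ?_⟩
  · rw [toMatrix_feedthrough, ← Matrix.mulVec_injective_iff_isUnit]
    intro v w hvw
    rw [← sub_eq_zero]
    set y := v - w
    have hy : y = G.D₀ *ᵥ (Δ *ᵥ y) := by
      have : (1 - G.D₀ * Δ) *ᵥ y = 0 := by
        rw [Matrix.mulVec_sub]; exact sub_eq_zero.2 hvw
      rw [Matrix.sub_mulVec, Matrix.one_mulVec, sub_eq_zero, ← Matrix.mulVec_mulVec] at this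
      exact this
    by_contra hne
    -- A kernel vector `y` reproduces itself around the algebraic loop at state zero, which the
    -- margin in `Θ` forbids.
    have a1 := hε 0 (Δ *ᵥ y)
    have a2 := hSn (G.next 0 (Δ *ᵥ y))
    have a3 : G.chan 0 (Δ *ᵥ y) = y := by simp [chan, ← hy]
    have a4 : 0 ≤ G.out 0 (Δ *ᵥ y) ⬝ᵥ G.out 0 (Δ *ᵥ y) := by
      simpa using dotProduct_star_self_nonneg (G.out 0 (Δ *ᵥ y))
    have a5 := h𝒱 Δ hΔ y
    simp only [supply, a3, form_zero_left, dotProduct_zero, add_zero, zero_add] at a1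
    have a6 : 0 < form Θ y y := form_pos hΘ hne
    have a7 := hΘn (Δ *ᵥ y)
    nlinarith
  · obtain ⟨c, hc0, -, hc⟩ := exists_pos_mul_le (V := X → ℝ) (f := fun x => form S x x)
      (g := fun x => ‖x‖ ^ 2) ((continuous_form S).comp (continuous_id.prodMk continuous_id))
      (by fun_prop) (fun c u => by rw [form_smul_left, form_smul_right]; ring)
      (fun c u => by rw [norm_smul, mul_pow, Real.norm_eq_abs, sq_abs])
      (fun u hu => form_pos hS hu)
    obtain ⟨C, hC0, -, hC⟩ := exists_pos_mul_le (V := X → ℝ) (f := fun x => ‖x‖ ^ 2)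
      (g := fun x => form S x x) (by fun_prop)
      ((continuous_form S).comp (continuous_id.prodMk continuous_id))
      (fun c u => by rw [norm_smul, mul_pow, Real.norm_eq_abs, sq_abs])
      (fun c u => by rw [form_smul_left, form_smul_right]; ring)
      (fun u hu => pow_pos (norm_pos_iff.2 hu) 2)
    have hρ : 0 < 1 - ε := sub_pos.2 h1
    refine ⟨√(1 / (c * C)), √(1 - ε), Real.sqrt_pos.2 (by positivity), Real.sqrt_pos.2 hρ, ?_,
      fun Δ hΔ x q p e hx hp k₀ k => ?_⟩
    · rw [Real.sqrt_lt' one_pos]; linarith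
    have hstep : ∀ k, form S (x (k + 1)) (x (k + 1)) ≤ (1 - ε) * form S (x k) (x k) := by
      intro k
      have b1 := hx k
      rw [toMatrix_mulVec, Matrix.mulVec_zero, add_zero, Sum.elim_eq_iff, Sum.elim_eq_iff] at b1
      obtain ⟨b1, b2, -⟩ := b1
      have a1 := hε (x k) (p k)
      have a4 : 0 ≤ G.out (x k) (p k) ⬝ᵥ G.out (x k) (p k) := by
        simpa using dotProduct_star_self_nonneg (G.out (x k) (p k))
      have a5 := h𝒱 (Δ k) (hΔ k) (q k)
      rw [← hp k] at a5
      have a6 : 0 ≤ x k ⬝ᵥ x k := by simpa using dotProduct_star_self_nonneg (x k)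
      have a7 := hΘn (p k)
      simp only [supply, ← b1, ← b2] at a1
      nlinarith
    have hind : ∀ k, form S (x (k₀ + k)) (x (k₀ + k)) ≤ (1 - ε) ^ k * form S (x k₀) (x k₀) := by
      intro k
      induction k with
      | zero => simp
      | succ k ih =>
        rw [← add_assoc, pow_succ', mul_assoc]
        exact (hstep _).trans (mul_le_mul_of_nonneg_left ih hρ.le)
    have h2 : ‖x (k₀ + k)‖ ^ 2 ≤ (1 / (c * C)) * (1 - ε) ^ k * ‖x k₀‖ ^ 2 := by
      have b1 := hc (x (k₀ + k))
      have b2 := hC (x k₀)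
      have b3 := hind k
      have b4 : (1 - ε) ^ k * (C * form S (x k₀) (x k₀)) ≤ (1 - ε) ^ k * ‖x k₀‖ ^ 2 :=
        mul_le_mul_of_nonneg_left b2 (by positivity)
      rw [mul_assoc, one_div, ← div_eq_inv_mul, le_div_iff₀ (by positivity)]
      nlinarith
    have h3 : √(1 - ε) ^ k = √((1 - ε) ^ k) := by
      rw [Real.sqrt_eq_rpow, Real.sqrt_eq_rpow, ← Real.rpow_natCast, ← Real.rpow_natCast,
        ← Real.rpow_mul hρ.le, ← Real.rpow_mul hρ.le, mul_comm]
    rw [h3, ← Real.sqrt_mul (by positivity), ← Real.sqrt_sq (norm_nonneg (x k₀)),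
      ← Real.sqrt_mul (by positivity)]
    exact Real.le_sqrt_of_sq_le h2

/-! ## The energy of the output -/

/-- The next state of a system on signals, without disturbance. -/
def sNext (G : LinSys X P D E) (x : Sig X) (p : Sig P) : Sig X := op G.A x + op G.B₀ p

/-- The input of the uncertainty, on signals. -/
def sChan (G : LinSys X P D E) (x : Sig X) (p : Sig P) : Sig P := op G.C₀ x + op G.D₀ p

/-- The performance output, on signals. -/
def sOut (G : LinSys X P D E) (x : Sig X) (p : Sig P) : Sig E := op G.C₁ x + op G.D₁ p

theorem hasSum_supply (x : Sig X) (p : Sig P) :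
    HasSum (fun k => G.supply Θ S (x.at k) (p.at k))
      (inner ℝ (G.sNext x p) (op S (G.sNext x p)) + inner ℝ (G.sChan x p) (op Θ (G.sChan x p))
        + inner ℝ (G.sOut x p) (G.sOut x p) - inner ℝ p (op Θ p)) :=
  (((Sig.hasSum_op S (G.sNext x p) (G.sNext x p)).add
    (Sig.hasSum_op Θ (G.sChan x p) (G.sChan x p))).add
    (Sig.hasSum_inner (G.sOut x p) (G.sOut x p))).sub (Sig.hasSum_op Θ p p)

theorem inner_op_comm {M : Matrix X X ℝ} (hM : Mᵀ = M) (f g : Sig X) :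
    inner ℝ f (op M g) = inner ℝ g (op M f) := by
  rw [real_inner_comm, inner_op_left, hM]

theorem inner_op_add_self {M : Matrix X X ℝ} (hM : Mᵀ = M) (f g : Sig X) :
    inner ℝ (f + g) (op M (f + g))
      = inner ℝ f (op M f) + 2 * inner ℝ f (op M g) + inner ℝ g (op M g) := by
  rw [map_add, inner_add_left, inner_add_right, inner_add_right, inner_op_comm hM g f]
  ring

theorem inner_op_advance_le {M : Matrix X X ℝ} (hM : M.PosSemidef) (f : Sig X) :
    inner ℝ (advance f) (op M (advance f)) ≤ inner ℝ f (op M f) := by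
  rw [inner_eq_add_inner_advance f, op_advance]
  exact le_add_of_nonneg_left (form_nonneg hM (f.at 0))

namespace Certificate

/-- The closed loop matrix of the feedback gain. -/
def AK (c : G.Certificate Θ) : Matrix X X ℝ := G.A + G.B₀ * c.K

/-- The weight of the current disturbance in the bound on the output energy. -/
def Y₀ (c : G.Certificate Θ) : Matrix D D ℝ :=
  G.B₁ᵀ * (c.S * G.B₁) + (c.S * G.B₁)ᵀ * (c.Z * (c.S * G.B₁))

/-- The weight of the adjoint state in the bound on the output energy. -/
def Y₁ (c : G.Certificate Θ) : Matrix D X ℝ :=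
  (G.B₁ᵀ + (c.S * G.B₁)ᵀ * c.Z) * c.AKᵀ

/-- The iteration of the adjoint system on signals. -/
def W (c : G.Certificate Θ) : Sig X →L[ℝ] Sig X := (op c.AKᵀ).comp advance

/-- The storage inequality leaves the cross term between the predicted state `z` and `b = S B₁ d`.
Pairing `z` with the adjoint state `w` transfers it to `B₀ v`, where `v` is the deviation of `p`
from the gain. Young's inequality pays for `v` with the slack `R`, and the covariance inequality
pays for `B₀ᵀ w`. What remains is quadratic in `d` and in the strictly future part of `w`. -/
theorem inner_out_le (c : G.Certificate Θ) {d : Sig D} {x : Sig X} {p : Sig P}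
    (hx : x = delay (G.sNext x p + op G.B₁ d))
    (hp : inner ℝ p (op Θ p) ≤ inner ℝ (G.sChan x p) (op Θ (G.sChan x p)))
    {w : Sig X} (hw : w = c.W w + op (c.S * G.B₁) d) :
    inner ℝ (G.sOut x p) (G.sOut x p)
      ≤ inner ℝ d (op c.Y₀ d) + 2 * inner ℝ d (op c.Y₁ (advance w)) := by
  have hST := c.S_psd.transpose_eq
  have hZT := c.Z_pos.transpose_eq
  set z := G.sNext x p with hz
  set v := p - op c.K x with hv
  set β := op G.B₁ d with hβ
  set b := op (c.S * G.B₁) d with hb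
  set g := op c.AKᵀ (advance w) with hg
  have hbS : b = op c.S β := op_mul _ _ _
  have hwg : w = g + b := hw
  have i1 : inner ℝ z (op c.S z) + inner ℝ (G.sChan x p) (op Θ (G.sChan x p))
      + inner ℝ (G.sOut x p) (G.sOut x p) - inner ℝ p (op Θ p) + inner ℝ v (op c.R v)
      ≤ inner ℝ x (op c.S x) :=
    hasSum_le (fun k => c.storage (x.at k) (p.at k))
      ((hasSum_supply (G := G) (Θ := Θ) (S := c.S) x p).add (Sig.hasSum_op c.R v v))
      (Sig.hasSum_op c.S x x)
  have i2 : inner ℝ x (op c.S x) = inner ℝ z (op c.S z) + 2 * inner ℝ z b + inner ℝ β b := by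
    rw [hx, op_delay, inner_delay_delay, inner_op_add_self hST, hbS]
  have hzv : z = op c.AK x + op G.B₀ v := by
    rw [AK, op_add, op_mul, hv, map_sub, hz, sNext]
    abel
  -- Adjointness of delay and advance: `x` is the delay of `z + β`, and advancing `w` under `AKᵀ`
  -- produces `g`.
  have i3 : inner ℝ (op c.AK x) w = inner ℝ z g + inner ℝ β g := by
    conv_lhs => rw [inner_op_left, hx, inner_delay_left, ← op_advance]
    rw [inner_add_left]
  have i4 : inner ℝ z b = inner ℝ (op G.B₀ v) w + inner ℝ β g := by
    have a1 : inner ℝ z w = inner ℝ z g + inner ℝ z b := by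
      conv_lhs => rw [hwg, inner_add_right]
    have a2 : inner ℝ z w = inner ℝ (op c.AK x) w + inner ℝ (op G.B₀ v) w := by
      conv_lhs => rw [hzv, inner_add_left]
    linarith
  have i5 : 2 * inner ℝ (op G.B₀ v) w
      ≤ inner ℝ v (op c.R v) + inner ℝ (op G.B₀ᵀ w) (op c.R⁻¹ (op G.B₀ᵀ w)) := by
    rw [inner_op_left, real_inner_comm, add_comm]
    exact hasSum_le (fun k => two_mul_dotProduct_le c.R_pos ((op G.B₀ᵀ w).at k) (v.at k))
      ((Sig.hasSum_inner (op G.B₀ᵀ w) v).mul_left 2)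
      ((Sig.hasSum_op c.R⁻¹ (op G.B₀ᵀ w) (op G.B₀ᵀ w)).add (Sig.hasSum_op c.R v v))
  have i6 : inner ℝ (op c.AKᵀ w) (op c.Z (op c.AKᵀ w))
      + inner ℝ (op G.B₀ᵀ w) (op c.R⁻¹ (op G.B₀ᵀ w)) ≤ inner ℝ w (op c.Z w) :=
    hasSum_le (fun k => c.covariance (w.at k))
      ((Sig.hasSum_op c.Z (op c.AKᵀ w) (op c.AKᵀ w)).add
        (Sig.hasSum_op c.R⁻¹ (op G.B₀ᵀ w) (op G.B₀ᵀ w))) (Sig.hasSum_op c.Z w w)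
  -- `g` is `AKᵀ w` advanced by one step, so its form loses only the nonnegative term at time zero.
  have i7 : inner ℝ g (op c.Z g) ≤ inner ℝ (op c.AKᵀ w) (op c.Z (op c.AKᵀ w)) :=
    inner_op_advance_le c.Z_pos.posSemidef (op c.AKᵀ w)
  have i8 : inner ℝ w (op c.Z w)
      = inner ℝ g (op c.Z g) + 2 * inner ℝ g (op c.Z b) + inner ℝ b (op c.Z b) := by
    conv_lhs => rw [hwg, inner_op_add_self hZT]
  have e1 : inner ℝ d (op c.Y₀ d) = inner ℝ β b + inner ℝ b (op c.Z b) := by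
    rw [Y₀, op_add, inner_add_right, op_mul, ← inner_op_left, op_mul (c.S * G.B₁)ᵀ,
      ← inner_op_left, op_mul c.Z]
  have e2 : inner ℝ d (op c.Y₁ (advance w)) = inner ℝ β g + inner ℝ g (op c.Z b) := by
    have a1 : inner ℝ β g = inner ℝ d (op G.B₁ᵀ g) := inner_op_left _ _ _
    have a2 : inner ℝ b (op c.Z g) = inner ℝ d (op (c.S * G.B₁)ᵀ (op c.Z g)) :=
      inner_op_left _ _ _
    rw [Y₁, op_mul, op_add, inner_add_right, op_mul (c.S * G.B₁)ᵀ, inner_op_comm hZT g b, a1, a2]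
  rw [e1, e2]
  linarith

/-- Advancing does not increase the form of `Z`, and `AKᵀ` contracts it by `ρ`; since `Z` is
positive definite, its form is equivalent to the squared norm. -/
theorem tendsto_norm_W_pow (c : G.Certificate Θ) :
    Filter.Tendsto (fun k : ℕ => ‖c.W ^ k‖) Filter.atTop (𝓝 0) := by
  obtain ⟨l, hl0, hl⟩ := exists_pos_mul_dotProduct_le c.Z_pos
  refine tendsto_norm_pow_of_contraction (N := fun u => inner ℝ u (op c.Z u)) (C := ‖op c.Z‖)
    hl0 c.ρ_nonneg c.ρ_lt (fun u => ?_) (fun u => ?_) (fun u => ?_)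
  · rw [← real_inner_self_eq_norm_sq]
    exact hasSum_le (fun k => hl (u.at k)) ((Sig.hasSum_inner u u).mul_left l)
      (Sig.hasSum_op c.Z u u)
  · calc inner ℝ u (op c.Z u) ≤ ‖u‖ * ‖op c.Z u‖ := real_inner_le_norm _ _
      _ ≤ ‖u‖ * (‖op c.Z‖ * ‖u‖) :=
          mul_le_mul_of_nonneg_left ((op c.Z).le_opNorm u) (norm_nonneg _)
      _ = _ := by ring
  · exact (inner_op_advance_le c.Z_pos.posSemidef (op c.AKᵀ u)).trans
      (hasSum_le (fun k => c.contract (u.at k)) (Sig.hasSum_op c.Z (op c.AKᵀ u) (op c.AKᵀ u))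
        ((Sig.hasSum_op c.Z u u).mul_left c.ρ))

theorem W_pow_apply (c : G.Certificate Θ) (j : ℕ) (u : Sig X) :
    (c.W ^ j) u = op (c.AKᵀ ^ j) ((advance ^ j) u) := by
  induction j generalizing u with
  | zero => simp
  | succ j ih =>
    rw [pow_succ, mul_apply_eq_comp, ih, W, ContinuousLinearMap.comp_apply, pow_succ, op_mul,
      pow_succ, mul_apply_eq_comp]
    congr 1
    refine Sig.ext_at fun k => ?_
    rw [advance_pow_at, op_at, op_at, advance_pow_at]

end Certificate

/-- The quadratic form is a finite combination of correlations at lag `j`; for white noise only the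
diagonal at lag zero survives. The constant depends on the lag but not on the signal. -/
theorem exists_abs_inner_sub_le (M : Matrix D D ℝ) (j : ℕ) : ∃ C : ℝ, ∀ (η : ℝ) (d : Sig D),
    d ∈ whiteSet D η → ‖d‖ = 1 →
    |inner ℝ d (op M ((advance ^ j) d)) - if j = 0 then M.trace / Fintype.card D else 0|
      ≤ C * η := by
  refine ⟨∑ a, ∑ b, |M a b| * (2 * (1 + 2 * π * j)), fun η d hd hd1 => ?_⟩
  have e : inner ℝ d (op M ((advance ^ j) d)) - (if j = 0 then M.trace / Fintype.card D else 0)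
      = ∑ a, ∑ b, M a b * (corr d j b a
          - if j = 0 ∧ b = a then ‖d‖ ^ 2 / Fintype.card D else 0) := by
    simp only [mul_sub, Finset.sum_sub_distrib]
    congr 1
    · rw [inner_op_eq_sum]
      refine Finset.sum_congr rfl fun a _ => Finset.sum_congr rfl fun b _ => ?_
      rw [corr, real_inner_comm]
    · rw [hd1]
      by_cases hj : j = 0
      · simp [hj, Matrix.trace, div_eq_mul_inv, Finset.sum_mul]
      · simp [hj]
  rw [e, Finset.sum_mul]
  refine (Finset.abs_sum_le_sum_abs _ _).trans (Finset.sum_le_sum fun a _ => ?_)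
  rw [Finset.sum_mul]
  refine (Finset.abs_sum_le_sum_abs _ _).trans (Finset.sum_le_sum fun b _ => ?_)
  rw [abs_mul, mul_assoc]
  exact mul_le_mul_of_nonneg_left (abs_corr_sub_le hd j b a) (abs_nonneg _)

end LinSys

namespace LinSys

variable {X P D E : Type} [Fintype X] [Fintype P] [Fintype D] [Fintype E]
  [DecidableEq X] [DecidableEq P] [DecidableEq D]
  {G : LinSys X P D E} {Θ : Matrix P P ℝ} {S Sp Sm : Matrix X X ℝ}

/-- The output energy under nearly white disturbances of unit energy is nearly bounded by the mean
of the diagonal of `Y₀`. -/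
theorem Certificate.exists_inner_out_le (c : G.Certificate Θ) {δ : ℝ} (hδ : 0 < δ) :
    ∃ η : ℝ, 0 < η ∧ ∀ (d : Sig D) (x : Sig X) (p : Sig P), d ∈ whiteSet D η → ‖d‖ = 1 →
      x = delay (G.sNext x p + op G.B₁ d) →
      inner ℝ p (op Θ p) ≤ inner ℝ (G.sChan x p) (op Θ (G.sChan x p)) →
      ‖G.sOut x p‖ ^ 2 ≤ c.Y₀.trace / Fintype.card D + δ := by
  obtain ⟨u, hu⟩ := isUnit_one_sub_of_tendsto_pow c.tendsto_norm_W_pow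
  set V : Sig X →L[ℝ] Sig X := ↑u⁻¹ with hV
  have hVW : ∀ f, V f = c.W (V f) + f := by
    intro f
    have h1 : ((u : Sig X →L[ℝ] Sig X) * V) f = f := by rw [hV, u.mul_inv]; rfl
    rw [hu] at h1
    have h2 : V f - c.W (V f) = f := h1
    exact sub_eq_iff_eq_add'.1 h2
  set w : Sig D → Sig X := fun d => V (op (c.S * G.B₁) d) with hw
  have hwW : ∀ d, w d = c.W (w d) + op (c.S * G.B₁) d := fun d => hVW _
  -- A truncated Neumann series: the whiteness estimates are not uniform in the lag, so the tail is
  -- kept as an operator remainder.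
  have hiter : ∀ d N, w d = ∑ j ∈ Finset.range N, (c.W ^ j) (op (c.S * G.B₁) d)
      + (c.W ^ N) (w d) := by
    intro d N
    induction N with
    | zero => simp
    | succ N ih =>
      have h1 : (c.W ^ N) (w d) = (c.W ^ (N + 1)) (w d) + (c.W ^ N) (op (c.S * G.B₁) d) := by
        rw [pow_succ, mul_apply_eq_comp, ← map_add, ← hwW]
      rw [Finset.sum_range_succ, add_assoc, add_comm ((c.W ^ N) _), ← h1]
      exact ih
  set B : ℝ := ‖op c.Y₁‖ * ‖(advance : Sig X →L[ℝ] Sig X)‖ * ‖V‖ * ‖op (c.S * G.B₁)‖ with hB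
  have hB0 : 0 ≤ B := by positivity
  -- `N` makes the remainder cost at most `δ / 2`. Then `η` is chosen, after `N`, so that the
  -- finitely many correlations cost at most the other `δ / 2`.
  obtain ⟨N, hN⟩ := (c.tendsto_norm_W_pow.eventually
    (gt_mem_nhds (show 0 < δ / (4 * (B + 1)) by positivity))).exists
  have hN' : 2 * (‖c.W ^ N‖ * B) ≤ δ / 2 := by
    rw [lt_div_iff₀ (by positivity)] at hN
    nlinarith [norm_nonneg (c.W ^ N)]
  choose C hC using fun j => exists_abs_inner_sub_le (c.Y₁ * (c.AKᵀ ^ j * (c.S * G.B₁))) (j + 1)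
  obtain ⟨C₀, hC₀⟩ := exists_abs_inner_sub_le c.Y₀ 0
  set Ct : ℝ := |C₀| + 2 * ∑ j ∈ Finset.range N, |C j| with hCt
  have hCt0 : 0 ≤ Ct := by positivity
  refine ⟨δ / (2 * (Ct + 1)), by positivity, fun d x p hd hd1 hx hp => ?_⟩
  set η := δ / (2 * (Ct + 1)) with hη
  have hη0 : 0 < η := by positivity
  have hCη : Ct * η ≤ δ / 2 := by
    have : (Ct + 1) * η = δ / 2 := by rw [hη]; field_simp
    linarith
  have hmain := c.inner_out_le hx hp (hwW d)
  have h0 : inner ℝ d (op c.Y₀ d) ≤ c.Y₀.trace / Fintype.card D + |C₀| * η := by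
    have h1 := hC₀ η d hd hd1
    rw [if_pos rfl, pow_zero, one_apply_eq_self] at h1
    have h2 : C₀ * η ≤ |C₀| * η := mul_le_mul_of_nonneg_right (le_abs_self _) hη0.le
    linarith [le_abs_self (inner ℝ d (op c.Y₀ d) - c.Y₀.trace / Fintype.card D)]
  -- The outer `advance` raises the lag to `j + 1`, so no term of the series sees lag zero and none
  -- has a white contribution.
  have hterm : ∀ j, inner ℝ d (op c.Y₁ (advance ((c.W ^ j) (op (c.S * G.B₁) d)))) ≤ |C j| * η := by
    intro j
    have h1 := hC j η d hd hd1
    rw [if_neg (Nat.succ_ne_zero j), sub_zero] at h1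
    have e : op c.Y₁ (advance ((c.W ^ j) (op (c.S * G.B₁) d)))
        = op (c.Y₁ * (c.AKᵀ ^ j * (c.S * G.B₁))) ((advance ^ (j + 1)) d) := by
      rw [c.W_pow_apply]
      refine Sig.ext_at fun k => ?_
      simp only [op_at, advance_at, advance_pow_at, Matrix.mulVec_mulVec]
      rw [add_assoc, add_comm 1 j]
    rw [e]
    exact (le_abs_self _).trans (h1.trans (mul_le_mul_of_nonneg_right (le_abs_self _) hη0.le))
  have hrem : inner ℝ d (op c.Y₁ (advance ((c.W ^ N) (w d)))) ≤ ‖c.W ^ N‖ * B := by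
    have b1 : ‖w d‖ ≤ ‖V‖ * ‖op (c.S * G.B₁)‖ := by
      refine (V.le_opNorm _).trans (mul_le_mul_of_nonneg_left ?_ (norm_nonneg _))
      simpa [hd1] using (op (c.S * G.B₁)).le_opNorm d
    calc inner ℝ d (op c.Y₁ (advance ((c.W ^ N) (w d))))
        ≤ ‖d‖ * ‖op c.Y₁ (advance ((c.W ^ N) (w d)))‖ := real_inner_le_norm _ _
      _ = ‖op c.Y₁ (advance ((c.W ^ N) (w d)))‖ := by rw [hd1, one_mul]
      _ ≤ ‖op c.Y₁‖ * (‖(advance : Sig X →L[ℝ] Sig X)‖ * (‖c.W ^ N‖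
            * (‖V‖ * ‖op (c.S * G.B₁)‖))) := by
          refine ((op c.Y₁).le_opNorm _).trans (mul_le_mul_of_nonneg_left ?_ (norm_nonneg _))
          refine (advance.le_opNorm _).trans (mul_le_mul_of_nonneg_left ?_ (norm_nonneg _))
          exact ((c.W ^ N).le_opNorm _).trans (mul_le_mul_of_nonneg_left b1 (norm_nonneg _))
      _ = _ := by rw [hB]; ring
  have hcross : inner ℝ d (op c.Y₁ (advance (w d)))
      ≤ (∑ j ∈ Finset.range N, |C j|) * η + ‖c.W ^ N‖ * B := by
    rw [hiter d N, map_add, map_add, map_sum, map_sum, inner_add_right, inner_sum, Finset.sum_mul]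
    exact add_le_add (Finset.sum_le_sum fun j _ => hterm j) hrem
  rw [← real_inner_self_eq_norm_sq]
  have : Ct * η = |C₀| * η + 2 * ((∑ j ∈ Finset.range N, |C j|) * η) := by rw [hCt]; ring
  linarith

/-! ## Well-posedness on signals -/

/-- The loop of the system with the uncertainty `Δ`, as an operator on the state and the output of
the uncertainty. -/
def loop (G : LinSys X P D E) (Δ : Sig P →L[ℝ] Sig P) : Sig X × Sig P →L[ℝ] Sig X × Sig P :=
  (delay.comp ((op G.A).coprod (op G.B₀))).prod (Δ.comp ((op G.C₀).coprod (op G.D₀)))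

theorem loop_apply (Δ : Sig P →L[ℝ] Sig P) (x : Sig X) (p : Sig P) :
    G.loop Δ (x, p) = (delay (G.sNext x p), Δ (G.sChan x p)) := rfl

/-- In the form of `S` on the state plus that of `Θ` on the channel, the loop is a contraction with
factor `1 - ε`: summing the storage inequality over time bounds the image, and `hΔ` absorbs the
uncertainty. Hence `1 - loop` is invertible on `ℓ₂` even for a non-causal `Δ`. -/
theorem isUnit_one_sub_loop (hS : S.PosDef) (hΘ : Θ.PosDef) (h : G.Dissipative Θ S)
    {Δ : Sig P →L[ℝ] Sig P} (hΔ : ∀ q, inner ℝ (Δ q) (op Θ (Δ q)) ≤ inner ℝ q (op Θ q)) :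
    IsUnit (1 - G.loop Δ) := by
  obtain ⟨ε, h0, h1, hε⟩ := h.exists_le
  obtain ⟨l, hl0, hl⟩ := exists_pos_mul_dotProduct_le hS
  obtain ⟨l', hl0', hl'⟩ := exists_pos_mul_dotProduct_le hΘ
  have low : ∀ {α : Type} [Fintype α] [DecidableEq α] {M : Matrix α α ℝ} {b : ℝ},
      (∀ x, b * (x ⬝ᵥ x) ≤ form M x x) → ∀ f : Sig α, b * ‖f‖ ^ 2 ≤ inner ℝ f (op M f) := by
    intro α _ _ M b hb f
    rw [← real_inner_self_eq_norm_sq]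
    exact hasSum_le (fun k => hb (f.at k)) ((Sig.hasSum_inner f f).mul_left b) (Sig.hasSum_op M f f)
  have upp : ∀ {α : Type} [Fintype α] [DecidableEq α] (M : Matrix α α ℝ) (f : Sig α) (b : ℝ),
      ‖f‖ ≤ b → inner ℝ f (op M f) ≤ ‖op M‖ * b ^ 2 := by
    intro α _ _ M f b hb
    calc inner ℝ f (op M f) ≤ ‖f‖ * ‖op M f‖ := real_inner_le_norm _ _
      _ ≤ ‖f‖ * (‖op M‖ * ‖f‖) := mul_le_mul_of_nonneg_left ((op M).le_opNorm f) (norm_nonneg _)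
      _ = ‖op M‖ * ‖f‖ ^ 2 := by ring
      _ ≤ _ := mul_le_mul_of_nonneg_left (pow_le_pow_left₀ (norm_nonneg _) hb 2) (norm_nonneg _)
  refine isUnit_one_sub_of_tendsto_pow (tendsto_norm_pow_of_contraction
    (N := fun u => inner ℝ u.1 (op S u.1) + inner ℝ u.2 (op Θ u.2)) (c := min l l')
    (C := ‖op S‖ + ‖op Θ‖) (ρ := 1 - ε) (lt_min hl0 hl0') (by linarith) (by linarith)
    (fun u => ?_) (fun u => ?_) (fun u => ?_))
  · have a1 := low hl u.1
    have a2 := low hl' u.2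
    have a3 := inner_op_nonneg hS.posSemidef u.1
    have a4 := inner_op_nonneg hΘ.posSemidef u.2
    rw [Prod.norm_def]
    rcases max_cases ‖u.1‖ ‖u.2‖ with ⟨e, -⟩ | ⟨e, -⟩ <;> rw [e]
    · have := mul_le_mul_of_nonneg_right (min_le_left l l') (sq_nonneg ‖u.1‖)
      linarith
    · have := mul_le_mul_of_nonneg_right (min_le_right l l') (sq_nonneg ‖u.2‖)
      linarith
  · rw [add_mul]
    exact add_le_add (upp S u.1 _ (norm_fst_le u)) (upp Θ u.2 _ (norm_snd_le u))
  · obtain ⟨x, p⟩ := u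
    have b1 := hasSum_le (fun k => hε (x.at k) (p.at k))
      ((hasSum_supply (G := G) (Θ := Θ) (S := S) x p).add
        ((((Sig.hasSum_inner x x).add (Sig.hasSum_op S x x)).add
          (Sig.hasSum_op Θ p p)).mul_left ε)) (Sig.hasSum_op S x x)
    have b2 := hΔ (G.sChan x p)
    have b3 : 0 ≤ inner ℝ x x := real_inner_self_nonneg
    have b4 : 0 ≤ inner ℝ (G.sOut x p) (G.sOut x p) := real_inner_self_nonneg
    simp only [loop_apply, op_delay, inner_delay_delay]
    nlinarith

/-- The delay encodes both the recursion and the zero initial state, so solving the system amounts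
to inverting `1 - loop`. -/
theorem isSolution_iff (rel : Sig P → Sig P → Prop) {Δ : Sig P →L[ℝ] Sig P}
    (hrel : ∀ q p, rel q p ↔ p = Δ q) (d : Sig D) (x : Sig X) (q p : Sig P) (e : Sig E) :
    IsSolution G.toMatrix rel d x q p e ↔
      (x, p) - G.loop Δ (x, p) = (delay (op G.B₁ d), 0) ∧ q = G.sChan x p ∧ e = G.sOut x p := by
  have hx : (x.at 0 = 0 ∧ ∀ k, x.at (k + 1) = G.next (x.at k) (p.at k) + G.B₁ *ᵥ d.at k) ↔
      x - delay (G.sNext x p) = delay (op G.B₁ d) := by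
    rw [sub_eq_iff_eq_add, ← map_add]
    constructor
    · rintro ⟨h0, h1⟩
      refine Sig.ext_at fun k => ?_
      cases k with
      | zero => rw [h0]; rfl
      | succ k => rw [h1, delay_at_succ, add_comm]; rfl
    · intro h
      refine ⟨by rw [h]; rfl, fun k => ?_⟩
      rw [h, delay_at_succ, ← h, add_comm]; rfl
  rw [IsSolution, hrel, loop_apply, Prod.mk_sub_mk, Prod.mk.injEq, ← hx, sub_eq_zero]
  simp only [toMatrix_mulVec, Sum.elim_eq_iff]
  constructor
  · rintro ⟨h0, h, hp⟩
    have hq : q = G.sChan x p := Sig.ext_at fun k => (h k).2.1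
    exact ⟨⟨⟨h0, fun k => (h k).1⟩, hq ▸ hp⟩, hq, Sig.ext_at fun k => (h k).2.2⟩
  · rintro ⟨⟨⟨h0, h⟩, hp⟩, rfl, rfl⟩
    exact ⟨h0, fun k => ⟨h k, rfl, rfl⟩, hp⟩

/-! ## The robust `H₂` norm -/

/-- The factor `√p` in the norm cancels the average over the `p` inputs. The limit is an infimum, so
a single `η` suffices; without inputs the norm is zero. -/
theorem h2Norm_le_of_forall {T : Sig D → Sig E} {v δ η : ℝ} (hη : 0 < η)
    (h : ∀ d ∈ whiteSet D η, ‖d‖ = 1 → ‖T d‖ ^ 2 ≤ v / Fintype.card D + δ) :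
    h2Norm T ≤ ENNReal.ofReal √(v + Fintype.card D * δ) := by
  rcases Nat.eq_zero_or_pos (Fintype.card D) with h0 | h0
  · simp [h2Norm, h0]
  have h0' : (0 : ℝ) < Fintype.card D := by exact_mod_cast h0
  have h1 : whiteGain T η ≤ ENNReal.ofReal √(v / Fintype.card D + δ) := by
    refine iSup₂_le fun d hd => ?_
    rw [← ofReal_norm]
    exact ENNReal.ofReal_le_ofReal (Real.le_sqrt_of_sq_le (h d hd.1 hd.2))
  calc h2Norm T ≤ ENNReal.ofReal √(Fintype.card D : ℝ) * ENNReal.ofReal √(v / Fintype.card D + δ) :=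
        mul_le_mul_right ((iInf₂_le η hη).trans h1) _
    _ = _ := by
        rw [← ENNReal.ofReal_mul (Real.sqrt_nonneg _), ← Real.sqrt_mul h0'.le]
        congr 2
        field_simp

theorem robustH2NormLT {𝒰 : Type} {rel : 𝒰 → Sig P → Sig P → Prop}
    {Δ : 𝒰 → Sig P →L[ℝ] Sig P} (hrel : ∀ i q p, rel i q p ↔ p = Δ i q) (hΘ : Θ.PosDef)
    (hΔ : ∀ i q, inner ℝ (Δ i q) (op Θ (Δ i q)) ≤ inner ℝ q (op Θ q))
    (hSp : Sp.PosDef) (hSm : Sm.PosDef) (hlt : (Sm - Sp).PosDef)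
    (hp : G.Dissipative Θ Sp) (hm : G.Dissipative Θ Sm) {Q : Matrix D D ℝ} {γ : ℝ} (hγ : 0 < γ)
    (hQ : ∀ v z, form Sp (z + G.B₁ *ᵥ v) (z + G.B₁ *ᵥ v) - form Sm z z ≤ form Q v v)
    (hQγ : Q.trace < γ ^ 2) : RobustH2NormLT G.toMatrix rel γ := by
  choose u hu using fun i => isUnit_one_sub_loop hSm hΘ hm (hΔ i)
  let Z : 𝒰 → (Sig D →L[ℝ] Sig X × Sig P) := fun i =>
    (↑(u i)⁻¹ : Sig X × Sig P →L[ℝ] Sig X × Sig P).comp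
      ((delay.comp (op G.B₁)).prod 0)
  have hZ : ∀ i d y, y - G.loop (Δ i) y = (delay (op G.B₁ d), 0) ↔ y = Z i d := by
    intro i d y
    have e : y - G.loop (Δ i) y = (u i : Sig X × Sig P →L[ℝ] Sig X × Sig P) y := by rw [hu]; rfl
    rw [e]
    constructor
    · intro h
      have : ((↑(u i)⁻¹ : Sig X × Sig P →L[ℝ] Sig X × Sig P) * ↑(u i)) y = y := by
        rw [(u i).inv_mul]; rfl
      rw [← this, mul_apply_eq_comp, h]; rfl
    · rintro rfl
      have : ((↑(u i) : Sig X × Sig P →L[ℝ] Sig X × Sig P) * ↑(u i)⁻¹) (delay (op G.B₁ d), 0)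
          = (delay (op G.B₁ d), 0) := by
        rw [(u i).mul_inv]; rfl
      exact this
  let x : 𝒰 → (Sig D →L[ℝ] Sig X) := fun i => (ContinuousLinearMap.fst ℝ _ _).comp (Z i)
  let p : 𝒰 → (Sig D →L[ℝ] Sig P) := fun i => (ContinuousLinearMap.snd ℝ _ _).comp (Z i)
  let T : 𝒰 → (Sig D →L[ℝ] Sig X × Sig P × Sig P × Sig E) := fun i =>
    (x i).prod (((op G.C₀).comp (x i) + (op G.D₀).comp (p i)).prod
      ((p i).prod ((op G.C₁).comp (x i) + (op G.D₁).comp (p i))))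
  have hsol : ∀ i d x q p e, IsSolution G.toMatrix (rel i) d x q p e ↔ (x, q, p, e) = T i d := by
    intro i d x' q' p' e'
    rw [isSolution_iff (rel i) (hrel i), hZ]
    constructor
    · rintro ⟨h, rfl, rfl⟩
      obtain ⟨rfl, rfl⟩ := Prod.mk.injEq .. ▸ h
      rfl
    · intro h
      obtain ⟨rfl, rfl, rfl, rfl⟩ := by simpa only [Prod.mk.injEq] using h
      exact ⟨rfl, rfl, rfl⟩
  refine ⟨T, hsol, ?_⟩
  obtain ⟨c, hc⟩ := exists_certificate hΘ hSp hSm hlt hp hm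
  have hY : c.Y₀.trace ≤ Q.trace := by
    refine trace_le_of_form_le fun v => ?_
    obtain ⟨z, hz⟩ := hc (G.B₁ *ᵥ v)
    have e : form c.Y₀ v v = form c.S (G.B₁ *ᵥ v) (G.B₁ *ᵥ v)
        + form c.Z (c.S *ᵥ (G.B₁ *ᵥ v)) (c.S *ᵥ (G.B₁ *ᵥ v)) := by
      rw [Certificate.Y₀, form_add, form_transpose_mul, form_mul, form_transpose_mul, form_mul,
        Matrix.mulVec_mulVec]
    rw [e]
    exact hz.trans (hQ v z)
  obtain ⟨δ, hδ, hδγ⟩ : ∃ δ : ℝ, 0 < δ ∧ Q.trace + Fintype.card D * δ < γ ^ 2 := by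
    refine ⟨(γ ^ 2 - Q.trace) / (Fintype.card D + 1), div_pos (by linarith) (by positivity), ?_⟩
    have h1 : (0 : ℝ) < Fintype.card D + 1 := by positivity
    have h2 : ((Fintype.card D : ℝ) + 1) * ((γ ^ 2 - Q.trace) / (Fintype.card D + 1))
        = γ ^ 2 - Q.trace := by field_simp
    have h3 : 0 < (γ ^ 2 - Q.trace) / (Fintype.card D + 1) := div_pos (by linarith) h1
    linarith
  -- This `η` depends on the certificate and `δ` only, so the bound below `γ` is uniform in the
  -- uncertainty and survives the supremum.
  obtain ⟨η, hη, hout⟩ := c.exists_inner_out_le hδ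
  have hle : ∀ i, h2Norm (fun d => (T i d).2.2.2)
      ≤ ENNReal.ofReal √(Q.trace + Fintype.card D * δ) := by
    intro i
    refine (h2Norm_le_of_forall (v := c.Y₀.trace) (δ := δ) hη fun d hd hd1 => ?_).trans
      (ENNReal.ofReal_le_ofReal (Real.sqrt_le_sqrt (by linarith)))
    have h1 := (isSolution_iff (rel i) (hrel i) d (T i d).1 (T i d).2.1 (T i d).2.2.1
      (T i d).2.2.2).1 ((hsol i d _ _ _ _).2 rfl)
    obtain ⟨h1, h2, h3⟩ := h1
    rw [loop_apply, Prod.mk_sub_mk, Prod.mk.injEq, sub_eq_zero] at h1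
    have h4 := hout d (T i d).1 (T i d).2.2.1 hd hd1 ?_ ?_
    · rwa [h3]
    · rw [map_add, ← h1.1]; abel
    · have := hΔ i (G.sChan (T i d).1 (T i d).2.2.1)
      rwa [← h1.2] at this
  refine (iSup_le hle).trans_lt ((ENNReal.ofReal_lt_ofReal_iff hγ).2 ?_)
  rw [Real.sqrt_lt' hγ]
  exact hδγ

end LinSys

/-! ## Congruence transformations of the analysis inequalities -/

section Congruence

variable {ι κ : Type} [Fintype ι] [Fintype κ]

theorem form_fromBlocks_sumElim (A : Matrix ι ι ℝ) (C : Matrix κ ι ℝ) (B : Matrix κ κ ℝ)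
    (x : ι → ℝ) (y : κ → ℝ) :
    form (Matrix.fromBlocks A Cᵀ C B) (Sum.elim x y) (Sum.elim x y)
      = form A x x + 2 * (y ⬝ᵥ C *ᵥ x) + form B y y := by
  have h : x ⬝ᵥ Cᵀ *ᵥ y = y ⬝ᵥ C *ᵥ x := form_transpose C x y
  simp only [form, Matrix.fromBlocks_mulVec, Sum.elim_comp_inl, Sum.elim_comp_inr,
    sumElim_dotProduct_sumElim, dotProduct_add, h]
  ring

theorem form_fromBlocks_diag (A : Matrix ι ι ℝ) (B : Matrix κ κ ℝ) (x : ι → ℝ) (y : κ → ℝ) :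
    form (Matrix.fromBlocks A 0 0 B) (Sum.elim x y) (Sum.elim x y) = form A x x + form B y y := by
  simpa using form_fromBlocks_sumElim A (0 : Matrix κ ι ℝ) B x y

theorem posDef_fromBlocks₁₁ {A : Matrix ι ι ℝ} {B : Matrix ι κ ℝ} {C : Matrix κ ι ℝ}
    {D : Matrix κ κ ℝ} (h : (Matrix.fromBlocks A B C D).PosDef) : A.PosDef :=
  h.submatrix Sum.inl_injective

theorem posDef_fromBlocks₂₂ {A : Matrix ι ι ℝ} {B : Matrix ι κ ℝ} {C : Matrix κ ι ℝ}
    {D : Matrix κ κ ℝ} (h : (Matrix.fromBlocks A B C D).PosDef) : D.PosDef :=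
  h.submatrix Sum.inr_injective

variable [DecidableEq ι]

theorem form_inv_mulVec {M : Matrix ι ι ℝ} (hM : M.PosDef) (x y : ι → ℝ) :
    form M (M⁻¹ *ᵥ x) y = x ⬝ᵥ y := by
  rw [form_comm hM.transpose_eq, form, mulVec_inv_mulVec hM.isUnit, dotProduct_comm]

theorem form_inv_self {M : Matrix ι ι ℝ} (hM : M.PosDef) (x : ι → ℝ) :
    form M (M⁻¹ *ᵥ x) (M⁻¹ *ᵥ x) = form M⁻¹ x x := form_inv_mulVec hM x _

theorem form_inv_mulVec_self {M : Matrix ι ι ℝ} (hM : M.PosDef) (x : ι → ℝ) :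
    form M⁻¹ (M *ᵥ x) (M *ᵥ x) = form M x x := by
  rw [form, inv_mulVec_mulVec hM.isUnit, dotProduct_comm]; rfl

/-- The matrix `Fᵀ T⁻¹ F`. -/
def congrInv (F T : Matrix ι ι ℝ) : Matrix ι ι ℝ := Fᵀ * (T⁻¹ * F)

theorem form_congrInv (F T : Matrix ι ι ℝ) (x y : ι → ℝ) :
    form (congrInv F T) x y = form T⁻¹ (F *ᵥ x) (F *ᵥ y) := by
  rw [congrInv, form_transpose_mul, form_mul]

theorem congrInv_transpose (F : Matrix ι ι ℝ) {T : Matrix ι ι ℝ} (hT : Tᵀ = T) :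
    (congrInv F T)ᵀ = congrInv F T := by
  simp only [congrInv, Matrix.transpose_mul, Matrix.transpose_transpose,
    Matrix.transpose_nonsing_inv, hT, Matrix.mul_assoc]

theorem mulVec_ne_zero {F : Matrix ι ι ℝ} (hF : IsUnit F) {x : ι → ℝ} (hx : x ≠ 0) :
    F *ᵥ x ≠ 0 := fun h => hx (Matrix.mulVec_injective_iff_isUnit.2 hF (by simpa using h))

theorem congrInv_posDef {F T : Matrix ι ι ℝ} (hF : IsUnit F) (hT : T.PosDef) :
    (congrInv F T).PosDef :=
  posDef_of_form (congrInv_transpose F hT.transpose_eq) fun x hx => by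
    rw [form_congrInv]
    exact form_pos hT.inv (mulVec_ne_zero hF hx)

theorem congrInv_sub_posDef {F Tp Tm : Matrix ι ι ℝ} (hF : IsUnit F) (hp : Tp.PosDef)
    (hm : Tm.PosDef) (h : (Tp - Tm).PosDef) : (congrInv F Tm - congrInv F Tp).PosDef := by
  refine posDef_of_form ?_ fun x hx => ?_
  · rw [Matrix.transpose_sub, congrInv_transpose F hm.transpose_eq,
      congrInv_transpose F hp.transpose_eq]
  · rw [form_sub, form_congrInv, form_congrInv]
    have hx' := mulVec_ne_zero hF hx
    set a := F *ᵥ x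
    -- Inversion reverses the order: Young's inequality for `Tm` at the vector `Tp⁻¹ a`, with `Tp -
    -- Tm` supplying strictness.
    have h1 := two_mul_dotProduct_le hm a (Tp⁻¹ *ᵥ a)
    have h2 := form_pos h (mulVec_ne_zero hp.inv.isUnit hx')
    rw [form_sub, form_inv_self hp] at h2
    have h3 : a ⬝ᵥ Tp⁻¹ *ᵥ a = form Tp⁻¹ a a := rfl
    linarith

/-- With `y = Tp⁻¹ (a + b)`, the block inequality tested at `(v, -y)` bounds `2 b ⬝ᵥ y` by the forms
of `Q` and `Tp - Tm`, and Young's inequality for `Tm` bounds `2 a ⬝ᵥ y`. Their sum contains `2 (a +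
b) ⬝ᵥ y`, twice the form of `Tp⁻¹` at `a + b`. -/
theorem form_congrInv_add_sub_le {F Tp Tm : Matrix ι ι ℝ} {Q : Matrix κ κ ℝ} {B : Matrix ι κ ℝ}
    (hp : Tp.PosDef) (hm : Tm.PosDef)
    (h : (Matrix.fromBlocks Q (F * B)ᵀ (F * B) (Tp - Tm)).PosDef) (v : κ → ℝ) (z : ι → ℝ) :
    form (congrInv F Tp) (z + B *ᵥ v) (z + B *ᵥ v) - form (congrInv F Tm) z z ≤ form Q v v := by
  rw [form_congrInv, form_congrInv, Matrix.mulVec_add, Matrix.mulVec_mulVec]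
  set a := F *ᵥ z
  set b := (F * B) *ᵥ v with hb
  have h1 := form_nonneg h.posSemidef (Sum.elim v (-(Tp⁻¹ *ᵥ (a + b))))
  have h2 := two_mul_dotProduct_le hm a (Tp⁻¹ *ᵥ (a + b))
  have h3 : (a + b) ⬝ᵥ Tp⁻¹ *ᵥ (a + b) = form Tp⁻¹ (a + b) (a + b) := rfl
  rw [form_fromBlocks_sumElim, ← hb, form_neg_left, form_neg_right, neg_neg, form_sub,
    form_inv_self hp, neg_dotProduct, dotProduct_comm _ b] at h1
  rw [add_dotProduct] at h3
  linarith

/-- On the kernel of `V` the form of `V + Vᵀ - T` would be minus that of `T`. -/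
theorem isUnit_of_add_transpose_sub_posDef {V T : Matrix ι ι ℝ} (hT : T.PosDef)
    (h : (V + Vᵀ - T).PosDef) : IsUnit V := by
  rw [← Matrix.mulVec_injective_iff_isUnit]
  intro v w hvw
  rw [← sub_eq_zero]
  by_contra hx
  have hV : V *ᵥ (v - w) = 0 := by rw [Matrix.mulVec_sub]; exact sub_eq_zero.2 hvw
  have h1 := form_pos h hx
  have h2 := form_pos hT hx
  have h3 : form V (v - w) (v - w) = 0 := by rw [form, hV, dotProduct_zero]
  rw [form_sub, form_add, form_transpose, h3] at h1
  linarith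

end Congruence

namespace LinSys

variable {X P D E : Type} [Fintype X] [Fintype P] [Fintype D] [Fintype E]
  [DecidableEq X] [DecidableEq P] [DecidableEq E] {G : LinSys X P D E}

/-- The synthesis inequality implies dissipativity with the storage `Fᵀ T⁻¹ F` and the scaling
`Hᵀ Θ⁻¹ H`. -/
theorem dissipative_of_posDef {F Y V T : Matrix X X ℝ} {H Z Θ : Matrix P P ℝ}
    {g : Matrix (X ⊕ P ⊕ E) (X ⊕ P) ℝ} (hT : T.PosDef) (hΘ : Θ.PosDef) (hV : F * Y = V)
    (hH : H * Z = Θ) (hY : IsUnit Y) (hZ : IsUnit Z)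
    (hg : ∀ x p, g *ᵥ Sum.elim x p = Sum.elim (F *ᵥ G.next (Y *ᵥ x) (Z *ᵥ p))
      (Sum.elim (H *ᵥ G.chan (Y *ᵥ x) (Z *ᵥ p)) (G.out (Y *ᵥ x) (Z *ᵥ p))))
    (h : (Matrix.fromBlocks (Matrix.fromBlocks (V + Vᵀ - T) 0 0 Θ) gᵀ g
      (Matrix.fromBlocks T 0 0 (Matrix.fromBlocks Θ 0 0 1))).PosDef) :
    G.Dissipative (congrInv H Θ) (congrInv F T) := by
  intro x p hxp
  obtain ⟨x, rfl⟩ : ∃ x', x = Y *ᵥ x' := ⟨Y⁻¹ *ᵥ x, (mulVec_inv_mulVec hY x).symm⟩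
  obtain ⟨p, rfl⟩ : ∃ p', p = Z *ᵥ p' := ⟨Z⁻¹ *ᵥ p, (mulVec_inv_mulVec hZ p).symm⟩
  have hne : Sum.elim x p ≠ 0 := by
    intro h0
    have h1 : x = 0 := funext fun i => congrFun h0 (.inl i)
    have h2 : p = 0 := funext fun i => congrFun h0 (.inr i)
    exact hxp (by simp [h1, h2])
  set a := F *ᵥ G.next (Y *ᵥ x) (Z *ᵥ p)
  set b := H *ᵥ G.chan (Y *ᵥ x) (Z *ᵥ p)
  set e := G.out (Y *ᵥ x) (Z *ᵥ p)
  -- The lower components minimize the form for given `x` and `p`, which carries out the Schur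
  -- complement.
  have hpos := form_pos h (x := Sum.elim (Sum.elim x p)
    (Sum.elim (-(T⁻¹ *ᵥ a)) (Sum.elim (-(Θ⁻¹ *ᵥ b)) (-e)))) (by
      intro h0
      exact hne (funext fun i => congrFun h0 (.inl i)))
  rw [form_fromBlocks_sumElim, hg, form_fromBlocks_diag, form_fromBlocks_diag,
    form_fromBlocks_diag, sumElim_dotProduct_sumElim, sumElim_dotProduct_sumElim] at hpos
  simp only [neg_dotProduct, form_neg_left, form_neg_right, neg_neg, form_inv_self hT,
    form_inv_self hΘ, form_one] at hpos
  have e1 : T⁻¹ *ᵥ a ⬝ᵥ a = form T⁻¹ a a := dotProduct_comm _ _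
  have e2 : Θ⁻¹ *ᵥ b ⬝ᵥ b = form Θ⁻¹ b b := dotProduct_comm _ _
  -- This is `V + Vᵀ - T ≤ Vᵀ T⁻¹ V`. It lets one slack matrix `V`, hence one controller, serve both
  -- storages.
  have e3 := two_mul_dotProduct_le hT (V *ᵥ x) x
  have e4 : form (congrInv H Θ) (Z *ᵥ p) (Z *ᵥ p) = form Θ p p := by
    rw [form_congrInv, Matrix.mulVec_mulVec, hH, form_inv_mulVec_self hΘ]
  have e5 : form (congrInv F T) (Y *ᵥ x) (Y *ᵥ x) = form T⁻¹ (V *ᵥ x) (V *ᵥ x) := by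
    rw [form_congrInv, Matrix.mulVec_mulVec, hV]
  have e6 : form (V + Vᵀ - T) x x = 2 * (V *ᵥ x ⬝ᵥ x) - form T x x := by
    rw [form_sub, form_add, form_transpose, form, dotProduct_comm]; ring
  rw [supply, form_congrInv, form_congrInv, e4, e5]
  linarith

end LinSys

/-! ## Matrices commuting with the uncertainty -/

section Commutant

variable {s f : ℕ} {m : Fin s → ℕ} {r : Fin f → ℕ} {M N : Matrix (Chan m r) (Chan m r) ℝ}

theorem blockDiag_mul (D D' : ∀ i, Matrix (Fin (m i)) (Fin (m i)) ℝ)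
    (E E' : ∀ j, Matrix (Fin (r j)) (Fin (r j)) ℝ) :
    blockDiag D E * blockDiag D' E' = blockDiag (fun i => D i * D' i) fun j => E j * E' j := by
  simp [blockDiag, Matrix.fromBlocks_multiply, Matrix.blockDiagonal'_mul]

theorem blockDiag_one :
    blockDiag (m := m) (r := r) (fun _ => 1) (fun _ => 1) = 1 := by
  have h1 : Matrix.blockDiagonal' (fun i => (1 : Matrix (Fin (m i)) (Fin (m i)) ℝ)) = 1 :=
    Matrix.blockDiagonal'_one
  have h2 : Matrix.blockDiagonal' (fun j => (1 : Matrix (Fin (r j)) (Fin (r j)) ℝ)) = 1 :=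
    Matrix.blockDiagonal'_one
  rw [blockDiag, h1, h2, Matrix.fromBlocks_one]

theorem one_mem_commutantSet : (1 : Matrix (Chan m r) (Chan m r) ℝ) ∈ commutantSet m r :=
  ⟨fun _ => 1, fun _ => 1, by simp only [one_smul, blockDiag_one]⟩

theorem mul_mem_commutantSet (hM : M ∈ commutantSet m r) (hN : N ∈ commutantSet m r) :
    M * N ∈ commutantSet m r := by
  obtain ⟨D, d, rfl⟩ := hM
  obtain ⟨D', d', rfl⟩ := hN
  exact ⟨fun i => D i * D' i, fun j => d j * d' j, by simp [blockDiag_mul, smul_smul, mul_comm]⟩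

theorem sub_mem_commutantSet (hM : M ∈ commutantSet m r) (hN : N ∈ commutantSet m r) :
    M - N ∈ commutantSet m r := by
  obtain ⟨D, d, rfl⟩ := hM
  obtain ⟨D', d', rfl⟩ := hN
  refine ⟨fun i => D i - D' i, fun j => d j - d' j, ?_⟩
  have h1 := Matrix.blockDiagonal'_sub D D'
  have h2 := Matrix.blockDiagonal'_sub (fun j => d j • (1 : Matrix (Fin (r j)) (Fin (r j)) ℝ))
    (fun j => d' j • 1)
  have h3 : (fun j => (d j - d' j) • (1 : Matrix (Fin (r j)) (Fin (r j)) ℝ))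
      = (fun j => d j • 1) - fun j => d' j • 1 := funext fun j => sub_smul _ _ _
  rw [h3, blockDiag, blockDiag, blockDiag, sub_eq_add_neg, Matrix.fromBlocks_neg,
    Matrix.fromBlocks_add]
  simp only [neg_zero, add_zero, ← sub_eq_add_neg]
  rw [← h1, ← h2]
  rfl

theorem neg_mem_commutantSet (hM : M ∈ commutantSet m r) : -M ∈ commutantSet m r := by
  simpa using sub_mem_commutantSet (sub_mem_commutantSet hM hM) hM

theorem transpose_mem_commutantSet (hM : M ∈ commutantSet m r) : Mᵀ ∈ commutantSet m r := by
  obtain ⟨D, d, rfl⟩ := hM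
  exact ⟨fun i => (D i)ᵀ, d, by
    simp [blockDiag, Matrix.fromBlocks_transpose, Matrix.blockDiagonal'_transpose]⟩

theorem isUnit_of_isUnit_blockDiagonal' {o : Type} [Fintype o] [DecidableEq o] {l : o → ℕ}
    {D : ∀ i, Matrix (Fin (l i)) (Fin (l i)) ℝ} (h : IsUnit (Matrix.blockDiagonal' D)) (i : o) :
    IsUnit (D i) := by
  set N := (Matrix.blockDiagonal' D)⁻¹ with hN
  have h1 : Matrix.blockDiagonal' D * N = 1 :=
    Matrix.mul_nonsing_inv _ ((Matrix.isUnit_iff_isUnit_det _).1 h)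
  refine IsUnit.of_mul_eq_one (.of fun a b => N ⟨i, a⟩ ⟨i, b⟩) ?_
  ext a b
  have h2 := congrFun (congrFun h1 ⟨i, a⟩) ⟨i, b⟩
  rw [Matrix.mul_apply, sum_blockDiagonal'_mul D i a fun y => N y ⟨i, b⟩] at h2
  rw [Matrix.mul_apply, Matrix.one_apply]
  simpa [Matrix.one_apply] using h2

theorem inv_mem_commutantSet (hM : M ∈ commutantSet m r) (hu : IsUnit M) :
    M⁻¹ ∈ commutantSet m r := by
  obtain ⟨D, d, rfl⟩ := hM
  refine ⟨fun i => (D i)⁻¹, fun j => (d j)⁻¹, Matrix.inv_eq_right_inv ?_⟩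
  rw [Matrix.isUnit_iff_isUnit_det, blockDiag, Matrix.det_fromBlocks_zero₂₁, IsUnit.mul_iff,
    ← Matrix.isUnit_iff_isUnit_det, ← Matrix.isUnit_iff_isUnit_det] at hu
  have h1 := isUnit_of_isUnit_blockDiagonal' hu.1
  have h2 : ∀ j, (d j • (1 : Matrix (Fin (r j)) (Fin (r j)) ℝ)) * ((d j)⁻¹ • 1) = 1 := by
    intro j
    have := isUnit_of_isUnit_blockDiagonal' hu.2 j
    -- A vanishing `d j` is possible only for an empty block, where `0 = 1`.
    rcases eq_or_ne (d j) 0 with h | h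
    · rw [h, zero_smul, isUnit_zero_iff] at this
      rw [h, zero_smul, zero_mul, this]
    · simp [smul_smul, h]
  rw [blockDiag_mul]
  simp only [h2, fun i => Matrix.mul_nonsing_inv (D i)
    ((Matrix.isUnit_iff_isUnit_det _).1 (h1 i)), blockDiag_one]

theorem mem_commutantSet_of_mem_scalingSet (hM : M ∈ scalingSet m r) : M ∈ commutantSet m r := by
  obtain ⟨D, d, -, -, rfl⟩ := hM
  exact ⟨D, d, rfl⟩

theorem transpose_of_mem_scalingSet (hM : M ∈ scalingSet m r) : Mᵀ = M := by
  obtain ⟨D, d, hD, -, rfl⟩ := hM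
  simp [blockDiag, Matrix.fromBlocks_transpose, Matrix.blockDiagonal'_transpose,
    fun i => (hD i).transpose_eq]

end Commutant

/-! ## The change of controller variables -/

section BlockOps

variable {ι τ a b c a' b' c' d e : Type} [Fintype a] [Fintype b] [Fintype c] [Fintype d] [Fintype e]
  [Fintype ι]

theorem row3_mul_col3 (K : Matrix ι a ℝ) (L : Matrix ι b ℝ) (M : Matrix ι c ℝ) (K' : Matrix a τ ℝ)
    (L' : Matrix b τ ℝ) (M' : Matrix c τ ℝ) :
    row3 K L M * col3 K' L' M' = K * K' + L * L' + M * M' := by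
  simp [row3, col3, Matrix.fromCols_mul_fromRows, add_assoc]

theorem mul_row3 (N : Matrix τ ι ℝ) (K : Matrix ι a ℝ) (L : Matrix ι b ℝ) (M : Matrix ι c ℝ) :
    N * row3 K L M = row3 (N * K) (N * L) (N * M) := by
  simp [row3, Matrix.mul_fromCols]

theorem col3_mul (K : Matrix a' ι ℝ) (L : Matrix b' ι ℝ) (M : Matrix c' ι ℝ) (N : Matrix ι τ ℝ) :
    col3 K L M * N = col3 (K * N) (L * N) (M * N) := by
  simp [col3, Matrix.fromRows_mul]

theorem row3_add (K K' : Matrix ι a ℝ) (L L' : Matrix ι b ℝ) (M M' : Matrix ι c ℝ) :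
    row3 K L M + row3 K' L' M' = row3 (K + K') (L + L') (M + M') := by
  ext i (j | j | j) <;> rfl

theorem col3_add (K K' : Matrix a ι ℝ) (L L' : Matrix b ι ℝ) (M M' : Matrix c ι ℝ) :
    col3 K L M + col3 K' L' M' = col3 (K + K') (L + L') (M + M') := by
  ext (i | i | i) j <;> rfl

theorem col3_row3_one [DecidableEq a] [DecidableEq b] [DecidableEq c] :
    col3 (row3 1 0 0) (row3 0 1 0) (row3 0 0 1) = (1 : Matrix (a ⊕ b ⊕ c) (a ⊕ b ⊕ c) ℝ) := by
  ext (i | i | i) (j | j | j) <;> simp [col3, row3, Matrix.one_apply]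

theorem row3_mulVec (K : Matrix ι a ℝ) (L : Matrix ι b ℝ) (M : Matrix ι c ℝ) (x : a → ℝ)
    (y : b → ℝ) (z : c → ℝ) :
    row3 K L M *ᵥ Sum.elim x (Sum.elim y z) = K *ᵥ x + L *ᵥ y + M *ᵥ z := by
  simp [row3, Matrix.fromCols_mulVec, add_assoc]

theorem col3_mulVec (K : Matrix a ι ℝ) (L : Matrix b ι ℝ) (M : Matrix c ι ℝ) (x : ι → ℝ) :
    col3 K L M *ᵥ x = Sum.elim (K *ᵥ x) (Sum.elim (L *ᵥ x) (M *ᵥ x)) := by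
  simp [col3, Matrix.fromRows_mulVec]

theorem row4_mulVec (K : Matrix ι a ℝ) (L : Matrix ι b ℝ) (M : Matrix ι c ℝ) (N : Matrix ι d ℝ)
    (x : a → ℝ) (y : b → ℝ) (z : c → ℝ) (w : d → ℝ) :
    row4 K L M N *ᵥ Sum.elim (Sum.elim x y) (Sum.elim z w)
      = K *ᵥ x + L *ᵥ y + M *ᵥ z + N *ᵥ w := by
  simp [row4, Matrix.fromCols_mulVec, add_assoc]

theorem row5_mulVec (K : Matrix ι a ℝ) (L : Matrix ι b ℝ) (M : Matrix ι c ℝ) (N : Matrix ι d ℝ)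
    (O : Matrix ι e ℝ) (x : a → ℝ) (y : b → ℝ) (z : c → ℝ) (w : d → ℝ) (v : e → ℝ) :
    row5 K L M N O *ᵥ Sum.elim (Sum.elim x y) (Sum.elim (Sum.elim z w) v)
      = K *ᵥ x + L *ᵥ y + M *ᵥ z + N *ᵥ w + O *ᵥ v := by
  simp [row5, row3, Matrix.fromCols_mulVec, add_assoc]

theorem col5_mulVec (K : Matrix a ι ℝ) (L : Matrix b ι ℝ) (M : Matrix c ι ℝ) (N : Matrix d ι ℝ)
    (O : Matrix e ι ℝ) (x : ι → ℝ) :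
    col5 K L M N O *ᵥ x = Sum.elim (Sum.elim (K *ᵥ x) (L *ᵥ x))
      (Sum.elim (Sum.elim (M *ᵥ x) (N *ᵥ x)) (O *ᵥ x)) := by
  simp [col5, col3, Matrix.fromRows_mulVec]

theorem exists_eq_sumElim (v : a ⊕ b → ℝ) : ∃ x y, v = Sum.elim x y :=
  ⟨_, _, (Sum.elim_comp_inl_inr v).symm⟩

end BlockOps

section Synthesis

variable {n nd ne nu ny : ℕ} {c : Type} [Fintype c] [DecidableEq c]
  (G : Plant n nd ne nu ny c) (K Khat : Controller n nu ny c)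
  {R S M N : Matrix (Fin n) (Fin n) ℝ} {L J L₂ J₂ : Matrix c c ℝ}

theorem Controller.toMatrix_mulVec (x : Fin n → ℝ) (y : Fin ny → ℝ) (p : c → ℝ) :
    K.toMatrix *ᵥ Sum.elim x (Sum.elim y p) = Sum.elim (K.A *ᵥ x + K.B₁ *ᵥ y + K.B₀ *ᵥ p)
      (Sum.elim (K.C₁ *ᵥ x + K.D₁₀ *ᵥ p) (K.C₀ *ᵥ x + K.D₀₀ *ᵥ p)) := by
  simp [Controller.toMatrix, col3_mulVec, row3_mulVec]

/-- The closed loop. -/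
def closedSystem : LinSys (Fin n ⊕ Fin n) (c ⊕ c) (Fin nd) (Fin ne) where
  A := Matrix.fromBlocks G.A (G.B₂ * K.C₁) (K.B₁ * G.C₂) K.A
  B₀ := Matrix.fromBlocks G.B₀ (G.B₂ * K.D₁₀) (K.B₁ * G.D₂₀) K.B₀
  B₁ := Matrix.fromRows G.B₁ (K.B₁ * G.D₂₁)
  C₀ := Matrix.fromBlocks G.C₀ (G.D₀₂ * K.C₁) 0 K.C₀
  D₀ := Matrix.fromBlocks G.D₀₀ (G.D₀₂ * K.D₁₀) 0 K.D₀₀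
  C₁ := Matrix.fromCols G.C₁ (G.D₁₂ * K.C₁)
  D₁ := Matrix.fromCols G.D₁₀ (G.D₁₂ * K.D₁₀)

theorem closedSystem_toMatrix : (closedSystem G K).toMatrix = closedLoop G K := by
  refine Matrix.mulVec_injective (funext fun v => ?_)
  obtain ⟨v, w, rfl⟩ := exists_eq_sumElim v
  obtain ⟨w, d, rfl⟩ := exists_eq_sumElim w
  obtain ⟨x, x', rfl⟩ := exists_eq_sumElim v
  obtain ⟨p, p', rfl⟩ := exists_eq_sumElim w
  simp only [LinSys.toMatrix_mulVec, LinSys.next, LinSys.chan, LinSys.out, closedSystem,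
    closedLoop, Matrix.add_mulVec, ← Matrix.mulVec_mulVec, col5_mulVec, row5_mulVec, col3_mulVec,
    row3_mulVec, Controller.toMatrix_mulVec, Matrix.fromBlocks_mulVec, Matrix.fromRows_mulVec,
    Matrix.fromCols_mulVec, Sum.elim_comp_inl, Sum.elim_comp_inr, ← Sum.elim_add_add,
    Matrix.zero_mulVec, Matrix.one_mulVec, Matrix.mulVec_add, zero_add, add_zero]
  congr 1
  · congr 1 <;> abel
  · congr 1
    · congr 1; abel
    · abel

variable (R S M N L J L₂ J₂) in
/-- The transformed controller data. -/
def Controller.transform : Controller n nu ny c where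
  A := M * K.A * N + M * K.B₁ * G.C₂ * S + R * G.B₂ * K.C₁ * N + R * G.A * S
  B₁ := M * K.B₁
  B₀ := M * K.B₁ * G.D₂₀ * J + M * K.B₀ * J₂ᵀ + R * G.B₂ * K.D₁₀ * J₂ᵀ + R * G.B₀ * J
  C₁ := K.C₁ * N
  D₁₀ := K.D₁₀ * J₂ᵀ
  C₀ := L * G.D₀₂ * K.C₁ * N + L₂ * K.C₀ * N + L * G.C₀ * S
  D₀₀ := L * G.D₀₂ * K.D₁₀ * J₂ᵀ + L₂ * K.D₀₀ * J₂ᵀ + L * G.D₀₀ * J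

theorem transform_toMatrix :
    (K.transform G R S M N L J L₂ J₂).toMatrix
      = leftFactor G R M L L₂ * K.toMatrix * rightFactor G S N J J₂ + shiftTerm G R S L J := by
  simp only [Controller.toMatrix, Controller.transform, leftFactor, rightFactor, shiftTerm,
    col3_mul, row3_mul_col3, mul_row3, row3_add, col3_add, Matrix.mul_zero, Matrix.zero_mul,
    Matrix.mul_one, Matrix.one_mul, Matrix.add_mul, zero_add, add_zero, Matrix.mul_assoc]
  congr 2
  · abel
  · congr 1
    abel

/-- The change of variables is triangular: `B₁`, `C₁` and `D₁₀` are determined first, and each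
remaining block then enters only through invertible factors. -/
theorem exists_transform_eq (hM : IsUnit M) (hN : IsUnit N) (hL₂ : IsUnit L₂) (hJ₂ : IsUnit J₂ᵀ) :
    ∃ K : Controller n nu ny c, K.transform G R S M N L J L₂ J₂ = Khat := by
  rw [Matrix.isUnit_iff_isUnit_det] at hM hN hL₂ hJ₂
  refine ⟨
    { A := M⁻¹ * (Khat.A - Khat.B₁ * G.C₂ * S - R * G.B₂ * Khat.C₁ - R * G.A * S) * N⁻¹
      B₁ := M⁻¹ * Khat.B₁
      B₀ := M⁻¹ * (Khat.B₀ - Khat.B₁ * G.D₂₀ * J - R * G.B₂ * Khat.D₁₀ - R * G.B₀ * J) * J₂ᵀ⁻¹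
      C₁ := Khat.C₁ * N⁻¹
      D₁₀ := Khat.D₁₀ * J₂ᵀ⁻¹
      C₀ := L₂⁻¹ * (Khat.C₀ - L * G.D₀₂ * Khat.C₁ - L * G.C₀ * S) * N⁻¹
      D₀₀ := L₂⁻¹ * (Khat.D₀₀ - L * G.D₀₂ * Khat.D₁₀ - L * G.D₀₀ * J) * J₂ᵀ⁻¹ }, ?_⟩
  obtain ⟨A, B₁, B₀, C₁, D₁₀, C₀, D₀₀⟩ := Khat
  simp only [Controller.transform, Controller.mk.injEq, Matrix.mul_assoc,
    Matrix.nonsing_inv_mul _ hN, Matrix.nonsing_inv_mul _ hJ₂,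
    Matrix.mul_nonsing_inv_cancel_left _ _ hM, Matrix.mul_nonsing_inv_cancel_left _ _ hL₂,
    Matrix.mul_one]
  refine ⟨?_, trivial, ?_, trivial, trivial, ?_, ?_⟩ <;> abel

/-- The linearization behind the synthesis: products of controller data with `M`, `N`, `L₂`, `J₂`
appear only inside the transformed data, so the congruence of the closed loop is affine in them. -/
theorem gMatrix_transform_mulVec (x : Fin n ⊕ Fin n → ℝ) (p : c ⊕ c → ℝ) :
    gMatrix G R S L J (K.transform G R S M N L J L₂ J₂) *ᵥ Sum.elim x p
      = Sum.elim (Matrix.fromBlocks 1 0 R M *ᵥ (closedSystem G K).next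
          (Matrix.fromBlocks S 1 N 0 *ᵥ x) (Matrix.fromBlocks 1 J 0 J₂ᵀ *ᵥ p))
        (Sum.elim (Matrix.fromBlocks L L₂ 1 0 *ᵥ (closedSystem G K).chan
          (Matrix.fromBlocks S 1 N 0 *ᵥ x) (Matrix.fromBlocks 1 J 0 J₂ᵀ *ᵥ p))
          ((closedSystem G K).out
          (Matrix.fromBlocks S 1 N 0 *ᵥ x) (Matrix.fromBlocks 1 J 0 J₂ᵀ *ᵥ p))) := by
  obtain ⟨x, x', rfl⟩ := exists_eq_sumElim x
  obtain ⟨p, p', rfl⟩ := exists_eq_sumElim p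
  simp only [LinSys.next, LinSys.chan, LinSys.out, closedSystem, Controller.transform,
    gMatrix, Matrix.add_mulVec, ← Matrix.mulVec_mulVec, col5_mulVec, row4_mulVec, col3_mulVec,
    row3_mulVec, Controller.toMatrix_mulVec, Matrix.fromBlocks_mulVec, Matrix.fromCols_mulVec,
    Sum.elim_comp_inl, Sum.elim_comp_inr, ← Sum.elim_add_add,
    Matrix.zero_mulVec, Matrix.one_mulVec, Matrix.mulVec_add, zero_add, add_zero]
  congr 1
  · congr 1 <;> abel
  · congr 1
    · congr 1 <;> abel
    · abel

theorem hMatrix_transform :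
    hMatrix G R (K.transform G R S M N L J L₂ J₂)
      = Matrix.fromBlocks 1 0 R M * (closedSystem G K).B₁ := by
  refine Matrix.mulVec_injective (funext fun d => ?_)
  simp only [closedSystem, Controller.transform,
    hMatrix, Matrix.add_mulVec, ← Matrix.mulVec_mulVec, col3_mulVec,
    row3_mulVec, Controller.toMatrix_mulVec, Matrix.fromBlocks_mulVec, Matrix.fromRows_mulVec,
    Sum.elim_comp_inl, Sum.elim_comp_inr, ← Sum.elim_add_add,
    Matrix.zero_mulVec, Matrix.one_mulVec, Matrix.mulVec_zero, zero_add, add_zero]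

theorem isUnit_leftFactor (hM : IsUnit M) (hL₂ : IsUnit L₂) : IsUnit (leftFactor G R M L L₂) := by
  rw [Matrix.isUnit_iff_isUnit_det] at hM hL₂
  refine IsUnit.of_mul_eq_one (col3 (row3 M⁻¹ (-(M⁻¹ * (R * G.B₂))) 0) (row3 0 1 0)
    (row3 0 (-(L₂⁻¹ * (L * G.D₀₂))) L₂⁻¹)) ?_
  simp only [leftFactor, col3_mul, row3_mul_col3, mul_row3, row3_add, Matrix.mul_zero,
    Matrix.zero_mul, Matrix.mul_one, Matrix.one_mul, Matrix.mul_neg, zero_add, add_zero,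
    Matrix.mul_nonsing_inv _ hM, Matrix.mul_nonsing_inv _ hL₂,
    Matrix.mul_nonsing_inv_cancel_left _ _ hM, Matrix.mul_nonsing_inv_cancel_left _ _ hL₂,
    neg_add_cancel, add_neg_cancel, col3_row3_one]

theorem isUnit_rightFactor (hN : IsUnit N) (hJ₂ : IsUnit J₂ᵀ) :
    IsUnit (rightFactor G S N J J₂) := by
  rw [Matrix.isUnit_iff_isUnit_det] at hN hJ₂
  refine IsUnit.of_mul_eq_one (col3 (row3 N⁻¹ 0 0)
    (row3 (-(G.C₂ * S * N⁻¹)) 1 (-(G.D₂₀ * J * J₂ᵀ⁻¹))) (row3 0 0 J₂ᵀ⁻¹)) ?_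
  simp only [rightFactor, col3_mul, row3_mul_col3, mul_row3, row3_add, Matrix.mul_zero,
    Matrix.zero_mul, Matrix.one_mul, zero_add, add_zero,
    Matrix.mul_nonsing_inv _ hN, Matrix.mul_nonsing_inv _ hJ₂,
    neg_add_cancel, add_neg_cancel, col3_row3_one]

end Synthesis

/-! ### Invertibility of the corner blocks -/

section Factors

variable {α : Type} [Fintype α] [DecidableEq α] {A B : Matrix α α ℝ}

theorem isUnit_of_isUnit_mul (h : IsUnit (A * B)) : IsUnit A ∧ IsUnit B := by
  rw [Matrix.isUnit_iff_isUnit_det, Matrix.det_mul, IsUnit.mul_iff] at h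
  simpa only [Matrix.isUnit_iff_isUnit_det] using h

theorem isUnit_of_isUnit_fromBlocks_one_zero
    (h : IsUnit (Matrix.fromBlocks (1 : Matrix α α ℝ) 0 A B)) : IsUnit B := by
  simpa [Matrix.isUnit_iff_isUnit_det] using h

theorem isUnit_of_isUnit_fromBlocks_one_zero'
    (h : IsUnit (Matrix.fromBlocks (1 : Matrix α α ℝ) A 0 B)) : IsUnit B := by
  simpa [Matrix.isUnit_iff_isUnit_det] using h

theorem isUnit_of_isUnit_fromBlocks_zero
    (h : IsUnit (Matrix.fromBlocks A (1 : Matrix α α ℝ) B 0)) : IsUnit B := by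
  rw [← Matrix.mulVec_injective_iff_isUnit] at h ⊢
  intro v w hvw
  have := @h (Sum.elim v (-(A *ᵥ v))) (Sum.elim w (-(A *ᵥ w))) (by
    simp [Matrix.fromBlocks_mulVec, hvw])
  exact (Sum.elim_eq_iff.1 this).1

theorem isUnit_of_isUnit_fromBlocks_zero'
    (h : IsUnit (Matrix.fromBlocks A B (1 : Matrix α α ℝ) 0)) : IsUnit B := by
  rw [← Matrix.mulVec_injective_iff_isUnit] at h ⊢
  intro v w hvw
  have := @h (Sum.elim 0 v) (Sum.elim 0 w) (by simp [Matrix.fromBlocks_mulVec, hvw])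
  exact (Sum.elim_eq_iff.1 this).2

end Factors

/-- A scaling of the closed loop built from commuting factors commutes with the uncertainty. -/
theorem isCommutant₂_congrInv {s f : ℕ} {m : Fin s → ℕ} {r : Fin f → ℕ}
    {L J L₂ J₂ : Matrix (Chan m r) (Chan m r) ℝ} (hL : L ∈ commutantSet m r) (hLt : Lᵀ = L)
    (hJ : J ∈ commutantSet m r) (hL₂ : L₂ ∈ commutantSet m r) (hJ₂ : J₂ ∈ commutantSet m r)
    (h : L₂ * J₂ᵀ = 1 - L * J) (hu : IsUnit J₂ᵀ)
    (hΘ : (Matrix.fromBlocks L 1 1 J).PosDef) :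
    IsCommutant₂ (congrInv (Matrix.fromBlocks L L₂ 1 0) (Matrix.fromBlocks L 1 1 J)) := by
  have hJ₂t := transpose_mem_commutantSet hJ₂
  have hL₂t := transpose_mem_commutantSet hL₂
  have hdet := (Matrix.isUnit_iff_isUnit_det _).1 hu
  set Z : Matrix (Chan m r ⊕ Chan m r) (Chan m r ⊕ Chan m r) ℝ := Matrix.fromBlocks 1 J 0 J₂ᵀ
    with hZ
  have hZu : IsUnit Z.det := by simpa [hZ, Matrix.isUnit_iff_isUnit_det] using hdet
  have hHZ : Matrix.fromBlocks L L₂ 1 0 * Z = Matrix.fromBlocks L 1 1 J := by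
    simp [hZ, Matrix.fromBlocks_multiply, h]
  have e : congrInv (Matrix.fromBlocks L L₂ 1 0) (Matrix.fromBlocks L 1 1 J)
      = Matrix.fromBlocks L L₂ L₂ᵀ (-(L₂ᵀ * J * J₂ᵀ⁻¹)) := by
    -- Multiplying by `Z` avoids inverting `[L 1; 1 J]`: as `H Z` equals that matrix, both sides
    -- reduce to `Hᵀ`.
    have e1 : congrInv (Matrix.fromBlocks L L₂ 1 0) (Matrix.fromBlocks L 1 1 J) * Z
        = Matrix.fromBlocks L L₂ L₂ᵀ (-(L₂ᵀ * J * J₂ᵀ⁻¹)) * Z := by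
      rw [congrInv, Matrix.mul_assoc, Matrix.mul_assoc, hHZ,
        Matrix.nonsing_inv_mul _ ((Matrix.isUnit_iff_isUnit_det _).1 hΘ.isUnit)]
      simp [hZ, Matrix.fromBlocks_multiply, Matrix.fromBlocks_transpose, hLt, h,
        Matrix.mul_assoc, Matrix.nonsing_inv_mul _ hdet]
    have e2 := congrArg (· * Z⁻¹) e1
    simpa only [Matrix.mul_assoc, Matrix.mul_nonsing_inv _ hZu, Matrix.mul_one] using e2
  rw [e]
  exact ⟨hL, hL₂, hL₂t, neg_mem_commutantSet (mul_mem_commutantSet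
    (mul_mem_commutantSet hL₂t hJ) (inv_mem_commutantSet hJ₂t hu))⟩

/-- The controllers given by the change of variables achieve the performance. -/
theorem achieves_of_transform {n nd ne nu ny s f : ℕ} {m : Fin s → ℕ} {r : Fin f → ℕ}
    (G : Plant n nd ne nu ny (Chan m r)) (K : Controller n nu ny (Chan m r)) {γ : ℝ} (hγ : 0 < γ)
    {Tp Tm : Matrix (Fin n ⊕ Fin n) (Fin n ⊕ Fin n) ℝ} (hTp : Tp.PosDef) (hTm : Tm.PosDef)
    {Q : Matrix (Fin nd) (Fin nd) ℝ} {L J L₂ J₂ : Matrix (Chan m r) (Chan m r) ℝ}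
    {R S U M N : Matrix (Fin n) (Fin n) ℝ}
    (hF : IsUnit (Matrix.fromBlocks (1 : Matrix (Fin n) (Fin n) ℝ) 0 R M))
    (hY : IsUnit (Matrix.fromBlocks S (1 : Matrix (Fin n) (Fin n) ℝ) N 0))
    (hH : IsUnit (Matrix.fromBlocks L L₂ (1 : Matrix (Chan m r) (Chan m r) ℝ) 0))
    (hZ : IsUnit (Matrix.fromBlocks (1 : Matrix (Chan m r) (Chan m r) ℝ) J 0 J₂ᵀ))
    (hMN : M * N = U - R * S) (hLJ : L₂ * J₂ᵀ = 1 - L * J)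
    (hΘ : (Matrix.fromBlocks L 1 1 J).PosDef)
    (hc : IsCommutant₂ (congrInv (Matrix.fromBlocks L L₂ 1 0) (Matrix.fromBlocks L 1 1 J)))
    (h₁ : (lmiMatrix G R S U L J (K.transform G R S M N L J L₂ J₂) Tp).PosDef)
    (h₂ : (lmiMatrix G R S U L J (K.transform G R S M N L J L₂ J₂) Tm).PosDef)
    (h₃ : (Matrix.fromBlocks Q (hMatrix G R (K.transform G R S M N L J L₂ J₂))ᵀ
      (hMatrix G R (K.transform G R S M N L J L₂ J₂)) (Tp - Tm)).PosDef)
    (h₄ : Q.trace < γ ^ 2) : Achieves G K γ := by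
  have hV : Matrix.fromBlocks (S + Sᵀ) (1 + Uᵀ) (U + 1) (Rᵀ + R)
      = Matrix.fromBlocks S 1 U R + (Matrix.fromBlocks S 1 U R)ᵀ := by
    simp [Matrix.fromBlocks_transpose, Matrix.fromBlocks_add, add_comm R]
  have hFY : Matrix.fromBlocks 1 0 R M * Matrix.fromBlocks S 1 N 0 = Matrix.fromBlocks S 1 U R := by
    simp [Matrix.fromBlocks_multiply, hMN]
  have hHZ : Matrix.fromBlocks L L₂ 1 0 * Matrix.fromBlocks 1 J 0 J₂ᵀ
      = Matrix.fromBlocks L 1 1 J := by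
    simp [Matrix.fromBlocks_multiply, hLJ]
  have hdiss : ∀ {T}, T.PosDef →
      (lmiMatrix G R S U L J (K.transform G R S M N L J L₂ J₂) T).PosDef →
      (closedSystem G K).Dissipative
        (congrInv (Matrix.fromBlocks L L₂ 1 0) (Matrix.fromBlocks L 1 1 J))
        (congrInv (Matrix.fromBlocks 1 0 R M) T) := by
    intro T hT h
    rw [lmiMatrix, hV] at h
    exact LinSys.dissipative_of_posDef hT hΘ hFY hHZ hY hZ (gMatrix_transform_mulVec G K) h
  have hΘ' := congrInv_posDef hH hΘ
  rw [hMatrix_transform] at h₃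
  rw [Achieves, ← closedSystem_toMatrix]
  constructor
  · refine LinSys.expStable (congrInv_posDef hF hTm) hΘ' (hdiss hTm h₂) ?_
    rintro _ ⟨Δ, hΔ, rfl⟩ q
    exact form_mulVec_le_of_mem_valueSet hΘ'.posSemidef hc hΔ q
  · exact LinSys.robustH2NormLT (Δ := Uncertainty.toCLM₂) (fun i q p => i.rel₂_iff q p) hΘ'
      (fun i q => i.inner_op_le hΘ'.posSemidef hc ((i.rel₂_iff _ _).2 rfl))
      (congrInv_posDef hF hTp) (congrInv_posDef hF hTm)
      (congrInv_sub_posDef hF hTp hTm (posDef_fromBlocks₂₂ h₃)) (hdiss hTp h₁) (hdiss hTm h₂) hγ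
      (form_congrInv_add_sub_le hTp hTm h₃) h₄

end RobustH2

end

/-! ### The synthesis theorem -/

theorem theorem2 {n nd ne nu ny s f : ℕ} (m : Fin s → ℕ) (r : Fin f → ℕ)
    (G : RobustH2.Plant n nd ne nu ny (RobustH2.Chan m r)) (γ : ℝ) (hγ : 0 < γ)
    (Tp Tm : Matrix (Fin n ⊕ Fin n) (Fin n ⊕ Fin n) ℝ) (hTp : Tp.PosDef) (hTm : Tm.PosDef)
    (Q : Matrix (Fin nd) (Fin nd) ℝ) (hQ : Q.PosDef)
    (L J : Matrix (RobustH2.Chan m r) (RobustH2.Chan m r) ℝ)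
    (hL : L ∈ RobustH2.scalingSet m r) (hJ : J ∈ RobustH2.scalingSet m r)
    (R S U : Matrix (Fin n) (Fin n) ℝ)
    (Khat : RobustH2.Controller n nu ny (RobustH2.Chan m r))
    (h₁ : (RobustH2.lmiMatrix G R S U L J Khat Tp).PosDef)
    (h₂ : (RobustH2.lmiMatrix G R S U L J Khat Tm).PosDef)
    (h₃ : (Matrix.fromBlocks Q (RobustH2.hMatrix G R Khat)ᵀ
      (RobustH2.hMatrix G R Khat) (Tp - Tm)).PosDef)
    (h₄ : Q.trace < γ ^ 2) :
    (∃ K : RobustH2.Controller n nu ny (RobustH2.Chan m r), RobustH2.Achieves G K γ) ∧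
    (∃ (M N : Matrix (Fin n) (Fin n) ℝ)
      (L₂ J₂ : Matrix (RobustH2.Chan m r) (RobustH2.Chan m r) ℝ),
      M * N = U - R * S ∧ L₂ ∈ RobustH2.commutantSet m r ∧ J₂ ∈ RobustH2.commutantSet m r ∧
      L₂ * J₂ᵀ = 1 - L * J) ∧
    ∀ (M N : Matrix (Fin n) (Fin n) ℝ)
      (L₂ J₂ : Matrix (RobustH2.Chan m r) (RobustH2.Chan m r) ℝ),
      M * N = U - R * S → L₂ ∈ RobustH2.commutantSet m r → J₂ ∈ RobustH2.commutantSet m r →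
      L₂ * J₂ᵀ = 1 - L * J →
      IsUnit (RobustH2.leftFactor G R M L L₂) ∧ IsUnit (RobustH2.rightFactor G S N J J₂) ∧
      ∃ K : RobustH2.Controller n nu ny (RobustH2.Chan m r),
        K.toMatrix = (RobustH2.leftFactor G R M L L₂)⁻¹ *
          (Khat.toMatrix - RobustH2.shiftTerm G R S L J) *
          (RobustH2.rightFactor G S N J J₂)⁻¹ ∧
        RobustH2.Achieves G K γ := by
  have hblock : ∀ {T}, (RobustH2.lmiMatrix G R S U L J Khat T).PosDef →
      (Matrix.fromBlocks S 1 U R + (Matrix.fromBlocks S 1 U R)ᵀ - T).PosDef ∧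
        (Matrix.fromBlocks L 1 1 J).PosDef := by
    intro T h
    have h' := RobustH2.posDef_fromBlocks₁₁ h
    refine ⟨?_, RobustH2.posDef_fromBlocks₂₂ h'⟩
    simpa [Matrix.fromBlocks_transpose, Matrix.fromBlocks_add, add_comm R]
      using RobustH2.posDef_fromBlocks₁₁ h'
  have hΘ := (hblock h₁).2
  have hV := RobustH2.isUnit_of_add_transpose_sub_posDef hTp (hblock h₁).1
  have hLc := RobustH2.mem_commutantSet_of_mem_scalingSet hL
  have hJc := RobustH2.mem_commutantSet_of_mem_scalingSet hJ
  have main : ∀ (M N : Matrix (Fin n) (Fin n) ℝ)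
      (L₂ J₂ : Matrix (RobustH2.Chan m r) (RobustH2.Chan m r) ℝ),
      M * N = U - R * S → L₂ ∈ RobustH2.commutantSet m r → J₂ ∈ RobustH2.commutantSet m r →
      L₂ * J₂ᵀ = 1 - L * J →
      IsUnit (RobustH2.leftFactor G R M L L₂) ∧ IsUnit (RobustH2.rightFactor G S N J J₂) ∧
      ∃ K : RobustH2.Controller n nu ny (RobustH2.Chan m r),
        K.toMatrix = (RobustH2.leftFactor G R M L L₂)⁻¹ *
          (Khat.toMatrix - RobustH2.shiftTerm G R S L J) *
          (RobustH2.rightFactor G S N J J₂)⁻¹ ∧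
        RobustH2.Achieves G K γ := by
    intro M N L₂ J₂ hMN hL₂ hJ₂ hLJ
    obtain ⟨hF, hY⟩ := RobustH2.isUnit_of_isUnit_mul
      (A := Matrix.fromBlocks 1 0 R M) (B := Matrix.fromBlocks S 1 N 0) (by
        simpa [Matrix.fromBlocks_multiply, hMN] using hV)
    obtain ⟨hH, hZ⟩ := RobustH2.isUnit_of_isUnit_mul
      (A := Matrix.fromBlocks L L₂ 1 0) (B := Matrix.fromBlocks 1 J 0 J₂ᵀ) (by
        simpa [Matrix.fromBlocks_multiply, hLJ] using hΘ.isUnit)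
    have hMu := RobustH2.isUnit_of_isUnit_fromBlocks_one_zero hF
    have hNu := RobustH2.isUnit_of_isUnit_fromBlocks_zero hY
    have hL₂u := RobustH2.isUnit_of_isUnit_fromBlocks_zero' hH
    have hJ₂u := RobustH2.isUnit_of_isUnit_fromBlocks_one_zero' hZ
    have hl := RobustH2.isUnit_leftFactor G (R := R) (L := L) hMu hL₂u
    have hr := RobustH2.isUnit_rightFactor G (S := S) (J := J) hNu hJ₂u
    -- From here the transformed data are those of an actual controller `K`, and the inequalities
    -- can be read as statements about its closed loop.
    obtain ⟨K, rfl⟩ := RobustH2.exists_transform_eq G Khat (R := R) (S := S) (L := L) (J := J)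
      hMu hNu hL₂u hJ₂u
    refine ⟨hl, hr, K, ?_, RobustH2.achieves_of_transform G K hγ hTp hTm hF hY hH hZ hMN hLJ hΘ
      (RobustH2.isCommutant₂_congrInv hLc (RobustH2.transpose_of_mem_scalingSet hL) hJc hL₂ hJ₂
        hLJ hJ₂u hΘ) h₁ h₂ h₃ h₄⟩
    rw [Matrix.isUnit_iff_isUnit_det] at hl hr
    rw [RobustH2.transform_toMatrix, add_sub_cancel_right, Matrix.mul_assoc _ K.toMatrix,
      Matrix.nonsing_inv_mul_cancel_left _ _ hl, Matrix.mul_nonsing_inv_cancel_right _ _ hr]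
  have hex : ∃ (M N : Matrix (Fin n) (Fin n) ℝ)
      (L₂ J₂ : Matrix (RobustH2.Chan m r) (RobustH2.Chan m r) ℝ),
      M * N = U - R * S ∧ L₂ ∈ RobustH2.commutantSet m r ∧ J₂ ∈ RobustH2.commutantSet m r ∧
      L₂ * J₂ᵀ = 1 - L * J :=
    -- The trivial factorizations suffice: the commutant is closed under products and differences,
    -- so it contains `1 - L * J`.
    ⟨U - R * S, 1, 1 - L * J, 1, mul_one _,
      RobustH2.sub_mem_commutantSet RobustH2.one_mem_commutantSet
        (RobustH2.mul_mem_commutantSet hLc hJc),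
      RobustH2.one_mem_commutantSet, by rw [Matrix.transpose_one, mul_one]⟩
  refine ⟨?_, hex, main⟩
  obtain ⟨M, N, L₂, J₂, hMN, hL₂, hJ₂, hLJ⟩ := hex
  obtain ⟨-, -, K, -, hK⟩ := main M N L₂ J₂ hMN hL₂ hJ₂ hLJ
  exact ⟨K, hK⟩
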